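/- Let $s_1,\dots,s_{n-1}$ be the standard generators of the braid group $B_n$ and $\bar s_i=s_i^{-1}$; let $\mathbb{Q}(t_0,t_1)$ be the field of rational functions in two variables. Consider the following relations in the group algebra $\mathbb{Q}(t_0,t_1)[B_n]$. $(R_1)$, for $1\le i\le n-1$: $s_i^2+(1-t_0-t_1)s_i+(t_0t_1-t_0-t_1)1+t_0t_1\bar s_i=0$. $(R_2)$, for $1\le i,j\le n-1$ with $|i-j|=1$: $\bar s_i s_j s_i-s_i s_j\bar s_i-\bar s_i\bar s_j s_i+s_i\bar s_j\bar s_i=s_i s_j-s_i\bar s_j-\bar s_i s_j+\bar s_i\bar s_j-s_j s_i+s_j\bar s_i+\bar s_j s_i-\bar s_j\bar s_i$. $(R_3)$, for $1\le i\le n-3$, $j=i+1$, $k=i+2$: $s_i\bar s_k s_j\bar s_k-\bar s_k s_j\bar s_k s_i=\sum_{l=1}^{78}a_l w_l$, where the coefficients $a_l\in\mathbb{Q}(t_0,t_1)$ and the words $w_l$ are listed at the end. **R-matrices.** For a finite-dimensional vector space $V$ and an invertible $R\in\mathrm{End}(V\otimes V)$ satisfying $R_{12}R_{23}R_{12}=R_{23}R_{12}R_{23}$,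 let $\rho_R:B_n\to GL(V^{\otimes n})$ be the representation that sends $s_i$ to $R$ acting on the tensor factors $i$ and $i+1$. For a diagonal $h\in\mathrm{End}(V)$, the closure of a braid $\beta\in B_n$ has the value $\langle\beta\rangle_{R,h}=\frac{1}{\dim V}\mathrm{tr}\big((\mathrm{id}_V\otimes h^{\otimes(n-1)})\circ\rho_R(\beta)\big)$. $V_1$: the base field is $\mathbb{Q}(t_0,t_1)$, $V$ has the basis $v_1,\dots,v_4$, $v_{ij}=v_i\otimes v_j$, $h_V=\mathrm{diag}(-1,1,1,-1)$, and $R_V$ is given by $v_{11}\mapsto -v_{11}$, $v_{12}\mapsto -t_0v_{21}$, $v_{13}\mapsto -t_1v_{31}$, $v_{14}\mapsto -t_0t_1v_{41}$, $v_{21}\mapsto -v_{12}+(t_0-1)v_{21}$, $v_{22}\mapsto t_0v_{22}$, $v_{23}\mapsto -t_1v_{32}+(t_0-1)t_1v_{41}$, $v_{24}\mapsto t_0t_1v_{42}$, $v_{31}\mapsto -v_{13}+(t_1-1)v_{31}$, $v_{32}\mapsto -t_1^{-1}v_{23}+(1-t_0)v_{41}$, $v_{33}\mapsto t_1v_{33}$,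 $v_{34}\mapsto v_{43}$, $v_{41}\mapsto -v_{14}+(t_1^{-1}-1)v_{23}+(t_1-1)v_{32}+(t_0+t_1-2)v_{41}$, $v_{42}\mapsto t_1^{-1}v_{24}+(t_0-1)v_{42}$, $v_{43}\mapsto t_1v_{34}+(t_1-1)v_{43}$, $v_{44}\mapsto -v_{44}$. $\mathrm{LG}$: the base field is any field extension of $\mathbb{Q}(t_0,t_1)$ with chosen square roots $t_0^{1/2}$, $t_1^{1/2}$ and $Y=\sqrt{(t_0-1)(1-t_1)}$, $W$ has the basis $w_1,\dots,w_4$, $w_{ij}=w_i\otimes w_j$ (these vectors are not to be confused with the words $w_l$), $h_{\mathrm{LG}}=\mathrm{diag}(t_0^{-1},-t_1,-t_0^{-1},t_1)$, and $R_{\mathrm{LG}}$ is given by $w_{11}\mapsto t_0w_{11}$, $w_{12}\mapsto t_0^{1/2}w_{21}$, $w_{13}\mapsto t_0^{1/2}w_{31}$, $w_{14}\mapsto w_{41}$, $w_{21}\mapsto t_0^{1/2}w_{12}+(t_0-1)w_{21}$, $w_{22}\mapsto -w_{22}$, $w_{23}\mapsto (t_0t_1-1)w_{23}-t_0^{1/2}t_1^{1/2}w_{32}-t_0^{1/2}t_1^{1/2}Yw_{41}$,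 $w_{24}\mapsto t_1^{1/2}w_{42}$, $w_{31}\mapsto t_0^{1/2}w_{13}+(t_0-1)w_{31}$, $w_{32}\mapsto -t_0^{1/2}t_1^{1/2}w_{23}+Yw_{41}$, $w_{33}\mapsto -w_{33}$, $w_{34}\mapsto t_1^{1/2}w_{43}$, $w_{41}\mapsto w_{14}-t_0^{1/2}t_1^{1/2}Yw_{23}+Yw_{32}+Y^2w_{41}$, $w_{42}\mapsto t_1^{1/2}w_{24}+(t_1-1)w_{42}$, $w_{43}\mapsto t_1^{1/2}w_{34}+(t_1-1)w_{43}$, $w_{44}\mapsto t_1w_{44}$. **Lemma.** For every $n\ge 1$ and for $(R,h)=(R_V,h_V)$ as well as $(R,h)=(R_{\mathrm{LG}},h_{\mathrm{LG}})$: (a) the operators $\rho_R(s_i)$ satisfy all the relations $(R_1)$, $(R_2)$, $(R_3)$ in $B_n$; (b) the invariants $V_1$ and $\mathrm{LG}$ satisfy these skein relations: writing a relation as $\sum_\gamma c_\gamma\gamma=0$ with $c_\gamma\in\mathbb{Q}(t_0,t_1)$ and $\gamma\in B_n$, one has $\sum_\gamma c_\gamma\langle\alpha\gamma\beta\rangle_{R,h}=0$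 for all $\alpha,\beta\in B_n$. **Coefficients and words of $(R_3)$.** Put $P=1 + t_1 t_0 + t_1^2 t_0 + t_1 t_0^2$, $Q=t_1 + t_0 + t_1 t_0 + t_1^2 t_0^2$, $N=-t_1^2 - t_1 t_0 - t_1^2 t_0 - t_0^2 - t_1 t_0^2 + t_1^2 t_0^2$, $M=t_1 - t_1^2 + t_0 - t_1 t_0 + t_1^2 t_0 - t_0^2 + t_1 t_0^2 + t_1^2 t_0^2$, $L=t_1^2 + t_1 t_0 + t_0^2 - t_1^2 t_0^2 + t_1^3 t_0^2 + t_1^2 t_0^3$, $D_1=t_1 (1 + t_1) t_0 (1 + t_0) (t_1 + t_0) (1 + t_1 t_0)$, $D_2=t_1 (1 + t_1) t_0 (1 + t_0) (t_1 + t_0) (t_1 t_0 - 1) (1 + t_1 t_0)$, $D_3=(1 + t_1) (1 + t_0) (t_1 + t_0) (1 + t_1 t_0)$, $D_4=(1 + t_1) (1 + t_0) (t_1 + t_0) (t_1 t_0 - 1) (1 + t_1 t_0)$. Then $a_{1} = -\frac{(t_1 - 1) (t_0 - 1) (-t_1 - t_0 - 2 t_1 t_0 - t_1^2 t_0 - t_1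 t_0^2 + t_1^3 t_0^2 + t_1^2 t_0^3)}{t_1 t_0 (t_1 + t_0) (t_1 t_0 - 1) (1 + t_1 t_0)},\quad w_{1} = s_i s_j$ $a_{2} = -\frac{(t_1 - 1) (t_0 - 1) (t_1 + t_0 + 2 t_1 t_0)}{(t_1 + t_0) (t_1 t_0 - 1) (1 + t_1 t_0)},\quad w_{2} = s_i \bar s_j$ $a_{3} = \frac{(t_1 - 1) (t_0 - 1) (-t_1 - t_0 - 2 t_1 t_0 - t_1^2 t_0 - t_1 t_0^2 + t_1^3 t_0^2 + t_1^2 t_0^3)}{t_1 t_0 (t_1 + t_0) (t_1 t_0 - 1) (1 + t_1 t_0)},\quad w_{3} = s_j s_i$ $a_{4} = \frac{(t_1 - 1) (t_0 - 1) (t_1 + t_0 + 2 t_1 t_0)}{(t_1 + t_0) (t_1 t_0 - 1) (1 + t_1 t_0)},\quad w_{4} = \bar s_j s_i$ $a_{5} = \frac{P}{t_1 (1 + t_1) t_0 (1 + t_0) (1 + t_1 t_0)},\quad w_{5} = s_k s_j$ $a_{6} = -\frac{Q}{t_1 (1 + t_1) t_0 (1 + t_0) (1 + t_1 t_0)},\quad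 w_{6} = \bar s_k s_j$ $a_{7} = -\frac{P M}{D_1},\quad w_{7} = s_k \bar s_j$ $a_{8} = \frac{Q M}{D_1},\quad w_{8} = \bar s_k \bar s_j$ $a_{9} = -\frac{P}{t_1 (1 + t_1) t_0 (1 + t_0) (1 + t_1 t_0)},\quad w_{9} = s_j s_k$ $a_{10} = \frac{P M}{D_1},\quad w_{10} = \bar s_j s_k$ $a_{11} = \frac{Q}{t_1 (1 + t_1) t_0 (1 + t_0) (1 + t_1 t_0)},\quad w_{11} = s_j \bar s_k$ $a_{12} = -\frac{Q M}{D_1},\quad w_{12} = \bar s_j \bar s_k$ $a_{13} = \frac{N}{D_1},\quad w_{13} = s_i s_k s_j$ $a_{14} = \frac{-t_1 + t_1^2 - t_0 + t_1 t_0 + t_1^2 t_0 + t_0^2 + t_1 t_0^2 - t_1^2 t_0^2 + 2 t_1^3 t_0^2 + t_1^4 t_0^2 + 2 t_1^2 t_0^3 + 2 t_1^3 t_0^3 + t_1^4 t_0^3 + t_1^2 t_0^4 + t_1^3 t_0^4}{D_1},\quad w_{14} = s_i s_k \bar s_j$ $a_{15} = -\frac{-t_1^3 - t_1 t_0 - t_1^4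 t_0 - t_1^2 t_0^2 - t_0^3 + t_1^4 t_0^3 - t_1 t_0^4 + t_1^3 t_0^4}{D_1},\quad w_{15} = s_i \bar s_k s_j$ $a_{16} = -\frac{-t_1^2 + t_1^3 - t_1 t_0 + t_1^2 t_0 + t_1^3 t_0 - t_0^2 + t_1 t_0^2 + 3 t_1^2 t_0^2 + t_1^4 t_0^2 + t_0^3 + t_1 t_0^3 + 2 t_1^3 t_0^3 + t_1^4 t_0^3 + t_1^2 t_0^4 + t_1^3 t_0^4}{D_1},\quad w_{16} = s_i \bar s_k \bar s_j$ $a_{17} = -\frac{P}{D_3},\quad w_{17} = \bar s_i s_k s_j$ $a_{18} = -\frac{(t_1 + t_0 - 1) P}{D_3},\quad w_{18} = \bar s_i s_k \bar s_j$ $a_{19} = \frac{Q}{D_3},\quad w_{19} = \bar s_i \bar s_k s_j$ $a_{20} = \frac{(t_1 + t_0 - 1) Q}{D_3},\quad w_{20} = \bar s_i \bar s_k \bar s_j$ $a_{21} = -\frac{Q}{D_1},\quad w_{21} = s_i s_j s_k$ $a_{22} = -\frac{-t_1^2 - t_1 t_0 - t_1^4 t_0 - t_0^2 + t_1^2 t_0^2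 - t_1^3 t_0^2 - t_1^2 t_0^3 + t_1^4 t_0^3 - t_1 t_0^4 + t_1^3 t_0^4}{D_1},\quad w_{22} = s_i s_j \bar s_k$ $a_{23} = \frac{t_1 - t_1^2 + t_0 - t_1 t_0 - t_1^4 t_0 - t_0^2 + t_1^2 t_0^2 - 2 t_1^3 t_0^2 - 2 t_1^2 t_0^3 + t_1^4 t_0^3 - t_1 t_0^4 + t_1^3 t_0^4}{D_1},\quad w_{23} = s_i \bar s_j s_k$ $a_{24} = -\frac{(t_1 + t_0 - 1) N}{D_1},\quad w_{24} = s_i \bar s_j \bar s_k$ $a_{25} = \frac{P}{D_3},\quad w_{25} = \bar s_i s_j s_k$ $a_{26} = -\frac{Q}{D_3},\quad w_{26} = \bar s_i s_j \bar s_k$ $a_{27} = \frac{(t_1 + t_0 - 1) P}{D_3},\quad w_{27} = \bar s_i \bar s_j s_k$ $a_{28} = -\frac{(t_1 + t_0 - 1) Q}{D_3},\quad w_{28} = \bar s_i \bar s_j \bar s_k$ $a_{29} = \frac{(1 + t_1) (1 + t_0)}{(t_1 + t_0) (t_1 t_0 - 1) (1 + t_1 t_0)},\quad w_{29} = s_j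 s_i s_k$ $a_{30} = \frac{-1 - 2 t_1 + t_1^2 - 2 t_0 + t_1 t_0 - t_1^3 t_0 + t_0^2 - 2 t_1^2 t_0^2 + t_1^3 t_0^2 - t_1 t_0^3 + t_1^2 t_0^3}{(t_1 + t_0) (t_1 t_0 - 1) (1 + t_1 t_0)},\quad w_{30} = s_j s_i \bar s_k$ $a_{31} = \frac{P N}{D_2},\quad w_{31} = s_j \bar s_i s_k$ $a_{32} = -\frac{Q N}{D_2},\quad w_{32} = s_j \bar s_i \bar s_k$ $a_{33} = -\frac{t_1 + t_0 + t_1 t_0 + t_1^2 t_0 + t_1^3 t_0 + t_1 t_0^2 + 4 t_1^2 t_0^2 - t_1^4 t_0^2 + t_1 t_0^3 - t_1^3 t_0^3 + t_1^4 t_0^3 + t_1^5 t_0^3 - t_1^2 t_0^4 + t_1^3 t_0^4 + 2 t_1^4 t_0^4 + t_1^5 t_0^4 + t_1^3 t_0^5 + t_1^4 t_0^5}{D_2},\quad w_{33} = \bar s_j s_i s_k$ $a_{34} = \frac{t_1^2 + 3 t_1 t_0 + 2 t_1^2 t_0 - t_1^3 t_0 + t_0^2 + 2 t_1 t_0^2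 + t_1^3 t_0^2 - t_1 t_0^3 + t_1^2 t_0^3 + t_1^3 t_0^3 + t_1^5 t_0^3 + 2 t_1^4 t_0^4 + t_1^5 t_0^4 + t_1^3 t_0^5 + t_1^4 t_0^5}{D_2},\quad w_{34} = \bar s_j s_i \bar s_k$ $a_{35} = \frac{P L}{D_2},\quad w_{35} = \bar s_j \bar s_i s_k$ $a_{36} = -\frac{Q L}{D_2},\quad w_{36} = \bar s_j \bar s_i \bar s_k$ $a_{37} = -\frac{Q}{t_1 t_0 (t_1 + t_0) (t_1 t_0 - 1) (1 + t_1 t_0)},\quad w_{37} = s_k s_j s_i$ $a_{38} = -\frac{P N}{D_2},\quad w_{38} = s_k s_j \bar s_i$ $a_{39} = \frac{t_1 + t_0 + t_1 t_0 + 2 t_1^2 t_0 + t_1^3 t_0 - t_1^4 t_0 + 2 t_1 t_0^2 + 4 t_1^2 t_0^2 - t_1^3 t_0^2 + t_1^5 t_0^2 + t_1 t_0^3 - t_1^2 t_0^3 + t_1^3 t_0^3 + 3 t_1^4 t_0^3 - t_1 t_0^4 + 3 t_1^3 t_0^4 - t_1^5 t_0^4 + t_1^2 t_0^5 - t_1^4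 t_0^5}{D_2},\quad w_{39} = s_k \bar s_j s_i$ $a_{40} = -\frac{P L}{D_2},\quad w_{40} = s_k \bar s_j \bar s_i$ $a_{41} = \frac{t_1^2 + 3 t_1 t_0 - t_1^2 t_0 + t_0^2 - t_1 t_0^2 + t_1^2 t_0^2 + t_1^3 t_0^2 - t_1^4 t_0^2 + t_1^2 t_0^3 - 2 t_1^3 t_0^3 + t_1^4 t_0^3 - t_1^2 t_0^4 + t_1^3 t_0^4}{t_1 t_0 (t_1 + t_0) (t_1 t_0 - 1) (1 + t_1 t_0)},\quad w_{41} = \bar s_k s_j s_i$ $a_{42} = \frac{Q N}{D_2},\quad w_{42} = \bar s_k s_j \bar s_i$ $a_{43} = -\frac{t_1^2 + 3 t_1 t_0 + 2 t_1^2 t_0 - t_1^3 t_0 + t_0^2 + 2 t_1 t_0^2 + 2 t_1^3 t_0^2 + t_1^4 t_0^2 - t_1 t_0^3 + 2 t_1^2 t_0^3 + 3 t_1^3 t_0^3 + t_1^2 t_0^4}{D_2},\quad w_{43} = \bar s_k \bar s_j s_i$ $a_{44} = \frac{Q L}{D_2},\quad w_{44} = \bar s_k \bar s_j \bar s_i$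 $a_{45} = \frac{P Q}{D_4},\quad w_{45} = s_k \bar s_i \bar s_j \bar s_i$ $a_{46} = -\frac{Q^2}{D_4},\quad w_{46} = \bar s_k \bar s_i \bar s_j \bar s_i$ $a_{47} = \frac{P}{D_3},\quad w_{47} = s_k \bar s_i \bar s_j s_i$ $a_{48} = -\frac{Q}{D_3},\quad w_{48} = \bar s_k \bar s_i \bar s_j s_i$ $a_{49} = -\frac{(t_1 + t_0 + 2 t_1 t_0) P}{D_4},\quad w_{49} = s_k \bar s_i s_j \bar s_i$ $a_{50} = \frac{(t_1 + t_0 + 2 t_1 t_0) Q}{D_4},\quad w_{50} = \bar s_k \bar s_i s_j \bar s_i$ $a_{51} = \frac{P N}{D_2},\quad w_{51} = s_k s_i \bar s_j \bar s_i$ $a_{52} = -\frac{Q N}{D_2},\quad w_{52} = \bar s_k s_i \bar s_j \bar s_i$ $a_{53} = -\frac{(t_1 + t_0 + t_1 t_0) P}{D_1},\quad w_{53} = s_k s_i \bar s_j s_i$ $a_{54} = \frac{(t_1 + t_0 + t_1 t_0) Q}{D_1},\quad w_{54} = \bar s_k s_i \bar s_j s_i$ $a_{55} = \frac{P (t_1^2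 + t_1^2 t_0 + t_0^2 + t_1 t_0^2)}{D_2},\quad w_{55} = s_k s_i s_j \bar s_i$ $a_{56} = -\frac{(t_1^2 + t_1^2 t_0 + t_0^2 + t_1 t_0^2) Q}{D_2},\quad w_{56} = \bar s_k s_i s_j \bar s_i$ $a_{57} = -\frac{P Q}{D_4},\quad w_{57} = \bar s_i \bar s_j \bar s_i s_k$ $a_{58} = \frac{Q^2}{D_4},\quad w_{58} = \bar s_i \bar s_j \bar s_i \bar s_k$ $a_{59} = -\frac{P}{D_3},\quad w_{59} = \bar s_i \bar s_j s_i s_k$ $a_{60} = \frac{Q}{D_3},\quad w_{60} = \bar s_i \bar s_j s_i \bar s_k$ $a_{61} = \frac{(t_1 + t_0 + 2 t_1 t_0) P}{D_4},\quad w_{61} = \bar s_i s_j \bar s_i s_k$ $a_{62} = -\frac{(t_1 + t_0 + 2 t_1 t_0) Q}{D_4},\quad w_{62} = \bar s_i s_j \bar s_i \bar s_k$ $a_{63} = -\frac{P N}{D_2},\quad w_{63} = s_i \bar s_j \bar s_i s_k$ $a_{64} = \frac{Q N}{D_2},\quad w_{64} = s_i \bar s_j \bar s_i \bar s_k$ $a_{65}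 = \frac{(t_1 + t_0 + t_1 t_0) P}{D_1},\quad w_{65} = s_i \bar s_j s_i s_k$ $a_{66} = -\frac{(t_1 + t_0 + t_1 t_0) Q}{D_1},\quad w_{66} = s_i \bar s_j s_i \bar s_k$ $a_{67} = -\frac{P (t_1^2 + t_1^2 t_0 + t_0^2 + t_1 t_0^2)}{D_2},\quad w_{67} = s_i s_j \bar s_i s_k$ $a_{68} = \frac{(t_1^2 + t_1^2 t_0 + t_0^2 + t_1 t_0^2) Q}{D_2},\quad w_{68} = s_i s_j \bar s_i \bar s_k$ $a_{69} = \frac{1}{t_1 + t_0},\quad w_{69} = s_i \bar s_j \bar s_k s_j$ $a_{70} = \frac{t_1 t_0}{1 + t_1 t_0},\quad w_{70} = s_i \bar s_j s_k \bar s_j$ $a_{71} = \frac{(t_1 - 1) (1 + t_1) (t_0 - 1) (1 + t_0)}{(t_1 + t_0) (t_1 t_0 - 1) (1 + t_1 t_0)},\quad w_{71} = s_i s_j \bar s_k \bar s_j$ $a_{72} = -\frac{1}{1 + t_1 t_0},\quad w_{72} = s_i s_j \bar s_k s_j$ $a_{73} = \frac{t_1^2 + t_0^2 - 2}{(t_1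 + t_0) (t_1 t_0 - 1) (1 + t_1 t_0)},\quad w_{73} = s_i s_j s_k \bar s_j$ $a_{74} = -\frac{1}{t_1 + t_0},\quad w_{74} = \bar s_j \bar s_k s_j s_i$ $a_{75} = -\frac{t_1 t_0}{1 + t_1 t_0},\quad w_{75} = \bar s_j s_k \bar s_j s_i$ $a_{76} = -\frac{(t_1 - 1) (1 + t_1) (t_0 - 1) (1 + t_0)}{(t_1 + t_0) (t_1 t_0 - 1) (1 + t_1 t_0)},\quad w_{76} = s_j \bar s_k \bar s_j s_i$ $a_{77} = \frac{1}{1 + t_1 t_0},\quad w_{77} = s_j \bar s_k s_j s_i$ $a_{78} = -\frac{t_1^2 + t_0^2 - 2}{(t_1 + t_0) (t_1 t_0 - 1) (1 + t_1 t_0)},\quad w_{78} = s_j s_k \bar s_j s_i$ -/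

import Mathlib

namespace LinksGould

open scoped Matrix

/-! ### Two-site operators on tensor powers -/

section LocalOperators

variable {K : Type*} [Field K] {ι : Type*} [Fintype ι] [DecidableEq ι]
  {P : Type*} [Fintype P] [DecidableEq P]

/-- Let `V` have basis `(v_x)_{x ∈ ι}`.  The tensor power of `V` over a finite set `P` of positions
has the basis `(⊗_k v_{f k})` indexed by `f : P → ι`.  `localOp M p q` is the operator (as a matrix
in this basis) that applies `M : End (V ⊗ V)` to the tensor factors at `p` and `q` (in this order)
and is the identity on all other factors. -/
def localOp (M : Matrix (ι × ι) (ι × ι) K) (p q : P) : Matrix (P → ι) (P → ι) K :=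
  Matrix.of fun f g =>
    if ∀ k, k ≠ p → k ≠ q → f k = g k then M (f p, f q) (g p, g q) else 0

theorem localOp_mulVec (M : Matrix (ι × ι) (ι × ι) K) {p q : P} (hpq : p ≠ q)
    (φ : (P → ι) → K) (f : P → ι) :
    (localOp M p q *ᵥ φ) f =
      ∑ x : ι × ι, M (f p, f q) x *
        φ (Function.update (Function.update f p x.1) q x.2) := by
  classical
  simp only [Matrix.mulVec, dotProduct, localOp, Matrix.of_apply, ite_mul, zero_mul]
  rw [← Finset.sum_filter]
  refine Finset.sum_bij' (fun g _ => (g p, g q))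
    (fun x _ => Function.update (Function.update f p x.1) q x.2) ?_ ?_ ?_ ?_ ?_
  · intros; simp
  · intro x _
    simp only [Finset.mem_filter, Finset.mem_univ, true_and]
    intro k h1 h2
    simp [h1, h2]
  · intro g hg
    simp only [Finset.mem_filter, Finset.mem_univ, true_and] at hg
    funext k
    by_cases h2 : k = q
    · subst h2; simp
    · by_cases h1 : k = p
      · subst h1; simp [h2]
      · simp [h1, h2, hg k h1 h2]
  · intro x _
    simp [hpq]
  · intro g hg
    simp only [Finset.mem_filter, Finset.mem_univ, true_and] at hg
    have : Function.update (Function.update f p (g p)) q (g q) = g := by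
      funext k
      by_cases h2 : k = q
      · subst h2; simp
      · by_cases h1 : k = p
        · subst h1; simp [h2]
        · simp [h1, h2, hg k h1 h2]
    simp [this]

theorem matrix_ext_mulVec {n : Type*} [Fintype n] [DecidableEq n] {A B : Matrix n n K}
    (h : ∀ φ : n → K, ∀ f, (A *ᵥ φ) f = (B *ᵥ φ) f) : A = B :=
  Matrix.mulVec_injective (funext fun φ => funext fun f => h φ f)

theorem localOp_one {p q : P} (hpq : p ≠ q) :
    localOp (1 : Matrix (ι × ι) (ι × ι) K) p q = 1 := by
  refine matrix_ext_mulVec fun φ f => ?_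
  rw [localOp_mulVec _ hpq]
  simp [Matrix.one_apply]

theorem localOp_mul (M N : Matrix (ι × ι) (ι × ι) K) {p q : P} (hpq : p ≠ q) :
    localOp (M * N) p q = localOp M p q * localOp N p q := by
  refine matrix_ext_mulVec fun φ f => ?_
  rw [← Matrix.mulVec_mulVec, localOp_mulVec _ hpq, localOp_mulVec _ hpq]
  simp only [localOp_mulVec _ hpq, Matrix.mul_apply, Finset.sum_mul, Finset.mul_sum]
  rw [Finset.sum_comm]
  refine Finset.sum_congr rfl fun x _ => Finset.sum_congr rfl fun y _ => ?_
  have h : Function.update (Function.update (Function.update (Function.update f p x.1) q x.2)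
      p y.1) q y.2 = Function.update (Function.update f p y.1) q y.2 := by
    rw [Function.update_comm hpq.symm, Function.update_idem, Function.update_idem]
  simp [hpq, h, mul_assoc]

theorem localOp_comm (M N : Matrix (ι × ι) (ι × ι) K) {p q r s : P} (hpq : p ≠ q) (hrs : r ≠ s)
    (hpr : p ≠ r) (hps : p ≠ s) (hqr : q ≠ r) (hqs : q ≠ s) :
    localOp M p q * localOp N r s = localOp N r s * localOp M p q := by
  refine matrix_ext_mulVec fun φ f => ?_
  rw [← Matrix.mulVec_mulVec, ← Matrix.mulVec_mulVec, localOp_mulVec _ hpq, localOp_mulVec _ hrs]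
  simp only [localOp_mulVec _ hpq, localOp_mulVec _ hrs, Finset.mul_sum]
  rw [Finset.sum_comm]
  refine Finset.sum_congr rfl fun x _ => Finset.sum_congr rfl fun y _ => ?_
  have h : Function.update (Function.update (Function.update (Function.update f p y.1) q y.2)
      r x.1) s x.2 = Function.update (Function.update (Function.update (Function.update f r x.1)
        s x.2) p y.1) q y.2 := by
    rw [Function.update_comm hqr, Function.update_comm hqs,
      Function.update_comm hpr, Function.update_comm hps]
  rw [h]
  simp [hpr, hps, hqr, hqs, hpr.symm, hps.symm, hqr.symm, hqs.symm]
  ring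

/-- Local operators only see the positions they involve. -/
theorem localOp_mulVec_extend {Q : Type*} [Fintype Q] [DecidableEq Q] {e : Q → P}
    (he : Function.Injective e) (M : Matrix (ι × ι) (ι × ι) K) {p q : Q} (hpq : p ≠ q)
    (φ : (P → ι) → K) (f : P → ι) (g : Q → ι) :
    (localOp M (e p) (e q) *ᵥ φ) (Function.extend e g f) =
      (localOp M p q *ᵥ fun g' => φ (Function.extend e g' f)) g := by
  have key : ∀ (g : Q → ι) (p : Q) (a : ι),
      Function.update (Function.extend e g f) (e p) a =
        Function.extend e (Function.update g p a) f := by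
    intro g p a
    funext k
    by_cases hk : ∃ j, e j = k
    · obtain ⟨j, rfl⟩ := hk
      simp [he.extend_apply, Function.update_apply, he.eq_iff]
    · have : k ≠ e p := fun h => hk ⟨p, h.symm⟩
      simp [this, Function.extend_apply' _ _ _ hk]
  rw [localOp_mulVec _ (he.ne hpq), localOp_mulVec _ hpq]
  simp [key, he.extend_apply]

theorem localOp_braid (M : Matrix (ι × ι) (ι × ι) K)
    (h : localOp M (0 : Fin 3) 1 * localOp M 1 2 * localOp M 0 1 =
      localOp M (1 : Fin 3) 2 * localOp M 0 1 * localOp M 1 2)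
    {p q r : P} (hpq : p ≠ q) (hpr : p ≠ r) (hqr : q ≠ r) :
    localOp M p q * localOp M q r * localOp M p q =
      localOp M q r * localOp M p q * localOp M q r := by
  have he : Function.Injective ![p, q, r] := by
    intro a b
    fin_cases a <;> fin_cases b <;> simp [hpq, hpr, hqr, hpq.symm, hpr.symm, hqr.symm]
  refine matrix_ext_mulVec fun φ f => ?_
  have hf : f = Function.extend ![p, q, r] (f ∘ ![p, q, r]) f := by
    funext k
    by_cases hk : ∃ j, ![p, q, r] j = k
    · obtain ⟨j, rfl⟩ := hk
      simp [he.extend_apply]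
    · simp [Function.extend_apply' _ _ _ hk]
  have h01 := fun φ f g => localOp_mulVec_extend he M (p := 0) (q := 1) (by decide) φ f g
  have h12 := fun φ f g => localOp_mulVec_extend he M (p := 1) (q := 2) (by decide) φ f g
  simp only [Matrix.cons_val] at h01 h12
  rw [hf]
  simp only [← Matrix.mulVec_mulVec, h01, h12]
  have := congrFun (congrArg (fun A => A *ᵥ fun g => φ (Function.extend ![p, q, r] g f)) h)
    (f ∘ ![p, q, r])
  simpa only [← Matrix.mulVec_mulVec] using this

end LocalOperators

/-! ### Braid groups, R-matrices and the resulting braid representations -/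

/-- The defining relations of the braid group on `n` strands, on generators `s_0, …, s_{n-2}`. -/
inductive BraidRel (n : ℕ) : FreeGroup (Fin (n - 1)) → Prop
  | braid (i j : Fin (n - 1)) (h : j.val = i.val + 1) :
      BraidRel n (FreeGroup.of i * FreeGroup.of j * FreeGroup.of i *
        (FreeGroup.of j * FreeGroup.of i * FreeGroup.of j)⁻¹)
  | far (i j : Fin (n - 1)) (h : i.val + 1 < j.val) :
      BraidRel n (FreeGroup.of i * FreeGroup.of j * (FreeGroup.of j * FreeGroup.of i)⁻¹)

/-- The Artin braid group `B_n` on `n` strands. -/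
abbrev BraidGroup (n : ℕ) : Type := PresentedGroup {w | BraidRel n w}

/-- The standard generator of `B_n` crossing the strands at the positions `i` and `i + 1`
(positions are numbered from `0`). -/
def sgen {n : ℕ} (i : Fin (n - 1)) : BraidGroup n := PresentedGroup.of i

/-- Left position of the `i`-th generator. -/
def posL {n : ℕ} (i : Fin (n - 1)) : Fin n := ⟨i.val, by omega⟩

/-- Right position of the `i`-th generator. -/
def posR {n : ℕ} (i : Fin (n - 1)) : Fin n := ⟨i.val + 1, by omega⟩

/-- An R-matrix on a vector space with basis indexed by `ι`: an invertible solution of the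
Yang--Baxter equation `R₁₂ R₂₃ R₁₂ = R₂₃ R₁₂ R₂₃`. -/
structure RMatrix (K : Type*) [Field K] (ι : Type*) [Fintype ι] [DecidableEq ι] where
  /-- The underlying matrix of an endomorphism of `V ⊗ V`. -/
  mat : Matrix (ι × ι) (ι × ι) K
  isUnit : IsUnit mat
  yangBaxter : localOp mat (0 : Fin 3) 1 * localOp mat 1 2 * localOp mat 0 1 =
    localOp mat (1 : Fin 3) 2 * localOp mat 0 1 * localOp mat 1 2

namespace RMatrix

variable {K : Type*} [Field K] {ι : Type*} [Fintype ι] [DecidableEq ι]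

theorem isUnit_localOp (R : RMatrix K ι) {P : Type*} [Fintype P] [DecidableEq P] {p q : P}
    (hpq : p ≠ q) : IsUnit (localOp R.mat p q) := by
  obtain ⟨u, hu⟩ := R.isUnit
  refine ⟨⟨localOp R.mat p q, localOp (↑u⁻¹ : Matrix (ι × ι) (ι × ι) K) p q, ?_, ?_⟩, rfl⟩
  · rw [← localOp_mul _ _ hpq, ← hu, Units.mul_inv, localOp_one hpq]
  · rw [← localOp_mul _ _ hpq, ← hu, Units.inv_mul, localOp_one hpq]

theorem posL_ne_posR {n : ℕ} (i : Fin (n - 1)) : posL i ≠ posR i := by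
  simp [posL, posR]

/-- The operator `id^{⊗ i} ⊗ R ⊗ id^{⊗ (n - 2 - i)}` on `V^{⊗ n}`. -/
noncomputable def genOp (R : RMatrix K ι) {n : ℕ} (i : Fin (n - 1)) :
    (Matrix (Fin n → ι) (Fin n → ι) K)ˣ :=
  (R.isUnit_localOp (posL_ne_posR i)).unit

theorem genOp_rel (R : RMatrix K ι) {n : ℕ} (w : FreeGroup (Fin (n - 1)))
    (hw : w ∈ {w | BraidRel n w}) : FreeGroup.lift (R.genOp (n := n)) w = 1 := by
  cases hw with
  | braid i j h =>
    have hij : posL j = posR i := by simp [posL, posR, h]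
    simp only [map_mul, map_inv, FreeGroup.lift_apply_of, mul_inv_eq_one]
    apply Units.ext
    simp only [Units.val_mul, genOp, IsUnit.unit_spec, hij]
    refine localOp_braid _ R.yangBaxter (posL_ne_posR i) ?_ ?_
    · simp only [posL, posR, ne_eq, Fin.mk.injEq]; omega
    · simp only [posR, ne_eq, Fin.mk.injEq]; omega
  | far i j h =>
    simp only [map_mul, map_inv, FreeGroup.lift_apply_of, mul_inv_eq_one]
    apply Units.ext
    simp only [Units.val_mul, genOp, IsUnit.unit_spec]
    refine localOp_comm _ _ (posL_ne_posR i) (posL_ne_posR j) ?_ ?_ ?_ ?_ <;>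
      simp only [posL, posR, ne_eq, Fin.mk.injEq] <;> omega

/-- The representation `ρ_R : B_n → GL(V^{⊗ n})`, sending `s_i` to `R` acting on the tensor factors
at the positions `i` and `i + 1`. -/
noncomputable def braidRep (R : RMatrix K ι) (n : ℕ) :
    BraidGroup n →* (Matrix (Fin n → ι) (Fin n → ι) K)ˣ :=
  PresentedGroup.toGroup (f := R.genOp) R.genOp_rel

/-- The operator-valued invariant of the `(1,1)`-tangle obtained from the closure of the braid `β`
by cutting the component through the first strand:
`tr_{2,…,n+1} ((id ⊗ h^{⊗ n}) ∘ ρ_R(β))`, where `h` is the diagonal matrix with entries `h x`. -/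
noncomputable def cutClosure (R : RMatrix K ι) (h : ι → K) {n : ℕ} (β : BraidGroup (n + 1)) :
    Matrix ι ι K :=
  Matrix.of fun x y => ∑ g : Fin n → ι,
    (∏ k, h (g k)) *
      (R.braidRep (n + 1) β : Matrix (Fin (n + 1) → ι) (Fin (n + 1) → ι) K)
        (Fin.cons x g) (Fin.cons y g)

/-- The scalar invariant of the link that is the closure of the braid `β`:
`(1 / dim V) tr ((id ⊗ h^{⊗ n}) ∘ ρ_R(β))`. -/
noncomputable def linkInvariant (R : RMatrix K ι) (h : ι → K) {n : ℕ} (β : BraidGroup (n + 1)) :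
    K :=
  (Fintype.card ι : K)⁻¹ * (R.cutClosure h β).trace

end RMatrix

/-! ### The ground field and the two R-matrices -/

/-- The field `ℚ(t₀, t₁)` of rational functions in two variables. -/
abbrev QT : Type := FractionRing (MvPolynomial (Fin 2) ℚ)

/-- The variable `t₀`. -/
noncomputable def t₀ : QT := algebraMap (MvPolynomial (Fin 2) ℚ) QT (MvPolynomial.X 0)

/-- The variable `t₁`. -/
noncomputable def t₁ : QT := algebraMap (MvPolynomial (Fin 2) ℚ) QT (MvPolynomial.X 1)

theorem t₀_ne_zero : t₀ ≠ 0 := by simp [t₀]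

theorem t₁_ne_zero : t₁ ≠ 0 := by simp [t₁]

section Tables

variable {K : Type*} [Field K]

/-- The basis vector `v_{ij} = v_i ⊗ v_j` of `V ⊗ V` for a `4`-dimensional space `V` with ordered
basis `(v_1, v_2, v_3, v_4)`: here `v_i` is numbered from `1`, while the index type `Fin 4` is
numbered from `0`. -/
def bv (i j : ℕ) : Fin 4 × Fin 4 → K :=
  fun x => if x.1.val + 1 = i ∧ x.2.val + 1 = j then 1 else 0

/-- The matrix of the endomorphism of `V ⊗ V` whose values on the basis vectors `v_{ij}` are the
entries of the table `A`. -/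
def ofTable (A : Matrix (Fin 4) (Fin 4) (Fin 4 × Fin 4 → K)) :
    Matrix (Fin 4 × Fin 4) (Fin 4 × Fin 4) K :=
  Matrix.of fun x y => A y.1 y.2 x

/-- The table of the Links--Gould R-matrix; `a` and `b` stand for `t₀^{1/2}` and `t₁^{1/2}`, and `Y`
for the square root of `(t₀ - 1) (1 - t₁)`. -/
def tableLG (t₀ t₁ a b Y : K) : Matrix (Fin 4) (Fin 4) (Fin 4 × Fin 4 → K) :=
  !![t₀ • bv 1 1,
     a • bv 2 1,
     a • bv 3 1,
     bv 4 1;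
     a • bv 1 2 + (t₀ - 1) • bv 2 1,
     -bv 2 2,
     (t₀ * t₁ - 1) • bv 2 3 - (a * b) • bv 3 2 - (a * b * Y) • bv 4 1,
     b • bv 4 2;
     a • bv 1 3 + (t₀ - 1) • bv 3 1,
     -(a * b) • bv 2 3 + Y • bv 4 1,
     -bv 3 3,
     b • bv 4 3;
     bv 1 4 - (a * b * Y) • bv 2 3 + Y • bv 3 2 + Y ^ 2 • bv 4 1,
     b • bv 2 4 + (t₁ - 1) • bv 4 2,
     b • bv 3 4 + (t₁ - 1) • bv 4 3,
     t₁ • bv 4 4]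

/-- The table of the R-matrix `R_{V,r}`. -/
def tableV (t₀ t₁ r : K) : Matrix (Fin 4) (Fin 4) (Fin 4 × Fin 4 → K) :=
  !![-bv 1 1,
     -t₀ • bv 2 1,
     -t₁ • bv 3 1,
     -(t₀ * t₁) • bv 4 1;
     -bv 1 2 + (t₀ - 1) • bv 2 1,
     t₀ • bv 2 2,
     -(r * t₁) • bv 3 2 + ((t₀ - 1) * t₁) • bv 4 1,
     (r * t₀ * t₁) • bv 4 2;
     -bv 1 3 + (t₁ - 1) • bv 3 1,
     -(r⁻¹ * t₁⁻¹) • bv 2 3 + (r⁻¹ * (1 - t₀)) • bv 4 1,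
     t₁ • bv 3 3,
     r⁻¹ • bv 4 3;
     -bv 1 4 + (t₁⁻¹ - 1) • bv 2 3 + (r * (t₁ - 1)) • bv 3 2 + (t₀ + t₁ - 2) • bv 4 1,
     (r⁻¹ * t₁⁻¹) • bv 2 4 + (t₀ - 1) • bv 4 2,
     (r * t₁) • bv 3 4 + (t₁ - 1) • bv 4 3,
     -bv 4 4]

theorem isUnit_of_cubic {n : Type*} [Fintype n] [DecidableEq n] {A : Matrix n n K} {t₀ t₁ : K}
    (h₀ : t₀ ≠ 0) (h₁ : t₁ ≠ 0)
    (h : ∀ φ x, (A *ᵥ (A *ᵥ (A *ᵥ φ))) x + (1 - t₀ - t₁) * (A *ᵥ (A *ᵥ φ)) x +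
      (t₀ * t₁ - t₀ - t₁) * (A *ᵥ φ) x + t₀ * t₁ * φ x = 0) : IsUnit A := by
  have h2 : A * (A * A + (1 - t₀ - t₁) • A + (t₀ * t₁ - t₀ - t₁) • (1 : Matrix n n K)) =
      (-(t₀ * t₁)) • 1 := by
    refine matrix_ext_mulVec fun φ x => ?_
    have := h φ x
    simp only [mul_add, Matrix.add_mulVec, Matrix.mul_smul, Matrix.smul_mulVec,
      ← Matrix.mulVec_mulVec, Pi.add_apply, Pi.smul_apply, smul_eq_mul, Matrix.one_mulVec]
    linear_combination this
  have h3 : A * ((-(t₀ * t₁))⁻¹ •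
      (A * A + (1 - t₀ - t₁) • A + (t₀ * t₁ - t₀ - t₁) • (1 : Matrix n n K))) = 1 := by
    rw [Matrix.mul_smul, h2, smul_smul, inv_mul_cancel₀ (by simp [h₀, h₁]), one_smul]
  exact ⟨⟨A, _, h3, mul_eq_one_comm.mp h3⟩, rfl⟩

theorem mulVec_pair (M : Matrix (Fin 4 × Fin 4) (Fin 4 × Fin 4) K) (φ : Fin 4 × Fin 4 → K)
    (x y : Fin 4) : (M *ᵥ φ) (x, y) = ∑ a, ∑ b, M (x, y) (a, b) * φ (a, b) := by
  simp [Matrix.mulVec, dotProduct, Fintype.sum_prod_type]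

theorem localOp_01 (M : Matrix (Fin 4 × Fin 4) (Fin 4 × Fin 4) K) (φ : (Fin 3 → Fin 4) → K)
    (x y z : Fin 4) : (localOp M (0 : Fin 3) 1 *ᵥ φ) ![x, y, z] =
      ∑ a, ∑ b, M (x, y) (a, b) * φ ![a, b, z] := by
  rw [localOp_mulVec _ (by decide), Fintype.sum_prod_type]
  refine Finset.sum_congr rfl fun a _ => Finset.sum_congr rfl fun b _ => ?_
  congr 2
  funext k
  fin_cases k <;> rfl

theorem localOp_12 (M : Matrix (Fin 4 × Fin 4) (Fin 4 × Fin 4) K) (φ : (Fin 3 → Fin 4) → K)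
    (x y z : Fin 4) : (localOp M (1 : Fin 3) 2 *ᵥ φ) ![x, y, z] =
      ∑ a, ∑ b, M (y, z) (a, b) * φ ![x, a, b] := by
  rw [localOp_mulVec _ (by decide), Fintype.sum_prod_type]
  refine Finset.sum_congr rfl fun a _ => Finset.sum_congr rfl fun b _ => ?_
  congr 2
  funext k
  fin_cases k <;> rfl

/-- The action of a table, row by row. -/
theorem ofTable_sum (A : Matrix (Fin 4) (Fin 4) (Fin 4 × Fin 4 → K)) (x : Fin 4 × Fin 4)
    (ψ : Fin 4 → Fin 4 → K) :
    ∑ a, ∑ b, ofTable A x (a, b) * ψ a b =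
      A 0 0 x * ψ 0 0 + A 0 1 x * ψ 0 1 + A 0 2 x * ψ 0 2 + A 0 3 x * ψ 0 3 +
      (A 1 0 x * ψ 1 0 + A 1 1 x * ψ 1 1 + A 1 2 x * ψ 1 2 + A 1 3 x * ψ 1 3) +
      (A 2 0 x * ψ 2 0 + A 2 1 x * ψ 2 1 + A 2 2 x * ψ 2 2 + A 2 3 x * ψ 2 3) +
      (A 3 0 x * ψ 3 0 + A 3 1 x * ψ 3 1 + A 3 2 x * ψ 3 2 + A 3 3 x * ψ 3 3) := by
  simp [Fin.sum_univ_four, ofTable]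

theorem rowV (t₀ t₁ r : K) (ψ : Fin 4 → Fin 4 → K) :
    let S := fun x y : Fin 4 => ∑ c, ∑ d, ofTable (tableV t₀ t₁ r) (x, y) (c, d) * ψ c d
    S 0 0 = -ψ 0 0 ∧
    S 0 1 = -ψ 1 0 ∧
    S 0 2 = -ψ 2 0 ∧
    S 0 3 = -ψ 3 0 ∧
    S 1 0 = -t₀ * ψ 0 1 + (t₀ - 1) * ψ 1 0 ∧
    S 1 1 = t₀ * ψ 1 1 ∧
    S 1 2 = -(r⁻¹ * t₁⁻¹) * ψ 2 1 + (t₁⁻¹ - 1) * ψ 3 0 ∧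
    S 1 3 = r⁻¹ * t₁⁻¹ * ψ 3 1 ∧
    S 2 0 = -t₁ * ψ 0 2 + (t₁ - 1) * ψ 2 0 ∧
    S 2 1 = -(r * t₁) * ψ 1 2 + r * (t₁ - 1) * ψ 3 0 ∧
    S 2 2 = t₁ * ψ 2 2 ∧
    S 2 3 = r * t₁ * ψ 3 2 ∧
    S 3 0 = -(t₀ * t₁) * ψ 0 3 + (t₀ - 1) * t₁ * ψ 1 2 + r⁻¹ * (1 - t₀) * ψ 2 1 + (t₀ + t₁ - 2) * ψ 3 0 ∧
    S 3 1 = r * t₀ * t₁ * ψ 1 3 + (t₀ - 1) * ψ 3 1 ∧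
    S 3 2 = r⁻¹ * ψ 2 3 + (t₁ - 1) * ψ 3 2 ∧
    S 3 3 = -ψ 3 3 := by
  refine ⟨?_, ?_, ?_, ?_, ?_, ?_, ?_, ?_, ?_, ?_, ?_, ?_, ?_, ?_, ?_, ?_⟩ <;>
    · simp only [ofTable_sum]
      simp [tableV, bv]
      try ring

theorem rowLG (t₀ t₁ a b Y : K) (ψ : Fin 4 → Fin 4 → K) :
    let S := fun x y : Fin 4 => ∑ c, ∑ d, ofTable (tableLG t₀ t₁ a b Y) (x, y) (c, d) * ψ c d
    S 0 0 = t₀ * ψ 0 0 ∧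
    S 0 1 = a * ψ 1 0 ∧
    S 0 2 = a * ψ 2 0 ∧
    S 0 3 = ψ 3 0 ∧
    S 1 0 = a * ψ 0 1 + (t₀ - 1) * ψ 1 0 ∧
    S 1 1 = -ψ 1 1 ∧
    S 1 2 = (t₀ * t₁ - 1) * ψ 1 2 - a * b * ψ 2 1 - a * b * Y * ψ 3 0 ∧
    S 1 3 = b * ψ 3 1 ∧
    S 2 0 = a * ψ 0 2 + (t₀ - 1) * ψ 2 0 ∧
    S 2 1 = -(a * b) * ψ 1 2 + Y * ψ 3 0 ∧
    S 2 2 = -ψ 2 2 ∧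
    S 2 3 = b * ψ 3 2 ∧
    S 3 0 = ψ 0 3 - a * b * Y * ψ 1 2 + Y * ψ 2 1 + Y ^ 2 * ψ 3 0 ∧
    S 3 1 = b * ψ 1 3 + (t₁ - 1) * ψ 3 1 ∧
    S 3 2 = b * ψ 2 3 + (t₁ - 1) * ψ 3 2 ∧
    S 3 3 = t₁ * ψ 3 3 := by
  refine ⟨?_, ?_, ?_, ?_, ?_, ?_, ?_, ?_, ?_, ?_, ?_, ?_, ?_, ?_, ?_, ?_⟩ <;>
    · simp only [ofTable_sum]
      simp [tableLG, bv]
      try ring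

theorem forall_fin4 {p : Fin 4 → Prop} (h0 : p 0) (h1 : p 1) (h2 : p 2) (h3 : p 3) :
    ∀ x, p x := by
  intro x; fin_cases x <;> assumption

theorem eq_vec3 (f : Fin 3 → Fin 4) : f = ![f 0, f 1, f 2] := by
  funext k; fin_cases k <;> rfl

theorem isUnit_V {t₀ t₁ r : K} (h₀ : t₀ ≠ 0) (h₁ : t₁ ≠ 0) (hr : r ≠ 0) :
    IsUnit (ofTable (tableV t₀ t₁ r)) := by
  refine isUnit_of_cubic h₀ h₁ ?_
  intro φ ⟨x, y⟩
  revert x y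
  simp only [mulVec_pair]
  have h := fun ψ => rowV t₀ t₁ r ψ
  simp only [forall_and] at h
  obtain ⟨g1, g2, g3, g4, g5, g6, g7, g8, g9, g10, g11, g12, g13, g14, g15, g16⟩ := h
  refine forall_fin4 ?_ ?_ ?_ ?_ <;> refine forall_fin4 ?_ ?_ ?_ ?_ <;>
    · simp only [g1, g2, g3, g4, g5, g6, g7, g8, g9, g10, g11, g12, g13, g14, g15, g16]
      field_simp
      ring

set_option linter.unusedSimpArgs false in
set_option maxHeartbeats 4000000 in
theorem yangBaxter_V {t₀ t₁ r : K} (h₁ : t₁ ≠ 0) (hr : r ≠ 0) :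
    let R := ofTable (tableV t₀ t₁ r)
    localOp R (0 : Fin 3) 1 * localOp R 1 2 * localOp R 0 1 =
      localOp R (1 : Fin 3) 2 * localOp R 0 1 * localOp R 1 2 := by
  intro R
  refine matrix_ext_mulVec fun φ f => ?_
  rw [eq_vec3 f]
  generalize f 0 = x
  generalize f 1 = y
  generalize f 2 = z
  revert x y z
  simp only [← Matrix.mulVec_mulVec, localOp_01, localOp_12, R]
  have h := fun ψ => rowV t₀ t₁ r ψ
  simp only [forall_and] at h
  obtain ⟨g1, g2, g3, g4, g5, g6, g7, g8, g9, g10, g11, g12, g13, g14, g15, g16⟩ := h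
  refine forall_fin4 ?_ ?_ ?_ ?_ <;> refine forall_fin4 ?_ ?_ ?_ ?_ <;>
    refine forall_fin4 ?_ ?_ ?_ ?_ <;>
    · simp only [g1, g2, g3, g4, g5, g6, g7, g8, g9, g10, g11, g12, g13, g14, g15, g16]
      try field_simp
      try ring

set_option linter.unusedSimpArgs false in
theorem isUnit_LG {t₀ t₁ a b Y : K} (h₀ : t₀ ≠ 0) (h₁ : t₁ ≠ 0) (ha : a ^ 2 = t₀)
    (hb : b ^ 2 = t₁) (hY : Y ^ 2 = (t₀ - 1) * (1 - t₁)) :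
    IsUnit (ofTable (tableLG t₀ t₁ a b Y)) := by
  refine isUnit_of_cubic h₀ h₁ ?_
  subst ha hb
  intro φ ⟨x, y⟩
  revert x y
  simp only [mulVec_pair]
  have h := fun ψ => rowLG (a ^ 2) (b ^ 2) a b Y ψ
  simp only [forall_and, hY] at h
  obtain ⟨g1, g2, g3, g4, g5, g6, g7, g8, g9, g10, g11, g12, g13, g14, g15, g16⟩ := h
  refine forall_fin4 ?_ ?_ ?_ ?_ <;> refine forall_fin4 ?_ ?_ ?_ ?_ <;>
    · simp only [g1, g2, g3, g4, g5, g6, g7, g8, g9, g10, g11, g12, g13, g14, g15, g16]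
      try ring_nf
      try simp only [hY, show Y ^ 3 = Y * ((a ^ 2 - 1) * (1 - b ^ 2)) by rw [← hY]; ring,
        show Y ^ 4 = ((a ^ 2 - 1) * (1 - b ^ 2)) ^ 2 by rw [← hY]; ring]
      try ring

set_option linter.unusedSimpArgs false in
set_option maxHeartbeats 4000000 in
theorem yangBaxter_LG {t₀ t₁ a b Y : K} (ha : a ^ 2 = t₀)
    (hb : b ^ 2 = t₁) (hY : Y ^ 2 = (t₀ - 1) * (1 - t₁)) :
    let R := ofTable (tableLG t₀ t₁ a b Y)
    localOp R (0 : Fin 3) 1 * localOp R 1 2 * localOp R 0 1 =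
      localOp R (1 : Fin 3) 2 * localOp R 0 1 * localOp R 1 2 := by
  intro R
  subst ha hb
  refine matrix_ext_mulVec fun φ f => ?_
  rw [eq_vec3 f]
  generalize f 0 = x
  generalize f 1 = y
  generalize f 2 = z
  revert x y z
  simp only [← Matrix.mulVec_mulVec, localOp_01, localOp_12, R]
  have h := fun ψ => rowLG (a ^ 2) (b ^ 2) a b Y ψ
  simp only [forall_and, hY] at h
  obtain ⟨g1, g2, g3, g4, g5, g6, g7, g8, g9, g10, g11, g12, g13, g14, g15, g16⟩ := h
  refine forall_fin4 ?_ ?_ ?_ ?_ <;> refine forall_fin4 ?_ ?_ ?_ ?_ <;>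
    refine forall_fin4 ?_ ?_ ?_ ?_ <;>
    · simp only [g1, g2, g3, g4, g5, g6, g7, g8, g9, g10, g11, g12, g13, g14, g15, g16]
      try ring_nf
      try simp only [hY, show Y ^ 3 = Y * ((a ^ 2 - 1) * (1 - b ^ 2)) by rw [← hY]; ring,
        show Y ^ 4 = ((a ^ 2 - 1) * (1 - b ^ 2)) ^ 2 by rw [← hY]; ring]
      try ring

end Tables

/-! ### The skein relations -/

/-- The 78 words of the four-strand relation in `x = s_i`, `y = s_j`, `z = s_k`. -/
def skeinWord {G : Type*} [Group G] (x y z : G) : Fin 78 → G :=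
  ![
    x * y, x * y⁻¹, y * x, y⁻¹ * x,
    z * y, z⁻¹ * y, z * y⁻¹, z⁻¹ * y⁻¹,
    y * z, y⁻¹ * z, y * z⁻¹, y⁻¹ * z⁻¹,
    x * z * y, x * z * y⁻¹, x * z⁻¹ * y, x * z⁻¹ * y⁻¹,
    x⁻¹ * z * y, x⁻¹ * z * y⁻¹, x⁻¹ * z⁻¹ * y, x⁻¹ * z⁻¹ * y⁻¹,
    x * y * z, x * y * z⁻¹, x * y⁻¹ * z, x * y⁻¹ * z⁻¹,
    x⁻¹ * y * z, x⁻¹ * y * z⁻¹, x⁻¹ * y⁻¹ * z, x⁻¹ * y⁻¹ * z⁻¹,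
    y * x * z, y * x * z⁻¹, y * x⁻¹ * z, y * x⁻¹ * z⁻¹,
    y⁻¹ * x * z, y⁻¹ * x * z⁻¹, y⁻¹ * x⁻¹ * z, y⁻¹ * x⁻¹ * z⁻¹,
    z * y * x, z * y * x⁻¹, z * y⁻¹ * x, z * y⁻¹ * x⁻¹,
    z⁻¹ * y * x, z⁻¹ * y * x⁻¹, z⁻¹ * y⁻¹ * x, z⁻¹ * y⁻¹ * x⁻¹,
    z * x⁻¹ * y⁻¹ * x⁻¹, z⁻¹ * x⁻¹ * y⁻¹ * x⁻¹, z * x⁻¹ * y⁻¹ * x, z⁻¹ * x⁻¹ * y⁻¹ * x,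
    z * x⁻¹ * y * x⁻¹, z⁻¹ * x⁻¹ * y * x⁻¹, z * x * y⁻¹ * x⁻¹, z⁻¹ * x * y⁻¹ * x⁻¹,
    z * x * y⁻¹ * x, z⁻¹ * x * y⁻¹ * x, z * x * y * x⁻¹, z⁻¹ * x * y * x⁻¹,
    x⁻¹ * y⁻¹ * x⁻¹ * z, x⁻¹ * y⁻¹ * x⁻¹ * z⁻¹, x⁻¹ * y⁻¹ * x * z, x⁻¹ * y⁻¹ * x * z⁻¹,
    x⁻¹ * y * x⁻¹ * z, x⁻¹ * y * x⁻¹ * z⁻¹, x * y⁻¹ * x⁻¹ * z, x * y⁻¹ * x⁻¹ * z⁻¹,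
    x * y⁻¹ * x * z, x * y⁻¹ * x * z⁻¹, x * y * x⁻¹ * z, x * y * x⁻¹ * z⁻¹,
    x * y⁻¹ * z⁻¹ * y, x * y⁻¹ * z * y⁻¹, x * y * z⁻¹ * y⁻¹, x * y * z⁻¹ * y,
    x * y * z * y⁻¹, y⁻¹ * z⁻¹ * y * x, y⁻¹ * z * y⁻¹ * x, y * z⁻¹ * y⁻¹ * x,
    y * z⁻¹ * y * x, y * z * y⁻¹ * x]

section Coefficients

/-! The coefficients `a_1, …, a_78` of the four-strand relation. -/

variable {K : Type*} [Field K] (t₀ t₁ : K)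

def a1 : K :=
    -((t₁ - 1) * (t₀ - 1) * (-t₁ - t₀ - 2 * t₁ * t₀ - t₁ ^ 2 * t₀ - t₁ * t₀ ^ 2 + t₁ ^ 3 * t₀ ^ 2
      + t₁ ^ 2 * t₀ ^ 3)) / (t₁ * t₀ * (t₁ + t₀) * (t₁ * t₀ - 1) * (1 + t₁ * t₀))

def a2 : K :=
    -((t₁ - 1) * (t₀ - 1) * (t₁ + t₀ + 2 * t₁ * t₀)) / ((t₁ + t₀) * (t₁ * t₀ - 1) * (1 + t₁ * t₀))

def a3 : K :=
    ((t₁ - 1) * (t₀ - 1) * (-t₁ - t₀ - 2 * t₁ * t₀ - t₁ ^ 2 * t₀ - t₁ * t₀ ^ 2 + t₁ ^ 3 * t₀ ^ 2 +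
      t₁ ^ 2 * t₀ ^ 3)) / (t₁ * t₀ * (t₁ + t₀) * (t₁ * t₀ - 1) * (1 + t₁ * t₀))

def a4 : K :=
    ((t₁ - 1) * (t₀ - 1) * (t₁ + t₀ + 2 * t₁ * t₀)) / ((t₁ + t₀) * (t₁ * t₀ - 1) * (1 + t₁ * t₀))

def a5 : K :=
    (1 + t₁ * t₀ + t₁ ^ 2 * t₀ + t₁ * t₀ ^ 2) / (t₁ * (1 + t₁) * t₀ * (1 + t₀) * (1 + t₁ * t₀))

def a6 : K :=
    -(t₁ + t₀ + t₁ * t₀ + t₁ ^ 2 * t₀ ^ 2) / (t₁ * (1 + t₁) * t₀ * (1 + t₀) * (1 + t₁ * t₀))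

def a7 : K :=
    -((1 + t₁ * t₀ + t₁ ^ 2 * t₀ + t₁ * t₀ ^ 2) * (t₁ - t₁ ^ 2 + t₀ - t₁ * t₀ + t₁ ^ 2 * t₀ - t₀ ^
      2 + t₁ * t₀ ^ 2 + t₁ ^ 2 * t₀ ^ 2)) / (t₁ * (1 + t₁) * t₀ * (1 + t₀) * (t₁ + t₀) * (1 + t₁ *
      t₀))

def a8 : K :=
    ((t₁ + t₀ + t₁ * t₀ + t₁ ^ 2 * t₀ ^ 2) * (t₁ - t₁ ^ 2 + t₀ - t₁ * t₀ + t₁ ^ 2 * t₀ - t₀ ^ 2 +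
      t₁ * t₀ ^ 2 + t₁ ^ 2 * t₀ ^ 2)) / (t₁ * (1 + t₁) * t₀ * (1 + t₀) * (t₁ + t₀) * (1 + t₁ *
      t₀))

def a9 : K :=
    -(1 + t₁ * t₀ + t₁ ^ 2 * t₀ + t₁ * t₀ ^ 2) / (t₁ * (1 + t₁) * t₀ * (1 + t₀) * (1 + t₁ * t₀))

def a10 : K :=
    ((1 + t₁ * t₀ + t₁ ^ 2 * t₀ + t₁ * t₀ ^ 2) * (t₁ - t₁ ^ 2 + t₀ - t₁ * t₀ + t₁ ^ 2 * t₀ - t₀ ^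
      2 + t₁ * t₀ ^ 2 + t₁ ^ 2 * t₀ ^ 2)) / (t₁ * (1 + t₁) * t₀ * (1 + t₀) * (t₁ + t₀) * (1 + t₁ *
      t₀))

def a11 : K :=
    (t₁ + t₀ + t₁ * t₀ + t₁ ^ 2 * t₀ ^ 2) / (t₁ * (1 + t₁) * t₀ * (1 + t₀) * (1 + t₁ * t₀))

def a12 : K :=
    -((t₁ + t₀ + t₁ * t₀ + t₁ ^ 2 * t₀ ^ 2) * (t₁ - t₁ ^ 2 + t₀ - t₁ * t₀ + t₁ ^ 2 * t₀ - t₀ ^ 2 +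
      t₁ * t₀ ^ 2 + t₁ ^ 2 * t₀ ^ 2)) / (t₁ * (1 + t₁) * t₀ * (1 + t₀) * (t₁ + t₀) * (1 + t₁ *
      t₀))

def a13 : K :=
    (-t₁ ^ 2 - t₁ * t₀ - t₁ ^ 2 * t₀ - t₀ ^ 2 - t₁ * t₀ ^ 2 + t₁ ^ 2 * t₀ ^ 2) / (t₁ * (1 + t₁) *
      t₀ * (1 + t₀) * (t₁ + t₀) * (1 + t₁ * t₀))

def a14 : K :=
    (-t₁ + t₁ ^ 2 - t₀ + t₁ * t₀ + t₁ ^ 2 * t₀ + t₀ ^ 2 + t₁ * t₀ ^ 2 - t₁ ^ 2 * t₀ ^ 2 + 2 * t₁ ^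
      3 * t₀ ^ 2 + t₁ ^ 4 * t₀ ^ 2 + 2 * t₁ ^ 2 * t₀ ^ 3 + 2 * t₁ ^ 3 * t₀ ^ 3 + t₁ ^ 4 * t₀ ^ 3 +
      t₁ ^ 2 * t₀ ^ 4 + t₁ ^ 3 * t₀ ^ 4) / (t₁ * (1 + t₁) * t₀ * (1 + t₀) * (t₁ + t₀) * (1 + t₁ *
      t₀))

def a15 : K :=
    -(-t₁ ^ 3 - t₁ * t₀ - t₁ ^ 4 * t₀ - t₁ ^ 2 * t₀ ^ 2 - t₀ ^ 3 + t₁ ^ 4 * t₀ ^ 3 - t₁ * t₀ ^ 4 +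
      t₁ ^ 3 * t₀ ^ 4) / (t₁ * (1 + t₁) * t₀ * (1 + t₀) * (t₁ + t₀) * (1 + t₁ * t₀))

def a16 : K :=
    -(-t₁ ^ 2 + t₁ ^ 3 - t₁ * t₀ + t₁ ^ 2 * t₀ + t₁ ^ 3 * t₀ - t₀ ^ 2 + t₁ * t₀ ^ 2 + 3 * t₁ ^ 2 *
      t₀ ^ 2 + t₁ ^ 4 * t₀ ^ 2 + t₀ ^ 3 + t₁ * t₀ ^ 3 + 2 * t₁ ^ 3 * t₀ ^ 3 + t₁ ^ 4 * t₀ ^ 3 + t₁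
      ^ 2 * t₀ ^ 4 + t₁ ^ 3 * t₀ ^ 4) / (t₁ * (1 + t₁) * t₀ * (1 + t₀) * (t₁ + t₀) * (1 + t₁ *
      t₀))

def a17 : K :=
    -(1 + t₁ * t₀ + t₁ ^ 2 * t₀ + t₁ * t₀ ^ 2) / ((1 + t₁) * (1 + t₀) * (t₁ + t₀) * (1 + t₁ * t₀))

def a18 : K :=
    -((t₁ + t₀ - 1) * (1 + t₁ * t₀ + t₁ ^ 2 * t₀ + t₁ * t₀ ^ 2)) / ((1 + t₁) * (1 + t₀) * (t₁ +
      t₀) * (1 + t₁ * t₀))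

def a19 : K :=
    (t₁ + t₀ + t₁ * t₀ + t₁ ^ 2 * t₀ ^ 2) / ((1 + t₁) * (1 + t₀) * (t₁ + t₀) * (1 + t₁ * t₀))

def a20 : K :=
    ((t₁ + t₀ - 1) * (t₁ + t₀ + t₁ * t₀ + t₁ ^ 2 * t₀ ^ 2)) / ((1 + t₁) * (1 + t₀) * (t₁ + t₀) *
      (1 + t₁ * t₀))

def a21 : K :=
    -(t₁ + t₀ + t₁ * t₀ + t₁ ^ 2 * t₀ ^ 2) / (t₁ * (1 + t₁) * t₀ * (1 + t₀) * (t₁ + t₀) * (1 + t₁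
      * t₀))

def a22 : K :=
    -(-t₁ ^ 2 - t₁ * t₀ - t₁ ^ 4 * t₀ - t₀ ^ 2 + t₁ ^ 2 * t₀ ^ 2 - t₁ ^ 3 * t₀ ^ 2 - t₁ ^ 2 * t₀ ^
      3 + t₁ ^ 4 * t₀ ^ 3 - t₁ * t₀ ^ 4 + t₁ ^ 3 * t₀ ^ 4) / (t₁ * (1 + t₁) * t₀ * (1 + t₀) * (t₁
      + t₀) * (1 + t₁ * t₀))

def a23 : K :=
    (t₁ - t₁ ^ 2 + t₀ - t₁ * t₀ - t₁ ^ 4 * t₀ - t₀ ^ 2 + t₁ ^ 2 * t₀ ^ 2 - 2 * t₁ ^ 3 * t₀ ^ 2 - 2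
      * t₁ ^ 2 * t₀ ^ 3 + t₁ ^ 4 * t₀ ^ 3 - t₁ * t₀ ^ 4 + t₁ ^ 3 * t₀ ^ 4) / (t₁ * (1 + t₁) * t₀ *
      (1 + t₀) * (t₁ + t₀) * (1 + t₁ * t₀))

def a24 : K :=
    -((t₁ + t₀ - 1) * (-t₁ ^ 2 - t₁ * t₀ - t₁ ^ 2 * t₀ - t₀ ^ 2 - t₁ * t₀ ^ 2 + t₁ ^ 2 * t₀ ^ 2))
      / (t₁ * (1 + t₁) * t₀ * (1 + t₀) * (t₁ + t₀) * (1 + t₁ * t₀))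

def a25 : K :=
    (1 + t₁ * t₀ + t₁ ^ 2 * t₀ + t₁ * t₀ ^ 2) / ((1 + t₁) * (1 + t₀) * (t₁ + t₀) * (1 + t₁ * t₀))

def a26 : K :=
    -(t₁ + t₀ + t₁ * t₀ + t₁ ^ 2 * t₀ ^ 2) / ((1 + t₁) * (1 + t₀) * (t₁ + t₀) * (1 + t₁ * t₀))

def a27 : K :=
    ((t₁ + t₀ - 1) * (1 + t₁ * t₀ + t₁ ^ 2 * t₀ + t₁ * t₀ ^ 2)) / ((1 + t₁) * (1 + t₀) * (t₁ + t₀)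
      * (1 + t₁ * t₀))

def a28 : K :=
    -((t₁ + t₀ - 1) * (t₁ + t₀ + t₁ * t₀ + t₁ ^ 2 * t₀ ^ 2)) / ((1 + t₁) * (1 + t₀) * (t₁ + t₀) *
      (1 + t₁ * t₀))

def a29 : K :=
    ((1 + t₁) * (1 + t₀)) / ((t₁ + t₀) * (t₁ * t₀ - 1) * (1 + t₁ * t₀))

def a30 : K :=
    (-1 - 2 * t₁ + t₁ ^ 2 - 2 * t₀ + t₁ * t₀ - t₁ ^ 3 * t₀ + t₀ ^ 2 - 2 * t₁ ^ 2 * t₀ ^ 2 + t₁ ^ 3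
      * t₀ ^ 2 - t₁ * t₀ ^ 3 + t₁ ^ 2 * t₀ ^ 3) / ((t₁ + t₀) * (t₁ * t₀ - 1) * (1 + t₁ * t₀))

def a31 : K :=
    ((1 + t₁ * t₀ + t₁ ^ 2 * t₀ + t₁ * t₀ ^ 2) * (-t₁ ^ 2 - t₁ * t₀ - t₁ ^ 2 * t₀ - t₀ ^ 2 - t₁ *
      t₀ ^ 2 + t₁ ^ 2 * t₀ ^ 2)) / (t₁ * (1 + t₁) * t₀ * (1 + t₀) * (t₁ + t₀) * (t₁ * t₀ - 1) * (1
      + t₁ * t₀))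

def a32 : K :=
    -((t₁ + t₀ + t₁ * t₀ + t₁ ^ 2 * t₀ ^ 2) * (-t₁ ^ 2 - t₁ * t₀ - t₁ ^ 2 * t₀ - t₀ ^ 2 - t₁ * t₀
      ^ 2 + t₁ ^ 2 * t₀ ^ 2)) / (t₁ * (1 + t₁) * t₀ * (1 + t₀) * (t₁ + t₀) * (t₁ * t₀ - 1) * (1 +
      t₁ * t₀))

def a33 : K :=
    -(t₁ + t₀ + t₁ * t₀ + t₁ ^ 2 * t₀ + t₁ ^ 3 * t₀ + t₁ * t₀ ^ 2 + 4 * t₁ ^ 2 * t₀ ^ 2 - t₁ ^ 4 *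
      t₀ ^ 2 + t₁ * t₀ ^ 3 - t₁ ^ 3 * t₀ ^ 3 + t₁ ^ 4 * t₀ ^ 3 + t₁ ^ 5 * t₀ ^ 3 - t₁ ^ 2 * t₀ ^ 4
      + t₁ ^ 3 * t₀ ^ 4 + 2 * t₁ ^ 4 * t₀ ^ 4 + t₁ ^ 5 * t₀ ^ 4 + t₁ ^ 3 * t₀ ^ 5 + t₁ ^ 4 * t₀ ^
      5) / (t₁ * (1 + t₁) * t₀ * (1 + t₀) * (t₁ + t₀) * (t₁ * t₀ - 1) * (1 + t₁ * t₀))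

def a34 : K :=
    (t₁ ^ 2 + 3 * t₁ * t₀ + 2 * t₁ ^ 2 * t₀ - t₁ ^ 3 * t₀ + t₀ ^ 2 + 2 * t₁ * t₀ ^ 2 + t₁ ^ 3 * t₀
      ^ 2 - t₁ * t₀ ^ 3 + t₁ ^ 2 * t₀ ^ 3 + t₁ ^ 3 * t₀ ^ 3 + t₁ ^ 5 * t₀ ^ 3 + 2 * t₁ ^ 4 * t₀ ^
      4 + t₁ ^ 5 * t₀ ^ 4 + t₁ ^ 3 * t₀ ^ 5 + t₁ ^ 4 * t₀ ^ 5) / (t₁ * (1 + t₁) * t₀ * (1 + t₀) *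
      (t₁ + t₀) * (t₁ * t₀ - 1) * (1 + t₁ * t₀))

def a35 : K :=
    ((1 + t₁ * t₀ + t₁ ^ 2 * t₀ + t₁ * t₀ ^ 2) * (t₁ ^ 2 + t₁ * t₀ + t₀ ^ 2 - t₁ ^ 2 * t₀ ^ 2 + t₁
      ^ 3 * t₀ ^ 2 + t₁ ^ 2 * t₀ ^ 3)) / (t₁ * (1 + t₁) * t₀ * (1 + t₀) * (t₁ + t₀) * (t₁ * t₀ -
      1) * (1 + t₁ * t₀))

def a36 : K :=
    -((t₁ + t₀ + t₁ * t₀ + t₁ ^ 2 * t₀ ^ 2) * (t₁ ^ 2 + t₁ * t₀ + t₀ ^ 2 - t₁ ^ 2 * t₀ ^ 2 + t₁ ^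
      3 * t₀ ^ 2 + t₁ ^ 2 * t₀ ^ 3)) / (t₁ * (1 + t₁) * t₀ * (1 + t₀) * (t₁ + t₀) * (t₁ * t₀ - 1)
      * (1 + t₁ * t₀))

def a37 : K :=
    -(t₁ + t₀ + t₁ * t₀ + t₁ ^ 2 * t₀ ^ 2) / (t₁ * t₀ * (t₁ + t₀) * (t₁ * t₀ - 1) * (1 + t₁ * t₀))

def a38 : K :=
    -((1 + t₁ * t₀ + t₁ ^ 2 * t₀ + t₁ * t₀ ^ 2) * (-t₁ ^ 2 - t₁ * t₀ - t₁ ^ 2 * t₀ - t₀ ^ 2 - t₁ *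
      t₀ ^ 2 + t₁ ^ 2 * t₀ ^ 2)) / (t₁ * (1 + t₁) * t₀ * (1 + t₀) * (t₁ + t₀) * (t₁ * t₀ - 1) * (1
      + t₁ * t₀))

def a39 : K :=
    (t₁ + t₀ + t₁ * t₀ + 2 * t₁ ^ 2 * t₀ + t₁ ^ 3 * t₀ - t₁ ^ 4 * t₀ + 2 * t₁ * t₀ ^ 2 + 4 * t₁ ^
      2 * t₀ ^ 2 - t₁ ^ 3 * t₀ ^ 2 + t₁ ^ 5 * t₀ ^ 2 + t₁ * t₀ ^ 3 - t₁ ^ 2 * t₀ ^ 3 + t₁ ^ 3 * t₀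
      ^ 3 + 3 * t₁ ^ 4 * t₀ ^ 3 - t₁ * t₀ ^ 4 + 3 * t₁ ^ 3 * t₀ ^ 4 - t₁ ^ 5 * t₀ ^ 4 + t₁ ^ 2 *
      t₀ ^ 5 - t₁ ^ 4 * t₀ ^ 5) / (t₁ * (1 + t₁) * t₀ * (1 + t₀) * (t₁ + t₀) * (t₁ * t₀ - 1) * (1
      + t₁ * t₀))

def a40 : K :=
    -((1 + t₁ * t₀ + t₁ ^ 2 * t₀ + t₁ * t₀ ^ 2) * (t₁ ^ 2 + t₁ * t₀ + t₀ ^ 2 - t₁ ^ 2 * t₀ ^ 2 +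
      t₁ ^ 3 * t₀ ^ 2 + t₁ ^ 2 * t₀ ^ 3)) / (t₁ * (1 + t₁) * t₀ * (1 + t₀) * (t₁ + t₀) * (t₁ * t₀
      - 1) * (1 + t₁ * t₀))

def a41 : K :=
    (t₁ ^ 2 + 3 * t₁ * t₀ - t₁ ^ 2 * t₀ + t₀ ^ 2 - t₁ * t₀ ^ 2 + t₁ ^ 2 * t₀ ^ 2 + t₁ ^ 3 * t₀ ^ 2
      - t₁ ^ 4 * t₀ ^ 2 + t₁ ^ 2 * t₀ ^ 3 - 2 * t₁ ^ 3 * t₀ ^ 3 + t₁ ^ 4 * t₀ ^ 3 - t₁ ^ 2 * t₀ ^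
      4 + t₁ ^ 3 * t₀ ^ 4) / (t₁ * t₀ * (t₁ + t₀) * (t₁ * t₀ - 1) * (1 + t₁ * t₀))

def a42 : K :=
    ((t₁ + t₀ + t₁ * t₀ + t₁ ^ 2 * t₀ ^ 2) * (-t₁ ^ 2 - t₁ * t₀ - t₁ ^ 2 * t₀ - t₀ ^ 2 - t₁ * t₀ ^
      2 + t₁ ^ 2 * t₀ ^ 2)) / (t₁ * (1 + t₁) * t₀ * (1 + t₀) * (t₁ + t₀) * (t₁ * t₀ - 1) * (1 + t₁
      * t₀))

def a43 : K :=
    -(t₁ ^ 2 + 3 * t₁ * t₀ + 2 * t₁ ^ 2 * t₀ - t₁ ^ 3 * t₀ + t₀ ^ 2 + 2 * t₁ * t₀ ^ 2 + 2 * t₁ ^ 3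
      * t₀ ^ 2 + t₁ ^ 4 * t₀ ^ 2 - t₁ * t₀ ^ 3 + 2 * t₁ ^ 2 * t₀ ^ 3 + 3 * t₁ ^ 3 * t₀ ^ 3 + t₁ ^
      2 * t₀ ^ 4) / (t₁ * (1 + t₁) * t₀ * (1 + t₀) * (t₁ + t₀) * (t₁ * t₀ - 1) * (1 + t₁ * t₀))

def a44 : K :=
    ((t₁ + t₀ + t₁ * t₀ + t₁ ^ 2 * t₀ ^ 2) * (t₁ ^ 2 + t₁ * t₀ + t₀ ^ 2 - t₁ ^ 2 * t₀ ^ 2 + t₁ ^ 3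
      * t₀ ^ 2 + t₁ ^ 2 * t₀ ^ 3)) / (t₁ * (1 + t₁) * t₀ * (1 + t₀) * (t₁ + t₀) * (t₁ * t₀ - 1) *
      (1 + t₁ * t₀))

def a45 : K :=
    ((1 + t₁ * t₀ + t₁ ^ 2 * t₀ + t₁ * t₀ ^ 2) * (t₁ + t₀ + t₁ * t₀ + t₁ ^ 2 * t₀ ^ 2)) / ((1 +
      t₁) * (1 + t₀) * (t₁ + t₀) * (t₁ * t₀ - 1) * (1 + t₁ * t₀))

def a46 : K :=
    -((t₁ + t₀ + t₁ * t₀ + t₁ ^ 2 * t₀ ^ 2) ^ 2) / ((1 + t₁) * (1 + t₀) * (t₁ + t₀) * (t₁ * t₀ -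
      1) * (1 + t₁ * t₀))

def a47 : K :=
    (1 + t₁ * t₀ + t₁ ^ 2 * t₀ + t₁ * t₀ ^ 2) / ((1 + t₁) * (1 + t₀) * (t₁ + t₀) * (1 + t₁ * t₀))

def a48 : K :=
    -(t₁ + t₀ + t₁ * t₀ + t₁ ^ 2 * t₀ ^ 2) / ((1 + t₁) * (1 + t₀) * (t₁ + t₀) * (1 + t₁ * t₀))

def a49 : K :=
    -((t₁ + t₀ + 2 * t₁ * t₀) * (1 + t₁ * t₀ + t₁ ^ 2 * t₀ + t₁ * t₀ ^ 2)) / ((1 + t₁) * (1 + t₀)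
      * (t₁ + t₀) * (t₁ * t₀ - 1) * (1 + t₁ * t₀))

def a50 : K :=
    ((t₁ + t₀ + 2 * t₁ * t₀) * (t₁ + t₀ + t₁ * t₀ + t₁ ^ 2 * t₀ ^ 2)) / ((1 + t₁) * (1 + t₀) * (t₁
      + t₀) * (t₁ * t₀ - 1) * (1 + t₁ * t₀))

def a51 : K :=
    ((1 + t₁ * t₀ + t₁ ^ 2 * t₀ + t₁ * t₀ ^ 2) * (-t₁ ^ 2 - t₁ * t₀ - t₁ ^ 2 * t₀ - t₀ ^ 2 - t₁ *
      t₀ ^ 2 + t₁ ^ 2 * t₀ ^ 2)) / (t₁ * (1 + t₁) * t₀ * (1 + t₀) * (t₁ + t₀) * (t₁ * t₀ - 1) * (1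
      + t₁ * t₀))

def a52 : K :=
    -((t₁ + t₀ + t₁ * t₀ + t₁ ^ 2 * t₀ ^ 2) * (-t₁ ^ 2 - t₁ * t₀ - t₁ ^ 2 * t₀ - t₀ ^ 2 - t₁ * t₀
      ^ 2 + t₁ ^ 2 * t₀ ^ 2)) / (t₁ * (1 + t₁) * t₀ * (1 + t₀) * (t₁ + t₀) * (t₁ * t₀ - 1) * (1 +
      t₁ * t₀))

def a53 : K :=
    -((t₁ + t₀ + t₁ * t₀) * (1 + t₁ * t₀ + t₁ ^ 2 * t₀ + t₁ * t₀ ^ 2)) / (t₁ * (1 + t₁) * t₀ * (1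
      + t₀) * (t₁ + t₀) * (1 + t₁ * t₀))

def a54 : K :=
    ((t₁ + t₀ + t₁ * t₀) * (t₁ + t₀ + t₁ * t₀ + t₁ ^ 2 * t₀ ^ 2)) / (t₁ * (1 + t₁) * t₀ * (1 + t₀)
      * (t₁ + t₀) * (1 + t₁ * t₀))

def a55 : K :=
    ((1 + t₁ * t₀ + t₁ ^ 2 * t₀ + t₁ * t₀ ^ 2) * (t₁ ^ 2 + t₁ ^ 2 * t₀ + t₀ ^ 2 + t₁ * t₀ ^ 2)) /
      (t₁ * (1 + t₁) * t₀ * (1 + t₀) * (t₁ + t₀) * (t₁ * t₀ - 1) * (1 + t₁ * t₀))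

def a56 : K :=
    -((t₁ ^ 2 + t₁ ^ 2 * t₀ + t₀ ^ 2 + t₁ * t₀ ^ 2) * (t₁ + t₀ + t₁ * t₀ + t₁ ^ 2 * t₀ ^ 2)) / (t₁
      * (1 + t₁) * t₀ * (1 + t₀) * (t₁ + t₀) * (t₁ * t₀ - 1) * (1 + t₁ * t₀))

def a57 : K :=
    -((1 + t₁ * t₀ + t₁ ^ 2 * t₀ + t₁ * t₀ ^ 2) * (t₁ + t₀ + t₁ * t₀ + t₁ ^ 2 * t₀ ^ 2)) / ((1 +
      t₁) * (1 + t₀) * (t₁ + t₀) * (t₁ * t₀ - 1) * (1 + t₁ * t₀))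

def a58 : K :=
    ((t₁ + t₀ + t₁ * t₀ + t₁ ^ 2 * t₀ ^ 2) ^ 2) / ((1 + t₁) * (1 + t₀) * (t₁ + t₀) * (t₁ * t₀ - 1)
      * (1 + t₁ * t₀))

def a59 : K :=
    -(1 + t₁ * t₀ + t₁ ^ 2 * t₀ + t₁ * t₀ ^ 2) / ((1 + t₁) * (1 + t₀) * (t₁ + t₀) * (1 + t₁ * t₀))

def a60 : K :=
    (t₁ + t₀ + t₁ * t₀ + t₁ ^ 2 * t₀ ^ 2) / ((1 + t₁) * (1 + t₀) * (t₁ + t₀) * (1 + t₁ * t₀))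

def a61 : K :=
    ((t₁ + t₀ + 2 * t₁ * t₀) * (1 + t₁ * t₀ + t₁ ^ 2 * t₀ + t₁ * t₀ ^ 2)) / ((1 + t₁) * (1 + t₀) *
      (t₁ + t₀) * (t₁ * t₀ - 1) * (1 + t₁ * t₀))

def a62 : K :=
    -((t₁ + t₀ + 2 * t₁ * t₀) * (t₁ + t₀ + t₁ * t₀ + t₁ ^ 2 * t₀ ^ 2)) / ((1 + t₁) * (1 + t₀) *
      (t₁ + t₀) * (t₁ * t₀ - 1) * (1 + t₁ * t₀))

def a63 : K :=
    -((1 + t₁ * t₀ + t₁ ^ 2 * t₀ + t₁ * t₀ ^ 2) * (-t₁ ^ 2 - t₁ * t₀ - t₁ ^ 2 * t₀ - t₀ ^ 2 - t₁ *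
      t₀ ^ 2 + t₁ ^ 2 * t₀ ^ 2)) / (t₁ * (1 + t₁) * t₀ * (1 + t₀) * (t₁ + t₀) * (t₁ * t₀ - 1) * (1
      + t₁ * t₀))

def a64 : K :=
    ((t₁ + t₀ + t₁ * t₀ + t₁ ^ 2 * t₀ ^ 2) * (-t₁ ^ 2 - t₁ * t₀ - t₁ ^ 2 * t₀ - t₀ ^ 2 - t₁ * t₀ ^
      2 + t₁ ^ 2 * t₀ ^ 2)) / (t₁ * (1 + t₁) * t₀ * (1 + t₀) * (t₁ + t₀) * (t₁ * t₀ - 1) * (1 + t₁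
      * t₀))

def a65 : K :=
    ((t₁ + t₀ + t₁ * t₀) * (1 + t₁ * t₀ + t₁ ^ 2 * t₀ + t₁ * t₀ ^ 2)) / (t₁ * (1 + t₁) * t₀ * (1 +
      t₀) * (t₁ + t₀) * (1 + t₁ * t₀))

def a66 : K :=
    -((t₁ + t₀ + t₁ * t₀) * (t₁ + t₀ + t₁ * t₀ + t₁ ^ 2 * t₀ ^ 2)) / (t₁ * (1 + t₁) * t₀ * (1 +
      t₀) * (t₁ + t₀) * (1 + t₁ * t₀))

def a67 : K :=
    -((1 + t₁ * t₀ + t₁ ^ 2 * t₀ + t₁ * t₀ ^ 2) * (t₁ ^ 2 + t₁ ^ 2 * t₀ + t₀ ^ 2 + t₁ * t₀ ^ 2)) /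
      (t₁ * (1 + t₁) * t₀ * (1 + t₀) * (t₁ + t₀) * (t₁ * t₀ - 1) * (1 + t₁ * t₀))

def a68 : K :=
    ((t₁ ^ 2 + t₁ ^ 2 * t₀ + t₀ ^ 2 + t₁ * t₀ ^ 2) * (t₁ + t₀ + t₁ * t₀ + t₁ ^ 2 * t₀ ^ 2)) / (t₁
      * (1 + t₁) * t₀ * (1 + t₀) * (t₁ + t₀) * (t₁ * t₀ - 1) * (1 + t₁ * t₀))

def a69 : K :=
    (1) / (t₁ + t₀)

def a70 : K :=
    (t₁ * t₀) / (1 + t₁ * t₀)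

def a71 : K :=
    ((t₁ - 1) * (1 + t₁) * (t₀ - 1) * (1 + t₀)) / ((t₁ + t₀) * (t₁ * t₀ - 1) * (1 + t₁ * t₀))

def a72 : K :=
    -(1) / (1 + t₁ * t₀)

def a73 : K :=
    (t₁ ^ 2 + t₀ ^ 2 - 2) / ((t₁ + t₀) * (t₁ * t₀ - 1) * (1 + t₁ * t₀))

def a74 : K :=
    -(1) / (t₁ + t₀)

def a75 : K :=
    -(t₁ * t₀) / (1 + t₁ * t₀)

def a76 : K :=
    -((t₁ - 1) * (1 + t₁) * (t₀ - 1) * (1 + t₀)) / ((t₁ + t₀) * (t₁ * t₀ - 1) * (1 + t₁ * t₀))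

def a77 : K :=
    (1) / (1 + t₁ * t₀)

def a78 : K :=
    -(t₁ ^ 2 + t₀ ^ 2 - 2) / ((t₁ + t₀) * (t₁ * t₀ - 1) * (1 + t₁ * t₀))

/-- The list of the coefficients: the entry at the index `l` (counted from `0`) is the coefficient
of the word `skeinWord x y z l`. -/
def skeinCoeff : Fin 78 → K :=
  ![
    a1 t₀ t₁, a2 t₀ t₁, a3 t₀ t₁, a4 t₀ t₁, a5 t₀ t₁, a6 t₀ t₁,
    a7 t₀ t₁, a8 t₀ t₁, a9 t₀ t₁, a10 t₀ t₁, a11 t₀ t₁, a12 t₀ t₁,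
    a13 t₀ t₁, a14 t₀ t₁, a15 t₀ t₁, a16 t₀ t₁, a17 t₀ t₁, a18 t₀ t₁,
    a19 t₀ t₁, a20 t₀ t₁, a21 t₀ t₁, a22 t₀ t₁, a23 t₀ t₁, a24 t₀ t₁,
    a25 t₀ t₁, a26 t₀ t₁, a27 t₀ t₁, a28 t₀ t₁, a29 t₀ t₁, a30 t₀ t₁,
    a31 t₀ t₁, a32 t₀ t₁, a33 t₀ t₁, a34 t₀ t₁, a35 t₀ t₁, a36 t₀ t₁,
    a37 t₀ t₁, a38 t₀ t₁, a39 t₀ t₁, a40 t₀ t₁, a41 t₀ t₁, a42 t₀ t₁,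
    a43 t₀ t₁, a44 t₀ t₁, a45 t₀ t₁, a46 t₀ t₁, a47 t₀ t₁, a48 t₀ t₁,
    a49 t₀ t₁, a50 t₀ t₁, a51 t₀ t₁, a52 t₀ t₁, a53 t₀ t₁, a54 t₀ t₁,
    a55 t₀ t₁, a56 t₀ t₁, a57 t₀ t₁, a58 t₀ t₁, a59 t₀ t₁, a60 t₀ t₁,
    a61 t₀ t₁, a62 t₀ t₁, a63 t₀ t₁, a64 t₀ t₁, a65 t₀ t₁, a66 t₀ t₁,
    a67 t₀ t₁, a68 t₀ t₁, a69 t₀ t₁, a70 t₀ t₁, a71 t₀ t₁, a72 t₀ t₁,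
    a73 t₀ t₁, a74 t₀ t₁, a75 t₀ t₁, a76 t₀ t₁, a77 t₀ t₁, a78 t₀ t₁]

end Coefficients

section Skein

variable {n : ℕ}

/-- The group algebra `ℚ(t₀, t₁)[B_n]`. -/
abbrev BraidAlgebra (n : ℕ) : Type := MonoidAlgebra QT (BraidGroup n)

/-- A braid, as an element of the group algebra. -/
noncomputable abbrev br (β : BraidGroup n) : BraidAlgebra n := MonoidAlgebra.of QT (BraidGroup n) β

/-- `s_i` in the group algebra. -/
noncomputable abbrev S (i : Fin (n - 1)) : BraidAlgebra n := br (sgen i)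

/-- The inverse `s̄_i` of `s_i` in the group algebra. -/
noncomputable abbrev S' (i : Fin (n - 1)) : BraidAlgebra n := br (sgen i)⁻¹

/-- The cubic relation (left side; the right side is `0`). -/
noncomputable def skeinR1 (i : Fin (n - 1)) : BraidAlgebra n :=
  S i ^ 2 + (1 - t₀ - t₁) • S i + (t₀ * t₁ - t₀ - t₁) • (1 : BraidAlgebra n) + (t₀ * t₁) • S' i

/-- Ishii's relation (left side minus right side). -/
noncomputable def skeinR2 (i j : Fin (n - 1)) : BraidAlgebra n :=
  (S' i * S j * S i - S i * S j * S' i - S' i * S' j * S i + S i * S' j * S' i) -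
    (S i * S j - S i * S' j - S' i * S j + S' i * S' j - S j * S i + S j * S' i
      + S' j * S i - S' j * S' i)

/-- The 78-term four-strand relation (left side minus right side). -/
noncomputable def skeinR3 (i j k : Fin (n - 1)) : BraidAlgebra n :=
  (S i * S' k * S j * S' k - S' k * S j * S' k * S i) -
    ∑ l : Fin 78, skeinCoeff t₀ t₁ l • br (skeinWord (sgen i) (sgen j) (sgen k) l)

/-- `Φ` vanishes on all the skein relations in `B_n`: on the cubic relation for every `i`, on Ishii's
relation for `|i - j| = 1`, and on the four-strand relation for `i = j - 1 = k - 2`. -/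
def VanishesOnSkein {M : Type*} [Zero M] (Φ : BraidAlgebra n → M) : Prop :=
  (∀ i, Φ (skeinR1 i) = 0) ∧
  (∀ i j : Fin (n - 1), (j.val = i.val + 1 ∨ i.val = j.val + 1) → Φ (skeinR2 i j) = 0) ∧
  (∀ i j k : Fin (n - 1), j.val = i.val + 1 → k.val = i.val + 2 → Φ (skeinR3 i j k) = 0)

/-- The `ℚ(t₀, t₁)`-linear extension to the group algebra of a function on braids. -/
noncomputable def linExt {M : Type*} [AddCommGroup M] [Module QT M] (F : BraidGroup n → M)
    (x : BraidAlgebra n) : M :=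
  x.coeff.sum fun β c => c • F β

/-- A function `F` on `B_n` satisfies the skein relations: whenever the braids occurring in one of
the relations are inserted in the same way into a larger braid, the values of `F` satisfy the
corresponding linear relation. -/
def SatisfiesSkein {M : Type*} [AddCommGroup M] [Module QT M] (F : BraidGroup n → M) : Prop :=
  ∀ α β : BraidGroup n, VanishesOnSkein fun r => linExt F (br α * r * br β)

/-- The braid representation of an R-matrix, extended to the group algebra `ℚ(t₀, t₁)[B_n]`. -/
noncomputable def RMatrix.algRep {K : Type*} [Field K] [Algebra QT K] {ι : Type*} [Fintype ι]
    [DecidableEq ι] (R : RMatrix K ι) (n : ℕ) :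
    BraidAlgebra n →ₐ[QT] Matrix (Fin n → ι) (Fin n → ι) K :=
  MonoidAlgebra.lift QT _ (BraidGroup n) ((Units.coeHom _).comp (R.braidRep n))

end Skein

/-! ### The invariants `V_1` and `LG` -/

/-- The R-matrix `R_V = R_{V,1}` of the `V_1`-polynomial. -/
noncomputable def RV : RMatrix QT (Fin 4) where
  mat := ofTable (tableV t₀ t₁ 1)
  isUnit := isUnit_V t₀_ne_zero t₁_ne_zero one_ne_zero
  yangBaxter := yangBaxter_V t₁_ne_zero one_ne_zero

/-- The enhancement `h_V = diag(-1, 1, 1, -1)`. -/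
noncomputable def hV : Fin 4 → QT := ![-1, 1, 1, -1]

/-- The `V_1`-polynomial of the link that is the closure of the braid `β`. -/
noncomputable def V1 {n : ℕ} (β : BraidGroup (n + 1)) : QT := RV.linkInvariant hV β

/-- A choice, in an extension field `K` of `ℚ(t₀, t₁)`, of the square roots `a = t₀^{1/2}`,
`b = t₁^{1/2}` and `Y = √((t₀ - 1) (1 - t₁))` that occur in the Links--Gould R-matrix. -/
structure LGRoots (K : Type*) [Field K] [Algebra QT K] where
  a : K
  b : K
  Y : K
  a_sq : a ^ 2 = algebraMap QT K t₀
  b_sq : b ^ 2 = algebraMap QT K t₁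
  Y_sq : Y ^ 2 = (algebraMap QT K t₀ - 1) * (1 - algebraMap QT K t₁)

section LG

variable {K : Type*} [Field K] [Algebra QT K]

/-- The Links--Gould R-matrix. -/
noncomputable def RLG (w : LGRoots K) : RMatrix K (Fin 4) where
  mat := ofTable (tableLG (algebraMap QT K t₀) (algebraMap QT K t₁) w.a w.b w.Y)
  isUnit := isUnit_LG ((map_ne_zero _).2 t₀_ne_zero) ((map_ne_zero _).2 t₁_ne_zero)
    w.a_sq w.b_sq w.Y_sq
  yangBaxter := yangBaxter_LG w.a_sq w.b_sq w.Y_sq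

/-- The enhancement `h_LG = diag(t₀⁻¹, -t₁, -t₀⁻¹, t₁)`. -/
noncomputable def hLG (K : Type*) [Field K] [Algebra QT K] : Fin 4 → K :=
  ![(algebraMap QT K t₀)⁻¹, -algebraMap QT K t₁, -(algebraMap QT K t₀)⁻¹, algebraMap QT K t₁]

/-- The Links--Gould polynomial of the link that is the closure of the braid `β`. -/
noncomputable def LG (w : LGRoots K) {n : ℕ} (β : BraidGroup (n + 1)) : K :=
  (RLG w).linkInvariant (hLG K) β

end LG

end LinksGould

/-!
# Skein relations for `V_1` and `LG`

Each skein relation involves at most four neighbouring strands, so in the representation of an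
R-matrix it is an identity between endomorphisms of the fourth tensor power of `V`: an operator
that acts on some tensor factors only vanishes on a large tensor power if and only if it vanishes
on the tensor power of these factors (`WordTree.mat_localOp_eq_zero`). The link invariants are
linear functionals of the matrix of the braid, and the kernel of an algebra homomorphism is an
ideal, so the invariants inherit the relations that hold in the representation
(`satisfiesSkein_linkInvariant`).

It remains to verify three relations, the second one in two forms, between `256 × 256` matrices
over a field of rational functions. They are turned into identities between matrices over
`ℤ[x, y]`. For `R_V` one takes `x = t₀`, `y = t₁` and multiplies the R-matrix by `t₁` and its inverse
by `t₀ t₁`. For `R_LG` one takes `x = t₀^{1/2}`, `y = t₁^{1/2}`, multiplies the inverse by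
`t₀ t₁`, and multiplies the fourth basis vector by `Y = √((t₀ - 1) (1 - t₁))`, after which only `Y²`
occurs. The coefficients of the four-strand relation are multiplied by their common denominator
`WordSum.denom`. That the vanishing of the polynomial matrices gives the relations for the
R-matrices is `IsModel.vanishesOnSkein`.

The polynomial identities are decided by Kronecker substitution (`eq_zero_of_evalAt_eq_zero`): an
integer polynomial in two variables whose coefficients are smaller than `N`, and whose partial
values at `x = N` are smaller than `M`, is zero as soon as it vanishes at `(N, M)`. The required
bounds come from a submultiplicative seminorm, which bounds the row sums of a product of matrices
by the product of the bounds (`WordTree.rowBounded`). The words of a relation are arranged as a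
prefix tree, so that common prefixes are multiplied only once, and each row of the matrix is
computed by a walk through this tree (`NumTree.walk`). Both tests, `smallAt` for the bounds and
`vanishesAt` for the value, are evaluations of natural numbers by the kernel, and
`mat_eq_zero_of_check` is their correctness.
-/

namespace LinksGould

/-! ### Majorants and Kronecker substitution -/

section Kronecker

open Polynomial

/-- A submultiplicative seminorm on a ring, with values in the natural numbers; `ν 1 ≤ 1` is not
required. -/
structure IsMajorant {R : Type*} [CommRing R] (ν : R → ℕ) : Prop where
  zero : ν 0 = 0
  neg : ∀ a, ν (-a) = ν a
  add_le : ∀ a b, ν (a + b) ≤ ν a + ν b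
  mul_le : ∀ a b, ν (a * b) ≤ ν a * ν b

theorem isMajorant_natAbs : IsMajorant Int.natAbs where
  zero := rfl
  neg := Int.natAbs_neg
  add_le := Int.natAbs_add_le
  mul_le a b := (Int.natAbs_mul a b).le

theorem IsMajorant.sum_le {R : Type*} [CommRing R] {ν : R → ℕ} (h : IsMajorant ν) {σ : Type*}
    (s : Finset σ) (F : σ → R) : ν (∑ i ∈ s, F i) ≤ ∑ i ∈ s, ν (F i) :=
  Finset.le_sum_of_subadditive ν h.zero.le h.add_le s F

/-- The weighted `ℓ¹`-seminorm `∑ ν(cᵢ) rⁱ` of the polynomial `∑ cᵢ Xⁱ`. -/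
noncomputable def l1 {R : Type*} [CommRing R] (ν : R → ℕ) (r : ℕ) (p : R[X]) : ℕ :=
  p.sum fun i c => ν c * r ^ i

section

variable {R : Type*} [CommRing R] {ν : R → ℕ}

theorem l1_monomial (h : IsMajorant ν) (r i : ℕ) (c : R) :
    l1 ν r (monomial i c) = ν c * r ^ i :=
  sum_monomial_index c _ (by simp [h.zero])

theorem l1_isMajorant (h : IsMajorant ν) (r : ℕ) : IsMajorant (l1 ν r) := by
  have hadd : ∀ p q : R[X], l1 ν r (p + q) ≤ l1 ν r p + l1 ν r q := by
    intro p q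
    have hz : ∀ i, ν 0 * r ^ i = 0 := by simp [h.zero]
    unfold l1
    rw [sum_eq_of_subset _ hz (support_add (p := p) (q := q)),
      sum_eq_of_subset _ hz (Finset.subset_union_left (s₁ := p.support) (s₂ := q.support)),
      sum_eq_of_subset _ hz (Finset.subset_union_right (s₁ := p.support) (s₂ := q.support)),
      ← Finset.sum_add_distrib]
    refine Finset.sum_le_sum fun i _ => ?_
    rw [coeff_add, ← add_mul]
    exact Nat.mul_le_mul_right _ (h.add_le _ _)
  have hzero : l1 ν r 0 = 0 := by simp [l1]
  refine ⟨hzero, fun p => ?_, hadd, fun p q => ?_⟩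
  · simp [l1, Polynomial.sum_def, h.neg]
  · rw [mul_eq_sum_sum]
    refine (Finset.le_sum_of_subadditive _ hzero.le hadd _ _).trans ?_
    rw [l1, l1, Polynomial.sum_def, Finset.sum_mul]
    refine Finset.sum_le_sum fun i _ => ?_
    rw [Polynomial.sum_def, Polynomial.sum_def, Finset.mul_sum]
    refine (Finset.le_sum_of_subadditive _ hzero.le hadd _ _).trans
      (Finset.sum_le_sum fun j _ => ?_)
    rw [l1_monomial h, pow_add, mul_mul_mul_comm]
    exact Nat.mul_le_mul_right _ (h.mul_le _ _)

theorem majorant_coeff_mul_pow_le (h : IsMajorant ν) (r : ℕ) (p : R[X]) (i : ℕ) :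
    ν (p.coeff i) * r ^ i ≤ l1 ν r p := by
  by_cases hi : i ∈ p.support
  · exact Finset.single_le_sum (f := fun i => ν (p.coeff i) * r ^ i) (fun _ _ => Nat.zero_le _) hi
  · simp [notMem_support_iff.1 hi, h.zero]

end

theorem natAbs_eval_le (N : ℕ) (p : ℤ[X]) : (p.eval (N : ℤ)).natAbs ≤ l1 Int.natAbs N p := by
  rw [eval_eq_sum, Polynomial.sum_def]
  refine (isMajorant_natAbs.sum_le _ _).trans (Finset.sum_le_sum fun i _ => ?_)
  simp [Int.natAbs_mul, Int.natAbs_pow]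

/-- An integer polynomial whose coefficients are smaller than `N` is determined by its value at `N`:
reducing modulo `N` shows that the constant coefficient of a polynomial vanishing at `N` is `0`. -/
theorem eq_zero_of_eval_eq_zero {N : ℕ} (p : ℤ[X]) (hp : ∀ i, (p.coeff i).natAbs < N)
    (h : p.eval (N : ℤ) = 0) : p = 0 := by
  induction hn : p.natDegree using Nat.strong_induction_on generalizing p with
  | _ n ih =>
    have hN : (N : ℤ) ≠ 0 := by have := hp 0; omega
    have h0 : p.coeff 0 = 0 := by
      refine Int.eq_zero_of_dvd_of_natAbs_lt_natAbs (d := (N : ℤ)) ?_ (by simpa using hp 0)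
      rw [← divX_mul_X_add p] at h
      simp only [eval_add, eval_mul, eval_X, eval_C] at h
      exact ⟨-(p.divX.eval (N : ℤ)), by linear_combination h⟩
    have hX : p = p.divX * X := by
      conv_lhs => rw [← divX_mul_X_add p, h0, C_0, add_zero]
    by_cases hd : p.natDegree = 0
    · rw [eq_C_of_natDegree_eq_zero hd, h0, C_0]
    · rw [hX, ih p.divX.natDegree (by rw [natDegree_divX_eq_natDegree_tsub_one]; omega) p.divX
        (fun i => by simpa using hp (i + 1)) ?_ rfl, zero_mul]
      rw [hX, eval_mul, eval_X] at h
      exact (mul_eq_zero.1 h).resolve_right hN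

/-- The majorant `∑ |cᵢⱼ| rⁱ` of the polynomial `∑ cᵢⱼ xⁱ yʲ`, where `ℤ[x, y]` is `ℤ[X][X]` with
`x` as the inner and `y` as the outer variable. -/
noncomputable def majorant (r : ℕ) : ℤ[X][X] → ℕ := l1 (l1 Int.natAbs r) 1

theorem isMajorant_majorant (r : ℕ) : IsMajorant (majorant r) :=
  l1_isMajorant (l1_isMajorant isMajorant_natAbs r) 1

/-- Evaluation of integer polynomials in two variables at a point of a commutative ring. -/
noncomputable def evalAt {R : Type*} [CommRing R] (x y : R) : ℤ[X][X] →+* R :=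
  eval₂RingHom (eval₂RingHom (Int.castRingHom R) x) y

/-- Kronecker substitution in two variables: a polynomial with coefficients smaller than `N`, the
values at `N` of whose `y`-coefficients are smaller than `M`, is determined by its value at
`(N, M)`. -/
theorem eq_zero_of_evalAt_eq_zero {N M : ℕ} (p : ℤ[X][X]) (hN : majorant 1 p < N)
    (hM : majorant N p < M) (h : evalAt (N : ℤ) (M : ℤ) p = 0) : p = 0 := by
  have hc : ∀ j, (p.coeff j).eval (N : ℤ) = 0 := by
    have hmap : p.map (evalRingHom (N : ℤ)) = 0 := by
      refine eq_zero_of_eval_eq_zero (N := M) _ (fun j => ?_) ?_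
      · rw [coeff_map, coe_evalRingHom]
        refine lt_of_le_of_lt ((natAbs_eval_le N _).trans ?_) hM
        simpa [majorant] using
          majorant_coeff_mul_pow_le (l1_isMajorant isMajorant_natAbs N) 1 p j
      · rw [eval_map]
        convert h using 1
        simp only [evalAt, coe_eval₂RingHom]
        congr 1
    intro j
    simpa using congrArg (fun q => q.coeff j) hmap
  ext1 j
  rw [coeff_zero]
  refine eq_zero_of_eval_eq_zero (N := N) _ (fun i => lt_of_le_of_lt ?_ hN) (hc j)
  have h1 := majorant_coeff_mul_pow_le isMajorant_natAbs 1 (p.coeff j) i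
  have h2 := majorant_coeff_mul_pow_le (l1_isMajorant isMajorant_natAbs 1) 1 p j
  simp only [one_pow, mul_one] at h1 h2
  exact h1.trans h2

/-- Integer polynomials in two variables as formal expressions, in a form that can be evaluated by
computation. -/
inductive PolyExpr
  | const (z : ℤ)
  | X
  | Y
  | add (a b : PolyExpr)
  | mul (a b : PolyExpr)
  | neg (a : PolyExpr)
  | pow (a : PolyExpr) (n : ℕ)

namespace PolyExpr

instance : Add PolyExpr := ⟨add⟩
instance : Mul PolyExpr := ⟨mul⟩
instance : Neg PolyExpr := ⟨neg⟩
instance : Sub PolyExpr := ⟨fun a b => add a (neg b)⟩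
instance : Pow PolyExpr ℕ := ⟨pow⟩
instance (n : ℕ) : OfNat PolyExpr n := ⟨const n⟩

variable {R : Type*} [CommRing R]

/-- The value of an expression at the point `(x, y)`. -/
def eval (x y : R) : PolyExpr → R
  | const z => z
  | X => x
  | Y => y
  | add a b => a.eval x y + b.eval x y
  | mul a b => a.eval x y * b.eval x y
  | neg a => -a.eval x y
  | pow a n => a.eval x y ^ n

section

variable (x y : R) (a b : PolyExpr) (n : ℕ)

@[simp] theorem eval_X : (X : PolyExpr).eval x y = x := rfl
@[simp] theorem eval_Y : (Y : PolyExpr).eval x y = y := rfl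
@[simp] theorem eval_add : (a + b).eval x y = a.eval x y + b.eval x y := rfl
@[simp] theorem eval_mul : (a * b).eval x y = a.eval x y * b.eval x y := rfl
@[simp] theorem eval_neg : (-a).eval x y = -a.eval x y := rfl
@[simp] theorem eval_pow : (a ^ n).eval x y = a.eval x y ^ n := rfl

@[simp] theorem eval_sub : (a - b).eval x y = a.eval x y - b.eval x y :=
  (sub_eq_add_neg (a.eval x y) (b.eval x y)).symm

@[simp] theorem eval_one : (1 : PolyExpr).eval x y = 1 := by
  change (((1 : ℕ) : ℤ) : R) = 1; simp

@[simp] theorem eval_ofNat [n.AtLeastTwo] : (ofNat(n) : PolyExpr).eval x y = ofNat(n) := by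
  change (((OfNat.ofNat n : ℕ) : ℤ) : R) = _; simp

theorem map_eval {S : Type*} [CommRing S] (φ : R →+* S) : φ (a.eval x y) = a.eval (φ x) (φ y) := by
  induction a <;> simp_all [eval]

end

/-- Substitution of the expressions `u` and `v` for the variables. -/
def subst (a u v : PolyExpr) : PolyExpr :=
  match a with
  | const z => const z
  | X => u
  | Y => v
  | add a b => add (a.subst u v) (b.subst u v)
  | mul a b => mul (a.subst u v) (b.subst u v)
  | neg a => neg (a.subst u v)
  | pow a n => pow (a.subst u v) n

theorem eval_subst (x y : R) (u v a : PolyExpr) :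
    (a.subst u v).eval x y = a.eval (u.eval x y) (v.eval x y) := by
  induction a <;> simp_all [eval, subst]

/-- The expression as an element of `ℤ[x, y]`. -/
noncomputable def toPoly (a : PolyExpr) : ℤ[X][X] := a.eval (C Polynomial.X) Polynomial.X

theorem evalAt_toPoly (x y : R) (a : PolyExpr) : evalAt x y a.toPoly = a.eval x y := by
  rw [toPoly, map_eval]
  simp [evalAt]

/-- A bound for the majorant that is computed along the expression. -/
def bound (r : ℕ) : PolyExpr → ℕ
  | const z => z.natAbs
  | X => r
  | Y => 1
  | add a b => Nat.add (a.bound r) (b.bound r)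
  | mul a b => Nat.mul (a.bound r) (b.bound r)
  | neg a => a.bound r
  | pow a n => Nat.pow (a.bound r) n

theorem majorant_toPoly_le (r : ℕ) (a : PolyExpr) : majorant r a.toPoly ≤ a.bound r := by
  have h1 : ∀ (i j : ℕ) (c : ℤ), majorant r (monomial j (monomial i c)) = c.natAbs * r ^ i := by
    intro i j c
    rw [majorant, l1_monomial (l1_isMajorant isMajorant_natAbs r), l1_monomial isMajorant_natAbs,
      one_pow, mul_one]
  have hC : ∀ z : ℤ, (z : ℤ[X][X]) = monomial 0 (monomial 0 z) := fun z => by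
    rw [monomial_zero_left, monomial_zero_left]; simp
  have hM := isMajorant_majorant r
  induction a with
  | const z =>
    change majorant r (z : ℤ[X][X]) ≤ z.natAbs
    rw [hC, h1]
    simp
  | X =>
    change majorant r (C Polynomial.X) ≤ r
    rw [← monomial_zero_left, ← monomial_one_one_eq_X, h1]
    simp
  | Y =>
    change majorant r Polynomial.X ≤ 1
    rw [← monomial_one_one_eq_X, ← C_1, ← monomial_zero_left, h1]
    simp
  | add a b iha ihb => exact (hM.add_le _ _).trans (Nat.add_le_add iha ihb)
  | mul a b iha ihb => exact (hM.mul_le _ _).trans (Nat.mul_le_mul iha ihb)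
  | neg a ih => exact (hM.neg _).le.trans ih
  | pow a n ih =>
    change majorant r (a.toPoly ^ n) ≤ a.bound r ^ n
    induction n with
    | zero =>
      have := (h1 0 0 1).le
      rw [← hC] at this
      simpa using this
    | succ n ihn =>
      rw [pow_succ, pow_succ]
      exact (hM.mul_le _ _).trans (Nat.mul_le_mul ihn ih)

end PolyExpr

end Kronecker

/-! ### Two-site operators over commutative semirings -/

section SiteOperators

variable {R : Type*} [CommSemiring R] {ι : Type*} {P : Type*} [Fintype P] [DecidableEq P]

/-- The operator `localOp M p q` (the two agree by definition over a field), for matrices over a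
commutative semiring: it is needed over `ℤ`, `ℤ[x, y]` and `ℕ`. -/
def siteOp [DecidableEq ι] (M : Matrix (ι × ι) (ι × ι) R) (p q : P) : Matrix (P → ι) (P → ι) R :=
  Matrix.of fun f g =>
    if ∀ k, k ≠ p → k ≠ q → f k = g k then M (f p, f q) (g p, g q) else 0

open Matrix in
theorem siteOp_mulVec [Fintype ι] [DecidableEq ι] (M : Matrix (ι × ι) (ι × ι) R) {p q : P}
    (hpq : p ≠ q) (φ : (P → ι) → R) (f : P → ι) :
    (siteOp M p q *ᵥ φ) f =
      ∑ x : ι × ι, M (f p, f q) x *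
        φ (Function.update (Function.update f p x.1) q x.2) := by
  classical
  have hback : ∀ g : P → ι, (∀ k, k ≠ p → k ≠ q → f k = g k) →
      Function.update (Function.update f p (g p)) q (g q) = g := by
    intro g hg
    funext k
    by_cases h2 : k = q
    · subst h2; simp
    · by_cases h1 : k = p
      · subst h1; simp [h2]
      · simp [h1, h2, hg k h1 h2]
  simp only [Matrix.mulVec, dotProduct, siteOp, Matrix.of_apply, ite_mul, zero_mul]
  rw [← Finset.sum_filter]
  refine Finset.sum_bij' (fun g _ => (g p, g q))
    (fun x _ => Function.update (Function.update f p x.1) q x.2) ?_ ?_ ?_ ?_ ?_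
  · intros; simp
  · intro x _
    simp only [Finset.mem_filter, Finset.mem_univ, true_and]
    intro k h1 h2
    simp [h1, h2]
  · intro g hg
    exact hback g (by simpa using hg)
  · intro x _
    simp [hpq]
  · intro g hg
    simp [hback g (by simpa using hg)]

theorem siteOp_map [DecidableEq ι] {S : Type*} [CommSemiring S] (φ : R →+* S)
    (M : Matrix (ι × ι) (ι × ι) R)
    (p q : P) : (siteOp M p q).map φ = siteOp (M.map φ) p q := by
  ext f g
  simp [siteOp, apply_ite φ]

end SiteOperators

/-! ### Linear combinations of words and their matrices -/

/-- The three pairs of neighbouring positions among four. -/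
inductive Pos
  | p01
  | p12
  | p23

/-- A letter: a generator (`true`) or its inverse (`false`), acting at a pair of neighbouring
positions. -/
abbrev Letter : Type := Pos × Bool

/-- A linear combination of words, arranged as a prefix tree: `emit e t` adds the empty word with
the coefficient `e`, and `letter p s u t` adds all words of `u` with the letter `(p, s)` put in
front. -/
inductive WordTree
  | nil
  | emit (e : PolyExpr) (t : WordTree)
  | letter (p : Pos) (s : Bool) (u t : WordTree)

namespace WordTree

/-- Equality of letters, by cases. -/
def sameLetter : Pos → Bool → Letter → Bool
  | .p01, true, (.p01, true) => true
  | .p01, false, (.p01, false) => true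
  | .p12, true, (.p12, true) => true
  | .p12, false, (.p12, false) => true
  | .p23, true, (.p23, true) => true
  | .p23, false, (.p23, false) => true
  | _, _, _ => false

theorem eq_of_sameLetter {p : Pos} {s : Bool} {l : Letter} (h : sameLetter p s l = true) :
    l = (p, s) := by
  obtain ⟨q, r⟩ := l
  cases p <;> cases s <;> cases q <;> cases r <;> simp_all [sameLetter]

/-- The tree consisting of one word. -/
def single (e : PolyExpr) : List Letter → WordTree
  | [] => emit e nil
  | l :: w => letter l.1 l.2 (single e w) nil

/-- Add a word to a tree, sharing prefixes. -/
def insert (e : PolyExpr) : WordTree → List Letter → WordTree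
  | nil, w => single e w
  | emit e' t, w => emit e' (t.insert e w)
  | letter p s u t, [] => letter p s u (t.insert e [])
  | letter p s u t, l :: w =>
    match sameLetter p s l with
    | true => letter p s (u.insert e w) t
    | false => letter p s u (t.insert e (l :: w))

/-- The tree of a list of words with coefficients. -/
def ofList : List (PolyExpr × List Letter) → WordTree
  | [] => nil
  | a :: l => (ofList l).insert a.1 a.2

/-- Whether only letters at the positions in `S` occur. -/
def Uses (S : Pos → Prop) : WordTree → Prop
  | nil => True
  | emit _ t => t.Uses S
  | letter p _ u t => S p ∧ u.Uses S ∧ t.Uses S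

section

variable {R : Type*} [CommRing R] {n : Type*} [Fintype n] [DecidableEq n]

/-- The matrix of a linear combination of words, when the coefficients are evaluated by `ev` and
the letters by `L`. -/
def mat (ev : PolyExpr → R) (L : Pos → Bool → Matrix n n R) : WordTree → Matrix n n R
  | nil => 0
  | emit e t => ev e • 1 + t.mat ev L
  | letter p s u t => L p s * u.mat ev L + t.mat ev L

variable (ev : PolyExpr → R) (L : Pos → Bool → Matrix n n R)

theorem mat_single (e : PolyExpr) (w : List Letter) :
    (single e w).mat ev L = ev e • (w.map fun l => L l.1 l.2).prod := by
  induction w with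
  | nil => simp [single, mat]
  | cons l w ih => simp [single, mat, ih]

theorem mat_insert (e : PolyExpr) (t : WordTree) (w : List Letter) :
    (t.insert e w).mat ev L = ev e • (w.map fun l => L l.1 l.2).prod + t.mat ev L := by
  induction t generalizing w with
  | nil => simp [insert, mat, mat_single]
  | emit e' t ih => rw [insert, mat, ih, mat]; abel
  | letter p s u t ihu iht =>
    cases w with
    | nil => rw [insert, mat, iht, mat]; abel
    | cons l w =>
      rw [insert]
      split
      next h =>
        rw [mat, ihu, mat, eq_of_sameLetter h]
        simp [mul_add, add_assoc]
      next h => rw [mat, iht, mat]; abel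

theorem mat_ofList (l : List (PolyExpr × List Letter)) :
    (ofList l).mat ev L = (l.map fun a => ev a.1 • (a.2.map fun l => L l.1 l.2).prod).sum := by
  induction l with
  | nil => rfl
  | cons a l ih => rw [ofList, mat_insert, ih, List.map_cons, List.sum_cons]

theorem map_mat {S : Type*} [CommRing S] (φ : R →+* S) (t : WordTree) :
    (t.mat ev L).map φ = t.mat (fun e => φ (ev e)) (fun p s => (L p s).map φ) := by
  induction t with
  | nil => ext; simp [mat]
  | emit e t ih =>
    rw [mat, mat, ← ih]
    ext i j
    simp [Matrix.one_apply, apply_ite φ]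
  | letter p s u t ihu iht =>
    rw [mat, mat, ← ihu, ← iht, ← Matrix.map_mul, Matrix.map_add φ (map_add φ)]

theorem mat_mul_of_intertwine {L' : Pos → Bool → Matrix n n R} {D : Matrix n n R}
    (h : ∀ p s, L p s * D = D * L' p s) (t : WordTree) : t.mat ev L * D = D * t.mat ev L' := by
  induction t with
  | nil => simp [mat]
  | emit e t ih => simp [mat, add_mul, mul_add, ih]
  | letter p s u t ihu iht =>
    rw [mat, mat, add_mul, mul_add, iht, mul_assoc, ihu, ← mul_assoc, h, mul_assoc]

end

end WordTree

/-! ### Tables with polynomial entries -/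

/-- The four basis labels. -/
inductive Label
  | v1
  | v2
  | v3
  | v4

/-- The number of a label, counted from `0`. -/
def Label.toFin : Label → Fin 4
  | v1 => 0
  | v2 => 1
  | v3 => 2
  | v4 => 3

/-- The label with a given number. -/
def Label.ofFin : Fin 4 → Label := ![v1, v2, v3, v4]

theorem Label.ofFin_toFin (a : Label) : ofFin a.toFin = a := by cases a <;> rfl

theorem Label.toFin_ofFin (i : Fin 4) : (ofFin i).toFin = i := by fin_cases i <;> rfl

/-- A sparse matrix of an endomorphism of `V ⊗ V`: for each pair of labels `(a, b)`, the list of the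
nonzero entries in the row `(a, b)`, each with its column. -/
abbrev Table : Type := Label → Label → List (Label × Label × PolyExpr)

namespace Table

variable {R : Type*} [CommRing R]

/-- The matrix of a table, with entries evaluated by `ev`. -/
def mat (ev : PolyExpr → R) (T : Table) : Matrix (Fin 4 × Fin 4) (Fin 4 × Fin 4) R :=
  Matrix.of fun x y => ((T (Label.ofFin x.1) (Label.ofFin x.2)).map fun t =>
    if (t.1.toFin, t.2.1.toFin) = y then ev t.2.2 else 0).sum

theorem sum_mat_mul (ev : PolyExpr → R) (T : Table) (a b : Label) (φ : Fin 4 × Fin 4 → R) :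
    ∑ y, T.mat ev (a.toFin, b.toFin) y * φ y =
      ((T a b).map fun t => ev t.2.2 * φ (t.1.toFin, t.2.1.toFin)).sum := by
  simp only [mat, Matrix.of_apply, Label.ofFin_toFin]
  induction T a b with
  | nil => simp
  | cons t l ih => simp [add_mul, Finset.sum_add_distrib, ih, ite_mul]

theorem map_mat {S : Type*} [CommRing S] (φ : R →+* S) (ev : PolyExpr → R) (T : Table) :
    (T.mat ev).map φ = T.mat fun e => φ (ev e) := by
  ext x y
  simp [mat, map_list_sum, Function.comp_def, apply_ite φ]

end Table

/-- The left position of a pair. -/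
def Pos.left : Pos → Fin 4
  | p01 => 0
  | p12 => 1
  | p23 => 2

/-- The right position of a pair. -/
def Pos.right : Pos → Fin 4
  | p01 => 1
  | p12 => 2
  | p23 => 3

theorem Pos.left_ne_right (p : Pos) : p.left ≠ p.right := by cases p <;> decide

/-- The operators on the fourth tensor power that are given by two tables, for the generators
(`true`) and for the inverse generators (`false`). -/
def tableOps {R : Type*} [CommRing R] (ev : PolyExpr → R) (T : Bool → Table) (p : Pos) (s : Bool) :
    Matrix (Fin 4 → Fin 4) (Fin 4 → Fin 4) R :=
  siteOp ((T s).mat ev) p.left p.right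

/-- The index of a basis vector of the fourth tensor power. -/
def idx (a b c d : Label) : Fin 4 → Fin 4 := ![a.toFin, b.toFin, c.toFin, d.toFin]

theorem eq_idx (f : Fin 4 → Fin 4) :
    f = idx (.ofFin (f 0)) (.ofFin (f 1)) (.ofFin (f 2)) (.ofFin (f 3)) := by
  funext k
  fin_cases k <;> simp [idx, Label.toFin_ofFin]

section

open Matrix

variable {R : Type*} [CommRing R] (ev : PolyExpr → R) (T : Bool → Table) (s : Bool)
  (φ : (Fin 4 → Fin 4) → R) (a b c d : Label)

theorem tableOps_p01_mulVec : (tableOps ev T .p01 s *ᵥ φ) (idx a b c d) =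
    ((T s a b).map fun t => ev t.2.2 * φ (idx t.1 t.2.1 c d)).sum := by
  rw [tableOps, siteOp_mulVec _ (Pos.left_ne_right _)]
  refine ((T s).sum_mat_mul ev a b fun y => φ (Function.update (Function.update (idx a b c d) 0 y.1)
    1 y.2)).trans ?_
  congr 1
  refine List.map_congr_left fun t _ => congrArg (fun f => ev t.2.2 * φ f) ?_
  funext k
  fin_cases k <;> rfl

theorem tableOps_p12_mulVec : (tableOps ev T .p12 s *ᵥ φ) (idx a b c d) =
    ((T s b c).map fun t => ev t.2.2 * φ (idx a t.1 t.2.1 d)).sum := by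
  rw [tableOps, siteOp_mulVec _ (Pos.left_ne_right _)]
  refine ((T s).sum_mat_mul ev b c fun y => φ (Function.update (Function.update (idx a b c d) 1 y.1)
    2 y.2)).trans ?_
  congr 1
  refine List.map_congr_left fun t _ => congrArg (fun f => ev t.2.2 * φ f) ?_
  funext k
  fin_cases k <;> rfl

theorem tableOps_p23_mulVec : (tableOps ev T .p23 s *ᵥ φ) (idx a b c d) =
    ((T s c d).map fun t => ev t.2.2 * φ (idx a b t.1 t.2.1)).sum := by
  rw [tableOps, siteOp_mulVec _ (Pos.left_ne_right _)]
  refine ((T s).sum_mat_mul ev c d fun y => φ (Function.update (Function.update (idx a b c d) 2 y.1)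
    3 y.2)).trans ?_
  congr 1
  refine List.map_congr_left fun t _ => congrArg (fun f => ev t.2.2 * φ f) ?_
  funext k
  fin_cases k <;> rfl

theorem tableOps_map {S : Type*} [CommRing S] (ψ : R →+* S) (p : Pos) :
    (tableOps ev T p s).map ψ = tableOps (fun e => ψ (ev e)) T p s := by
  rw [tableOps, siteOp_map, Table.map_mat, tableOps]

end

/-! ### Majorants of matrices -/

/-- All row sums of the majorants of the entries are at most `B`. -/
def RowBounded {R : Type*} (ν : R → ℕ) {n : Type*} [Fintype n] (W : Matrix n n R) (B : ℕ) : Prop :=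
  ∀ f, ∑ g, ν (W f g) ≤ B

section RowBounds

variable {R : Type*} [CommRing R] {ν : R → ℕ} {n : Type*} [Fintype n]

theorem RowBounded.add (h : IsMajorant ν) {A B : Matrix n n R} {a b : ℕ} (hA : RowBounded ν A a)
    (hB : RowBounded ν B b) : RowBounded ν (A + B) (a + b) := fun f =>
  (Finset.sum_le_sum fun g _ => h.add_le (A f g) (B f g)).trans
    (by rw [Finset.sum_add_distrib]; exact Nat.add_le_add (hA f) (hB f))

theorem RowBounded.mul (h : IsMajorant ν) {A B : Matrix n n R} {a b : ℕ} (hA : RowBounded ν A a)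
    (hB : RowBounded ν B b) : RowBounded ν (A * B) (a * b) := fun f => by
  calc ∑ g, ν ((A * B) f g) ≤ ∑ g, ∑ k, ν (A f k) * ν (B k g) :=
        Finset.sum_le_sum fun g _ => by
          rw [Matrix.mul_apply]
          exact (h.sum_le _ _).trans (Finset.sum_le_sum fun k _ => h.mul_le _ _)
    _ = ∑ k, ν (A f k) * ∑ g, ν (B k g) := by
        rw [Finset.sum_comm]; simp only [Finset.mul_sum]
    _ ≤ ∑ k, ν (A f k) * b := Finset.sum_le_sum fun k _ => Nat.mul_le_mul_left _ (hB k)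
    _ ≤ a * b := by rw [← Finset.sum_mul]; exact Nat.mul_le_mul_right _ (hA f)

theorem rowBounded_zero (h : IsMajorant ν) : RowBounded ν (0 : Matrix n n R) 0 := fun f => by
  simp [h.zero]

theorem rowBounded_smul_one [DecidableEq n] (h : IsMajorant ν) {c : R} {b : ℕ} (hc : ν c ≤ b) :
    RowBounded ν (c • (1 : Matrix n n R)) b := fun f => by
  simpa [Matrix.one_apply, apply_ite ν, h.zero] using hc

theorem rowBounded_siteOp (h : IsMajorant ν) {ι P : Type*} [Fintype ι] [DecidableEq ι] [Fintype P]
    [DecidableEq P] {M : Matrix (ι × ι) (ι × ι) R} {b : ℕ} (hM : RowBounded ν M b) {p q : P}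
    (hpq : p ≠ q) : RowBounded ν (siteOp M p q) b := fun f => by
  -- the majorants of the entries are the entries of a two-site operator over `ℕ`
  have h1 := siteOp_mulVec (M.map ν) hpq 1 f
  simp only [Matrix.mulVec, dotProduct, siteOp, Matrix.of_apply, Matrix.map_apply, Pi.one_apply,
    mul_one] at h1
  simp only [siteOp, Matrix.of_apply, apply_ite ν, h.zero, h1]
  exact hM _

end RowBounds

/-- The maximum over the labels. -/
def supLabel (F : Label → ℕ) : ℕ := Nat.max (F .v1) (Nat.max (F .v2) (Nat.max (F .v3) (F .v4)))

theorem le_supLabel (F : Label → ℕ) (a : Label) : F a ≤ supLabel F := by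
  unfold supLabel
  change F a ≤ max (F .v1) (max (F .v2) (max (F .v3) (F .v4)))
  cases a <;> simp

/-- A bound for the majorants of the rows of a table. -/
def Table.bound (r : ℕ) (T : Table) : ℕ :=
  supLabel fun a => supLabel fun b => (T a b).foldr (fun t k => Nat.add (t.2.2.bound r) k) 0

theorem Table.rowBounded (r : ℕ) (T : Table) :
    RowBounded (majorant r) (T.mat PolyExpr.toPoly) (T.bound r) := by
  rintro ⟨i, j⟩
  obtain ⟨a, rfl⟩ : ∃ a : Label, a.toFin = i := ⟨_, Label.toFin_ofFin i⟩
  obtain ⟨b, rfl⟩ : ∃ b : Label, b.toFin = j := ⟨_, Label.toFin_ofFin j⟩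
  refine le_trans ?_ ((le_supLabel _ b).trans
    (le_supLabel (fun a => supLabel fun b => (T a b).foldr _ 0) a))
  simp only [Table.mat, Matrix.of_apply, Label.ofFin_toFin]
  have h := isMajorant_majorant r
  induction T a b with
  | nil => simp [h.zero]
  | cons t l ih =>
    simp only [List.map_cons, List.sum_cons, List.foldr_cons]
    refine (Finset.sum_le_sum fun g _ => h.add_le _ _).trans ?_
    rw [Finset.sum_add_distrib]
    refine Nat.add_le_add ?_ ih
    simpa [apply_ite (majorant r), h.zero] using PolyExpr.majorant_toPoly_le r t.2.2

/-- A bound for the majorants of the rows of a combination of words, from bounds for its letters. -/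
def WordTree.bound (r : ℕ) (B : Bool → ℕ) : WordTree → ℕ
  | nil => 0
  | emit e t => Nat.add (e.bound r) (t.bound r B)
  | letter _ s u t => Nat.add (Nat.mul (B s) (u.bound r B)) (t.bound r B)

theorem WordTree.rowBounded (r : ℕ) (T : Bool → Table) (t : WordTree) :
    RowBounded (majorant r) (t.mat PolyExpr.toPoly (tableOps PolyExpr.toPoly T))
      (t.bound r fun s => (T s).bound r) := by
  have h := isMajorant_majorant r
  induction t with
  | nil => exact rowBounded_zero h
  | emit e t ih => exact (rowBounded_smul_one h (e.majorant_toPoly_le r)).add h ih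
  | letter p s u t ihu iht =>
    exact ((rowBounded_siteOp h ((T s).rowBounded r) p.left_ne_right).mul h ihu).add h iht

/-! ### Evaluation at an integer point by computation in the kernel -/

/-- Continue with the literal value of `n`; this forces its evaluation. -/
def natSeq {α : Type*} (n : ℕ) (k : ℕ → α) : α :=
  match n with
  | 0 => k 0
  | m + 1 => k (m + 1)

theorem natSeq_eq {α : Type*} (n : ℕ) (k : ℕ → α) : natSeq n k = k n := by cases n <;> rfl

/-- The integer with sign `s` (`true` for a negative sign) and absolute value `v`. -/
def signed (s : Bool) (v : ℕ) : ℤ := bif s then -v else v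

theorem signed_mul (s s' : Bool) (v v' : ℕ) :
    signed (Bool.xor s s') (Nat.mul v v') = signed s v * signed s' v' := by
  cases s <;> cases s' <;> simp [signed]

/-- A row of an integer matrix on `V ⊗ V`: a list of columns, signs and absolute values. -/
inductive NumRow
  | nil
  | cons (a b : Label) (s : Bool) (v : ℕ) (t : NumRow)

/-- The product of a row with the vector `φ`. -/
def NumRow.dot (φ : Label → Label → ℤ) : NumRow → ℤ
  | nil => 0
  | cons a b s v t => signed s v * φ a b + t.dot φ

/-- A linear combination of words with integer coefficients, as a prefix tree. -/
inductive NumTree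
  | nil
  | emit (s : Bool) (v : ℕ) (t : NumTree)
  | letter (p : Pos) (s : Bool) (u t : NumTree)

/-- The value at `(a, b, c, d)` of a combination of words applied to the vector `φ`. -/
def NumTree.apply (T : Bool → Label → Label → NumRow) (φ : Label → Label → Label → Label → ℤ) :
    NumTree → Label → Label → Label → Label → ℤ
  | nil, _, _, _, _ => 0
  | emit s v t, a, b, c, d => signed s v * φ a b c d + t.apply T φ a b c d
  | letter .p01 s u t, a, b, c, d =>
    (T s a b).dot (fun a b => u.apply T φ a b c d) + t.apply T φ a b c d
  | letter .p12 s u t, a, b, c, d =>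
    (T s b c).dot (fun b c => u.apply T φ a b c d) + t.apply T φ a b c d
  | letter .p23 s u t, a, b, c, d =>
    (T s c d).dot (fun c d => u.apply T φ a b c d) + t.apply T φ a b c d

section Compile

variable (x y : ℤ)

/-- The value at `(x, y)` of a row of a table. -/
def compileRow : List (Label × Label × PolyExpr) → NumRow
  | [] => .nil
  | (a, b, e) :: l =>
    match e.eval x y with
    | .ofNat n => .cons a b false n (compileRow l)
    | .negSucc n => .cons a b true (n + 1) (compileRow l)

/-- `compileRow` in continuation-passing style, evaluating all entries to literals. -/
def forceRow {α : Type*} : List (Label × Label × PolyExpr) → (NumRow → α) → α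
  | [], k => k .nil
  | (a, b, e) :: l, k =>
    match e.eval x y with
    | .ofNat n => natSeq n fun n => forceRow l fun r => k (.cons a b false n r)
    | .negSucc n => natSeq n fun n => forceRow l fun r => k (.cons a b true (n + 1) r)

theorem forceRow_eq {α : Type*} (l : List (Label × Label × PolyExpr)) (k : NumRow → α) :
    forceRow x y l k = k (compileRow x y l) := by
  induction l generalizing k with
  | nil => rfl
  | cons t l ih =>
    obtain ⟨a, b, e⟩ := t
    rw [forceRow, compileRow]
    cases e.eval x y <;> simp [natSeq_eq, ih]

/-- The value at `(x, y)` of a table, in continuation-passing style. -/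
noncomputable def forceTable {α : Type*} (T : Table) (k : (Label → Label → NumRow) → α) : α :=
  forceRow x y (T .v1 .v1) fun a1 => forceRow x y (T .v1 .v2) fun a2 =>
  forceRow x y (T .v1 .v3) fun a3 => forceRow x y (T .v1 .v4) fun a4 =>
  forceRow x y (T .v2 .v1) fun b1 => forceRow x y (T .v2 .v2) fun b2 =>
  forceRow x y (T .v2 .v3) fun b3 => forceRow x y (T .v2 .v4) fun b4 =>
  forceRow x y (T .v3 .v1) fun c1 => forceRow x y (T .v3 .v2) fun c2 =>
  forceRow x y (T .v3 .v3) fun c3 => forceRow x y (T .v3 .v4) fun c4 =>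
  forceRow x y (T .v4 .v1) fun d1 => forceRow x y (T .v4 .v2) fun d2 =>
  forceRow x y (T .v4 .v3) fun d3 => forceRow x y (T .v4 .v4) fun d4 =>
  k fun a b => Label.rec (Label.rec a1 a2 a3 a4 b) (Label.rec b1 b2 b3 b4 b)
    (Label.rec c1 c2 c3 c4 b) (Label.rec d1 d2 d3 d4 b) a

theorem forceTable_eq {α : Type*} (T : Table) (k : (Label → Label → NumRow) → α) :
    forceTable x y T k = k fun a b => compileRow x y (T a b) := by
  simp only [forceTable, forceRow_eq]
  congr 1
  funext a b
  cases a <;> cases b <;> rfl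

/-- The value at `(x, y)` of a combination of words. -/
def compileTree : WordTree → NumTree
  | .nil => .nil
  | .emit e t =>
    match e.eval x y with
    | .ofNat n => .emit false n (compileTree t)
    | .negSucc n => .emit true (n + 1) (compileTree t)
  | .letter p s u t => .letter p s (compileTree u) (compileTree t)

/-- `compileTree` in continuation-passing style, evaluating all coefficients to literals. -/
def forceTree {α : Type*} : WordTree → (NumTree → α) → α
  | .nil, k => k .nil
  | .emit e t, k =>
    match e.eval x y with
    | .ofNat n => natSeq n fun n => forceTree t fun t => k (.emit false n t)
    | .negSucc n => natSeq n fun n => forceTree t fun t => k (.emit true (n + 1) t)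
  | .letter p s u t, k => forceTree u fun u => forceTree t fun t => k (.letter p s u t)

theorem forceTree_eq {α : Type*} (t : WordTree) (k : NumTree → α) :
    forceTree x y t k = k (compileTree x y t) := by
  induction t generalizing k with
  | nil => rfl
  | emit e t ih =>
    rw [forceTree, compileTree]
    cases e.eval x y <;> simp [natSeq_eq, ih]
  | letter p s u t ihu iht => rw [forceTree, compileTree, ihu, iht]

theorem dot_compileRow (φ : Label → Label → ℤ) (l : List (Label × Label × PolyExpr)) :
    (compileRow x y l).dot φ = (l.map fun t => t.2.2.eval x y * φ t.1 t.2.1).sum := by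
  induction l with
  | nil => rfl
  | cons t l ih =>
    obtain ⟨a, b, e⟩ := t
    rw [compileRow, List.map_cons, List.sum_cons, ← ih]
    cases e.eval x y <;> simp [NumRow.dot, signed, Int.negSucc_eq]

open Matrix in
theorem apply_compileTree (T : Bool → Table) (φ : (Fin 4 → Fin 4) → ℤ) (t : WordTree)
    (a b c d : Label) :
    (compileTree x y t).apply (fun s a b => compileRow x y (T s a b))
        (fun a b c d => φ (idx a b c d)) a b c d =
      (t.mat (PolyExpr.eval x y) (tableOps (PolyExpr.eval x y) T) *ᵥ φ) (idx a b c d) := by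
  induction t generalizing a b c d with
  | nil => simp [compileTree, NumTree.apply, WordTree.mat]
  | emit e t ih =>
    rw [compileTree, WordTree.mat, Matrix.add_mulVec, Pi.add_apply, ← ih, Matrix.smul_mulVec,
      Matrix.one_mulVec, Pi.smul_apply, smul_eq_mul]
    cases e.eval x y <;> simp [NumTree.apply, signed, Int.negSucc_eq]
  | letter p s u t ihu iht =>
    rw [compileTree, WordTree.mat, Matrix.add_mulVec, Pi.add_apply, ← iht, ← Matrix.mulVec_mulVec]
    cases p
    · rw [tableOps_p01_mulVec, NumTree.apply, dot_compileRow]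
      simp only [ihu]
    · rw [tableOps_p12_mulVec, NumTree.apply, dot_compileRow]
      simp only [ihu]
    · rw [tableOps_p23_mulVec, NumTree.apply, dot_compileRow]
      simp only [ihu]

end Compile

/-- A sparse integer vector indexed by lists of labels.  Each node holds the value at the empty list
as a difference `u - v`, and the four vectors indexed by the lists that start with a given label. -/
inductive Trie
  | nil
  | node (u v : ℕ) (p q r s : Trie)

namespace Trie

/-- The scalar product with the vector `φ`. -/
def dot (φ : List Label → ℤ) : Trie → ℤ
  | nil => 0
  | node u v p q r s => ((u : ℤ) - v) * φ [] + p.dot (fun l => φ (.v1 :: l)) +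
      q.dot (fun l => φ (.v2 :: l)) + r.dot (fun l => φ (.v3 :: l)) + s.dot (fun l => φ (.v4 :: l))

/-! The functions below are written with recursors rather than by pattern matching: the kernel
evaluates them in fewer steps. -/

/-- Add `signed s w` to the value at the empty list. -/
noncomputable def addHere (s : Bool) (w : ℕ) (t : Trie) : Trie :=
  Trie.rec (Bool.rec (.node w 0 .nil .nil .nil .nil) (.node 0 w .nil .nil .nil .nil) s)
    (fun u v p q r s' _ _ _ _ =>
      Bool.rec (.node (Nat.add u w) v p q r s') (.node u (Nat.add v w) p q r s') s) t

/-- Apply `f` to the subvector indexed by the lists that start with `a`. -/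
noncomputable def modify (a : Label) (f : Trie → Trie) (t : Trie) : Trie :=
  Trie.rec (Label.rec (.node 0 0 (f .nil) .nil .nil .nil) (.node 0 0 .nil (f .nil) .nil .nil)
      (.node 0 0 .nil .nil (f .nil) .nil) (.node 0 0 .nil .nil .nil (f .nil)) a)
    (fun u v p q r s _ _ _ _ => Label.rec (.node u v (f p) q r s) (.node u v p (f q) r s)
      (.node u v p q (f r) s) (.node u v p q r (f s)) a) t

/-- Whether all values are `0`. -/
noncomputable def isZero (t : Trie) : Bool :=
  Trie.rec true (fun u v _ _ _ _ p q r s =>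
    Bool.rec false (Bool.rec false (Bool.rec false (Bool.rec false s r) q) p) (Nat.beq u v)) t

theorem dot_addHere (φ : List Label → ℤ) (s : Bool) (w : ℕ) (t : Trie) :
    (t.addHere s w).dot φ = signed s w * φ [] + t.dot φ := by
  cases t <;> cases s <;> simp [addHere, dot, signed] <;> ring

theorem dot_modify {f : Trie → Trie} {l : List Label} {c : ℤ}
    (hf : ∀ φ t, (f t).dot φ = c * φ l + t.dot φ) (φ : List Label → ℤ) (a : Label) (t : Trie) :
    (t.modify a f).dot φ = c * φ (a :: l) + t.dot φ := by
  cases t <;> cases a <;> simp [modify, dot, hf] <;> ring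

theorem dot_eq_zero {t : Trie} (h : t.isZero = true) (φ : List Label → ℤ) : t.dot φ = 0 := by
  induction t generalizing φ with
  | nil => rfl
  | node u v p q r s ihp ihq ihr ihs =>
    have h' : (Bool.rec false (Bool.rec false (Bool.rec false (Bool.rec false s.isZero r.isZero)
      q.isZero) p.isZero) (Nat.beq u v) : Bool) = true := h
    cases huv : Nat.beq u v <;> cases hp : p.isZero <;> cases hq : q.isZero <;>
      cases hr : r.isZero <;> simp_all [dot]

end Trie

/-- Apply `f` to the entries of a row, one after the other. -/
noncomputable def NumRow.fold (f : Label → Label → Bool → ℕ → Trie → Trie) (r : NumRow) :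
    Trie → Trie :=
  NumRow.rec (fun t => t) (fun a b s v _ ih t => ih (f a b s v t)) r

theorem NumRow.dot_fold {f : Label → Label → Bool → ℕ → Trie → Trie} {φ : List Label → ℤ} {c : ℤ}
    {F : Label → Label → ℤ}
    (hf : ∀ a b s v t, (f a b s v t).dot φ = c * (signed s v * F a b) + t.dot φ) (r : NumRow)
    (t : Trie) : (r.fold f t).dot φ = c * r.dot F + t.dot φ := by
  induction r generalizing t with
  | nil => simp [fold, dot]
  | cons a b s v r ih =>
    refine (ih (f a b s v t)).trans ?_
    rw [hf, dot]
    ring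

/-- Add to a vector the product of `signed s v`, the row vector at `(a, b, c, d)` of the identity
matrix and the matrix of a combination of words. -/
noncomputable def NumTree.walk (T : Bool → Label → Label → NumRow) (w : NumTree) :
    Bool → ℕ → Label → Label → Label → Label → Trie → Trie :=
  NumTree.rec (fun _ _ _ _ _ _ t => t)
    (fun s' v' _ ih s v a b c d t => ih s v a b c d (Trie.modify a (Trie.modify b (Trie.modify c
      (Trie.modify d (Trie.addHere (Bool.xor s s') (Nat.mul v v'))))) t))
    (fun p s' _ _ ihu iht s v a b c d t => iht s v a b c d (Pos.rec
      (NumRow.fold (fun a b r w => ihu (Bool.xor s r) (Nat.mul v w) a b c d) (T s' a b))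
      (NumRow.fold (fun b c r w => ihu (Bool.xor s r) (Nat.mul v w) a b c d) (T s' b c))
      (NumRow.fold (fun c d r w => ihu (Bool.xor s r) (Nat.mul v w) a b c d) (T s' c d)) p t)) w

theorem NumTree.dot_walk (T : Bool → Label → Label → NumRow) (φ : List Label → ℤ) (w : NumTree)
    (s : Bool) (v : ℕ) (a b c d : Label) (t : Trie) :
    (w.walk T s v a b c d t).dot φ =
      signed s v * w.apply T (fun a b c d => φ [a, b, c, d]) a b c d + t.dot φ := by
  induction w generalizing s v a b c d t with
  | nil => simp [walk, apply]
  | emit s' v' w ih =>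
    refine (ih _ _ _ _ _ _ _).trans ?_
    rw [Trie.dot_modify fun φ t => Trie.dot_modify (fun φ t => Trie.dot_modify (fun φ t =>
      Trie.dot_modify (fun φ t => Trie.dot_addHere φ _ _ t) φ d t) φ c t) φ b t, apply, signed_mul]
    ring
  | letter p s' u w ihu ihw =>
    refine (ihw _ _ _ _ _ _ _).trans ?_
    cases p
    · refine (congrArg _ (NumRow.dot_fold (c := signed s v) (F := fun a b => u.apply T
        (fun a b c d => φ [a, b, c, d]) a b c d) (fun a b r w t => ?_) _ _)).trans ?_
      · rw [← mul_assoc, ← signed_mul]; exact ihu _ _ _ _ _ _ _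
      · rw [apply]; ring
    · refine (congrArg _ (NumRow.dot_fold (c := signed s v) (F := fun b c => u.apply T
        (fun a b c d => φ [a, b, c, d]) a b c d) (fun b c r w t => ?_) _ _)).trans ?_
      · rw [← mul_assoc, ← signed_mul]; exact ihu _ _ _ _ _ _ _
      · rw [apply]; ring
    · refine (congrArg _ (NumRow.dot_fold (c := signed s v) (F := fun c d => u.apply T
        (fun a b c d => φ [a, b, c, d]) a b c d) (fun c d r w t => ?_) _ _)).trans ?_
      · rw [← mul_assoc, ← signed_mul]; exact ihu _ _ _ _ _ _ _
      · rw [apply]; ring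

/-- Conjunction over the labels. -/
noncomputable def allLabels (F : Label → Bool) : Bool :=
  Bool.rec false (Bool.rec false (Bool.rec false (F .v4) (F .v3)) (F .v2)) (F .v1)

theorem of_allLabels {F : Label → Bool} (h : allLabels F = true) (a : Label) : F a = true := by
  unfold allLabels at h
  cases a <;> cases h1 : F .v1 <;> cases h2 : F .v2 <;> cases h3 : F .v3 <;> simp_all

/-- The test whether a combination of words, evaluated at the integer point `(N, M)`, is the zero
matrix. -/
noncomputable def vanishesAt (N M : ℕ) (T : Bool → Table) (t : WordTree) : Bool :=
  forceTable N M (T true) fun A => forceTable N M (T false) fun B => forceTree N M t fun w =>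
    allLabels fun a => allLabels fun b => allLabels fun c => allLabels fun d =>
      (w.walk (fun s => Bool.rec B A s) false 1 a b c d .nil).isZero

theorem mat_eq_zero_of_vanishesAt {N M : ℕ} {T : Bool → Table} {t : WordTree}
    (h : vanishesAt N M T t = true) :
    t.mat (PolyExpr.eval (N : ℤ) (M : ℤ)) (tableOps (PolyExpr.eval (N : ℤ) (M : ℤ)) T) = 0 := by
  rw [vanishesAt, forceTable_eq, forceTable_eq, forceTree_eq] at h
  have hT : (fun s : Bool => (Bool.rec (fun a b => compileRow (N : ℤ) M (T false a b))
      (fun a b => compileRow (N : ℤ) M (T true a b)) s : Label → Label → NumRow)) =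
      fun s a b => compileRow (N : ℤ) M (T s a b) := by
    funext s; cases s <;> rfl
  rw [hT] at h
  refine Matrix.mulVec_injective (funext fun φ => funext fun f => ?_)
  rw [Matrix.zero_mulVec, eq_idx f, ← apply_compileTree, Pi.zero_apply]
  have h0 := Trie.dot_eq_zero (of_allLabels (of_allLabels (of_allLabels (of_allLabels h
    (.ofFin (f 0))) (.ofFin (f 1))) (.ofFin (f 2))) (.ofFin (f 3)))
    fun l => match l with
      | [a, b, c, d] => φ (idx a b c d)
      | _ => 0
  rw [NumTree.dot_walk] at h0
  simpa [signed, Trie.dot] using h0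

/-- The test whether the majorants of the entries of the matrix of a combination of words are small
enough for the point `(N, M)` to decide the vanishing of these entries. -/
noncomputable def smallAt (N M : ℕ) (T : Bool → Table) (t : WordTree) : Bool :=
  Bool.rec false (Nat.blt (t.bound N fun s => (T s).bound N) M)
    (Nat.blt (t.bound 1 fun s => (T s).bound 1) N)

theorem map_evalAt_mat (T : Bool → Table) (t : WordTree) {R : Type*} [CommRing R] (x y : R) :
    (t.mat PolyExpr.toPoly (tableOps PolyExpr.toPoly T)).map (evalAt x y) =
      t.mat (PolyExpr.eval x y) (tableOps (PolyExpr.eval x y) T) := by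
  rw [WordTree.map_mat]
  simp only [tableOps_map, PolyExpr.evalAt_toPoly]

/-- A combination of words in two tables vanishes identically if it vanishes at one integer point
that is large compared with its coefficients. -/
theorem mat_eq_zero_of_check {N M : ℕ} {T : Bool → Table} {t : WordTree}
    (hs : smallAt N M T t = true) (hv : vanishesAt N M T t = true) {R : Type*} [CommRing R]
    (x y : R) : t.mat (PolyExpr.eval x y) (tableOps (PolyExpr.eval x y) T) = 0 := by
  have hsmall : (t.bound 1 fun s => (T s).bound 1) < N ∧
      (t.bound N fun s => (T s).bound N) < M := by
    rw [← Nat.blt_eq, ← Nat.blt_eq]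
    unfold smallAt at hs
    cases h : Nat.blt (t.bound 1 fun s => (T s).bound 1) N <;> simp_all
  have hle : ∀ r f g, majorant r (t.mat PolyExpr.toPoly (tableOps PolyExpr.toPoly T) f g) ≤
      t.bound r fun s => (T s).bound r := fun r f g =>
    (Finset.single_le_sum (f := fun g => majorant r (t.mat PolyExpr.toPoly _ f g))
      (fun _ _ => Nat.zero_le _) (Finset.mem_univ g)).trans (t.rowBounded r T f)
  have h0 : t.mat PolyExpr.toPoly (tableOps PolyExpr.toPoly T) = 0 := by
    ext1 f g
    refine eq_zero_of_evalAt_eq_zero (N := N) (M := M) _ ((hle 1 f g).trans_lt hsmall.1)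
      ((hle N f g).trans_lt hsmall.2) ?_
    have := map_evalAt_mat T t (N : ℤ) (M : ℤ)
    rw [mat_eq_zero_of_vanishesAt hv] at this
    exact congrFun (congrFun this f) g
  rw [← map_evalAt_mat, h0]
  ext
  simp

/-! ### The tables and the skein relations as polynomial data -/

open PolyExpr in
/-- The rows of `t₁ R_V`, in the variables `X = t₀` and `Y = t₁`. -/
def tableVPos : Table
  | .v1, .v1 => [(.v1, .v1, -Y)]
  | .v1, .v2 => [(.v2, .v1, -Y)]
  | .v1, .v3 => [(.v3, .v1, -Y)]
  | .v1, .v4 => [(.v4, .v1, -Y)]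
  | .v2, .v1 => [(.v1, .v2, -X * Y), (.v2, .v1, (X - 1) * Y)]
  | .v2, .v2 => [(.v2, .v2, X * Y)]
  | .v2, .v3 => [(.v3, .v2, -1), (.v4, .v1, 1 - Y)]
  | .v2, .v4 => [(.v4, .v2, 1)]
  | .v3, .v1 => [(.v1, .v3, -Y ^ 2), (.v3, .v1, Y * (Y - 1))]
  | .v3, .v2 => [(.v2, .v3, -Y ^ 2), (.v4, .v1, Y * (Y - 1))]
  | .v3, .v3 => [(.v3, .v3, Y ^ 2)]
  | .v3, .v4 => [(.v4, .v3, Y ^ 2)]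
  | .v4, .v1 => [(.v1, .v4, -X * Y ^ 2), (.v2, .v3, (X - 1) * Y ^ 2), (.v3, .v2, (1 - X) * Y),
      (.v4, .v1, (X + Y - 2) * Y)]
  | .v4, .v2 => [(.v2, .v4, X * Y ^ 2), (.v4, .v2, (X - 1) * Y)]
  | .v4, .v3 => [(.v3, .v4, Y), (.v4, .v3, Y * (Y - 1))]
  | .v4, .v4 => [(.v4, .v4, -Y)]

open PolyExpr in
/-- The rows of `t₀ t₁ R_V⁻¹`, in the variables `X = t₀` and `Y = t₁`. -/
def tableVNeg : Table
  | .v1, .v1 => [(.v1, .v1, -X * Y)]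
  | .v1, .v2 => [(.v1, .v2, (1 - X) * Y), (.v2, .v1, -Y)]
  | .v1, .v3 => [(.v1, .v3, X * (1 - Y)), (.v3, .v1, -X)]
  | .v1, .v4 => [(.v1, .v4, X + Y - 2 * X * Y), (.v2, .v3, (X - 1) * Y), (.v3, .v2, 1 - X),
      (.v4, .v1, -1)]
  | .v2, .v1 => [(.v1, .v2, -X * Y)]
  | .v2, .v2 => [(.v2, .v2, Y)]
  | .v2, .v3 => [(.v1, .v4, X * (1 - Y)), (.v3, .v2, -X)]
  | .v2, .v4 => [(.v2, .v4, (1 - X) * Y), (.v4, .v2, 1)]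
  | .v3, .v1 => [(.v1, .v3, -X * Y)]
  | .v3, .v2 => [(.v1, .v4, X * Y * (Y - 1)), (.v2, .v3, -X * Y ^ 2)]
  | .v3, .v3 => [(.v3, .v3, X)]
  | .v3, .v4 => [(.v3, .v4, X * (1 - Y)), (.v4, .v3, X * Y)]
  | .v4, .v1 => [(.v1, .v4, -X * Y)]
  | .v4, .v2 => [(.v2, .v4, X * Y ^ 2)]
  | .v4, .v3 => [(.v3, .v4, X)]
  | .v4, .v4 => [(.v4, .v4, -X * Y)]

open PolyExpr in
/-- The rows of `R_LG` in the variables `X = t₀^{1/2}` and `Y = t₁^{1/2}`, after the fourth basis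
vector has been multiplied by `√((t₀ - 1) (1 - t₁))`. -/
def tableLGPos : Table
  | .v1, .v1 => [(.v1, .v1, X ^ 2)]
  | .v1, .v2 => [(.v2, .v1, X)]
  | .v1, .v3 => [(.v3, .v1, X)]
  | .v1, .v4 => [(.v4, .v1, 1)]
  | .v2, .v1 => [(.v1, .v2, X), (.v2, .v1, X ^ 2 - 1)]
  | .v2, .v2 => [(.v2, .v2, -1)]
  | .v2, .v3 => [(.v2, .v3, X ^ 2 * Y ^ 2 - 1), (.v3, .v2, -X * Y),
      (.v4, .v1, -X * Y * (X ^ 2 - 1) * (1 - Y ^ 2))]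
  | .v2, .v4 => [(.v4, .v2, Y)]
  | .v3, .v1 => [(.v1, .v3, X), (.v3, .v1, X ^ 2 - 1)]
  | .v3, .v2 => [(.v2, .v3, -X * Y), (.v4, .v1, (X ^ 2 - 1) * (1 - Y ^ 2))]
  | .v3, .v3 => [(.v3, .v3, -1)]
  | .v3, .v4 => [(.v4, .v3, Y)]
  | .v4, .v1 => [(.v1, .v4, 1), (.v2, .v3, -X * Y), (.v3, .v2, 1),
      (.v4, .v1, (X ^ 2 - 1) * (1 - Y ^ 2))]
  | .v4, .v2 => [(.v2, .v4, Y), (.v4, .v2, Y ^ 2 - 1)]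
  | .v4, .v3 => [(.v3, .v4, Y), (.v4, .v3, Y ^ 2 - 1)]
  | .v4, .v4 => [(.v4, .v4, Y ^ 2)]

open PolyExpr in
/-- The rows of `t₀ t₁ R_LG⁻¹`, in the same variables and the same basis as `tableLGPos`. -/
def tableLGNeg : Table
  | .v1, .v1 => [(.v1, .v1, Y ^ 2)]
  | .v1, .v2 => [(.v1, .v2, (1 - X ^ 2) * Y ^ 2), (.v2, .v1, X * Y ^ 2)]
  | .v1, .v3 => [(.v1, .v3, (1 - X ^ 2) * Y ^ 2), (.v3, .v1, X * Y ^ 2)]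
  | .v1, .v4 => [(.v1, .v4, (X ^ 2 - 1) * (1 - Y ^ 2)), (.v2, .v3, X * Y), (.v3, .v2, -1),
      (.v4, .v1, X ^ 2 * Y ^ 2)]
  | .v2, .v1 => [(.v1, .v2, X * Y ^ 2)]
  | .v2, .v2 => [(.v2, .v2, -X ^ 2 * Y ^ 2)]
  | .v2, .v3 => [(.v1, .v4, X * Y * (X ^ 2 - 1) * (1 - Y ^ 2)), (.v3, .v2, -X * Y)]
  | .v2, .v4 => [(.v2, .v4, X ^ 2 * (1 - Y ^ 2)), (.v4, .v2, X ^ 2 * Y)]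
  | .v3, .v1 => [(.v1, .v3, X * Y ^ 2)]
  | .v3, .v2 => [(.v1, .v4, (X ^ 2 - 1) * (Y ^ 2 - 1)), (.v2, .v3, -X * Y),
      (.v3, .v2, 1 - X ^ 2 * Y ^ 2)]
  | .v3, .v3 => [(.v3, .v3, -X ^ 2 * Y ^ 2)]
  | .v3, .v4 => [(.v3, .v4, X ^ 2 * (1 - Y ^ 2)), (.v4, .v3, X ^ 2 * Y)]
  | .v4, .v1 => [(.v1, .v4, X ^ 2 * Y ^ 2)]
  | .v4, .v2 => [(.v2, .v4, X ^ 2 * Y)]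
  | .v4, .v3 => [(.v3, .v4, X ^ 2 * Y)]
  | .v4, .v4 => [(.v4, .v4, X ^ 2)]

/-- The tables for `R_V`. -/
def tablesV : Bool → Table
  | true => tableVPos
  | false => tableVNeg

/-- The tables for `R_LG`. -/
def tablesLG : Bool → Table
  | true => tableLGPos
  | false => tableLGNeg

/-- A linear combination of words in the generators and their inverses; the coefficients are
polynomials in `X = t₀` and `Y = t₁`. -/
abbrev WordSum : Type := List (PolyExpr × List Letter)

namespace WordSum

/-- The generator at a position, as a letter. -/
abbrev pos (p : Pos) : Letter := (p, true)

/-- The inverse generator at a position, as a letter. -/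
abbrev inv (p : Pos) : Letter := (p, false)

open PolyExpr in
/-- The cubic relation. -/
def cubic (p : Pos) : WordSum :=
  [(1, [pos p, pos p]), (1 - X - Y, [pos p]), (X * Y - X - Y, []), (X * Y, [inv p])]

/-- Ishii's relation. -/
def ishii (p q : Pos) : WordSum :=
  [(1, [inv p, pos q, pos p]), (-1, [pos p, pos q, inv p]), (-1, [inv p, inv q, pos p]),
    (1, [pos p, inv q, inv p]), (-1, [pos p, pos q]), (1, [pos p, inv q]), (1, [inv p, pos q]),
    (-1, [inv p, inv q]), (1, [pos q, pos p]), (-1, [pos q, inv p]), (-1, [inv q, pos p]),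
    (1, [inv q, inv p])]

section FourStrand

open PolyExpr

/-! The coefficients of the four-strand relation are written over the common denominator `denom`;
`pP`, `pQ`, `pN`, `pM` and `pL` are polynomials that occur in several numerators. -/

/-- The common denominator of the coefficients of the four-strand relation. -/
def denom : PolyExpr := Y * (1 + Y) * X * (1 + X) * (Y + X) * (Y * X - 1) * (1 + Y * X)

/-- The polynomial `P` of the numerators. -/
def pP : PolyExpr := 1 + Y * X + Y ^ 2 * X + Y * X ^ 2

/-- The polynomial `Q` of the numerators. -/
def pQ : PolyExpr := Y + X + Y * X + Y ^ 2 * X ^ 2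

/-- The polynomial `N` of the numerators. -/
def pN : PolyExpr :=
  -Y ^ 2 - Y * X - Y ^ 2 * X - X ^ 2 - Y * X ^ 2 + Y ^ 2 * X ^ 2

/-- The polynomial `M` of the numerators. -/
def pM : PolyExpr :=
  Y - Y ^ 2 + X - Y * X + Y ^ 2 * X - X ^ 2 + Y * X ^ 2 + Y ^ 2 * X ^ 2

/-- The polynomial `L` of the numerators. -/
def pL : PolyExpr :=
  Y ^ 2 + Y * X + X ^ 2 - Y ^ 2 * X ^ 2 + Y ^ 3 * X ^ 2 + Y ^ 2 * X ^ 3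

/-- The letter of `s_i`. -/
abbrev x : Letter := pos .p01

/-- The letter of the inverse of `s_i`. -/
abbrev xi : Letter := inv .p01

/-- The letter of `s_j`. -/
abbrev y : Letter := pos .p12

/-- The letter of the inverse of `s_j`. -/
abbrev yi : Letter := inv .p12

/-- The letter of `s_k`. -/
abbrev z : Letter := pos .p23

/-- The letter of the inverse of `s_k`. -/
abbrev zi : Letter := inv .p23

/-- The irregular factor of the numerator of `a1`. -/
def p1 : PolyExpr :=
  -Y - X - 2 * Y * X - Y ^ 2 * X - Y * X ^ 2 + Y ^ 3 * X ^ 2 + Y ^ 2 * X ^ 3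

/-- The irregular factor of the numerator of `a14`. -/
def p14 : PolyExpr :=
  -Y + Y ^ 2 - X + Y * X + Y ^ 2 * X + X ^ 2 + Y * X ^ 2 - Y ^ 2 * X ^ 2 + 2 * Y ^ 3 * X ^ 2 + Y
    ^ 4 * X ^ 2 + 2 * Y ^ 2 * X ^ 3 + 2 * Y ^ 3 * X ^ 3 + Y ^ 4 * X ^ 3 + Y ^ 2 * X ^ 4 + Y ^ 3
    * X ^ 4

/-- The irregular factor of the numerator of `a15`. -/
def p15 : PolyExpr :=
  -Y ^ 3 - Y * X - Y ^ 4 * X - Y ^ 2 * X ^ 2 - X ^ 3 + Y ^ 4 * X ^ 3 - Y * X ^ 4 + Y ^ 3 * X ^ 4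

/-- The irregular factor of the numerator of `a16`. -/
def p16 : PolyExpr :=
  -Y ^ 2 + Y ^ 3 - Y * X + Y ^ 2 * X + Y ^ 3 * X - X ^ 2 + Y * X ^ 2 + 3 * Y ^ 2 * X ^ 2 + Y ^ 4
    * X ^ 2 + X ^ 3 + Y * X ^ 3 + 2 * Y ^ 3 * X ^ 3 + Y ^ 4 * X ^ 3 + Y ^ 2 * X ^ 4 + Y ^ 3 * X
    ^ 4

/-- The irregular factor of the numerator of `a22`. -/
def p22 : PolyExpr :=
  -Y ^ 2 - Y * X - Y ^ 4 * X - X ^ 2 + Y ^ 2 * X ^ 2 - Y ^ 3 * X ^ 2 - Y ^ 2 * X ^ 3 + Y ^ 4 * X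
    ^ 3 - Y * X ^ 4 + Y ^ 3 * X ^ 4

/-- The irregular factor of the numerator of `a23`. -/
def p23 : PolyExpr :=
  Y - Y ^ 2 + X - Y * X - Y ^ 4 * X - X ^ 2 + Y ^ 2 * X ^ 2 - 2 * Y ^ 3 * X ^ 2 - 2 * Y ^ 2 * X
    ^ 3 + Y ^ 4 * X ^ 3 - Y * X ^ 4 + Y ^ 3 * X ^ 4

/-- The irregular factor of the numerator of `a30`. -/
def p30 : PolyExpr :=
  -1 - 2 * Y + Y ^ 2 - 2 * X + Y * X - Y ^ 3 * X + X ^ 2 - 2 * Y ^ 2 * X ^ 2 + Y ^ 3 * X ^ 2 - Y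
    * X ^ 3 + Y ^ 2 * X ^ 3

/-- The irregular factor of the numerator of `a33`. -/
def p33 : PolyExpr :=
  Y + X + Y * X + Y ^ 2 * X + Y ^ 3 * X + Y * X ^ 2 + 4 * Y ^ 2 * X ^ 2 - Y ^ 4 * X ^ 2 + Y * X
    ^ 3 - Y ^ 3 * X ^ 3 + Y ^ 4 * X ^ 3 + Y ^ 5 * X ^ 3 - Y ^ 2 * X ^ 4 + Y ^ 3 * X ^ 4 + 2 * Y
    ^ 4 * X ^ 4 + Y ^ 5 * X ^ 4 + Y ^ 3 * X ^ 5 + Y ^ 4 * X ^ 5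

/-- The irregular factor of the numerator of `a34`. -/
def p34 : PolyExpr :=
  Y ^ 2 + 3 * Y * X + 2 * Y ^ 2 * X - Y ^ 3 * X + X ^ 2 + 2 * Y * X ^ 2 + Y ^ 3 * X ^ 2 - Y * X
    ^ 3 + Y ^ 2 * X ^ 3 + Y ^ 3 * X ^ 3 + Y ^ 5 * X ^ 3 + 2 * Y ^ 4 * X ^ 4 + Y ^ 5 * X ^ 4 + Y
    ^ 3 * X ^ 5 + Y ^ 4 * X ^ 5

/-- The irregular factor of the numerator of `a39`. -/
def p39 : PolyExpr :=
  Y + X + Y * X + 2 * Y ^ 2 * X + Y ^ 3 * X - Y ^ 4 * X + 2 * Y * X ^ 2 + 4 * Y ^ 2 * X ^ 2 - Y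
    ^ 3 * X ^ 2 + Y ^ 5 * X ^ 2 + Y * X ^ 3 - Y ^ 2 * X ^ 3 + Y ^ 3 * X ^ 3 + 3 * Y ^ 4 * X ^ 3
    - Y * X ^ 4 + 3 * Y ^ 3 * X ^ 4 - Y ^ 5 * X ^ 4 + Y ^ 2 * X ^ 5 - Y ^ 4 * X ^ 5

/-- The irregular factor of the numerator of `a41`. -/
def p41 : PolyExpr :=
  Y ^ 2 + 3 * Y * X - Y ^ 2 * X + X ^ 2 - Y * X ^ 2 + Y ^ 2 * X ^ 2 + Y ^ 3 * X ^ 2 - Y ^ 4 * X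
    ^ 2 + Y ^ 2 * X ^ 3 - 2 * Y ^ 3 * X ^ 3 + Y ^ 4 * X ^ 3 - Y ^ 2 * X ^ 4 + Y ^ 3 * X ^ 4

/-- The irregular factor of the numerator of `a43`. -/
def p43 : PolyExpr :=
  Y ^ 2 + 3 * Y * X + 2 * Y ^ 2 * X - Y ^ 3 * X + X ^ 2 + 2 * Y * X ^ 2 + 2 * Y ^ 3 * X ^ 2 + Y
    ^ 4 * X ^ 2 - Y * X ^ 3 + 2 * Y ^ 2 * X ^ 3 + 3 * Y ^ 3 * X ^ 3 + Y ^ 2 * X ^ 4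

/-- The numerators of the words in `s_i` and `s_j`. -/
def numeratorsXY : WordSum :=
  [
    (-((Y - 1) * (X - 1) * p1) * (1 + Y) * (1 + X), [x, y]),
    (-((Y - 1) * (X - 1) * (Y + X + 2 * Y * X)) * Y * X * (1 + Y) * (1 + X), [x, yi]),
    (((Y - 1) * (X - 1) * p1) * (1 + Y) * (1 + X), [y, x]),
    (((Y - 1) * (X - 1) * (Y + X + 2 * Y * X)) * Y * X * (1 + Y) * (1 + X), [yi, x])]

/-- The numerators of the words in `s_j` and `s_k`. -/
def numeratorsYZ : WordSum :=
  [
    (pP * (Y + X) * (Y * X - 1), [z, y]),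
    (-pQ * (Y + X) * (Y * X - 1), [zi, y]),
    (-(pP * pM) * (Y * X - 1), [z, yi]),
    (pQ * pM * (Y * X - 1), [zi, yi]),
    (-pP * (Y + X) * (Y * X - 1), [y, z]),
    (pP * pM * (Y * X - 1), [yi, z]),
    (pQ * (Y + X) * (Y * X - 1), [y, zi]),
    (-(pQ * pM) * (Y * X - 1), [yi, zi])]

/-- The numerators of the words of length three that start with `s_i` or its inverse. -/
def numeratorsXOuter : WordSum :=
  [
    (pN * (Y * X - 1), [x, z, y]),
    (p14 * (Y * X - 1), [x, z, yi]),
    (-p15 * (Y * X - 1), [x, zi, y]),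
    (-p16 * (Y * X - 1), [x, zi, yi]),
    (-pP * Y * X * (Y * X - 1), [xi, z, y]),
    (-((Y + X - 1) * pP) * Y * X * (Y * X - 1), [xi, z, yi]),
    (pQ * Y * X * (Y * X - 1), [xi, zi, y]),
    (((Y + X - 1) * pQ) * Y * X * (Y * X - 1), [xi, zi, yi]),
    (-pQ * (Y * X - 1), [x, y, z]),
    (-p22 * (Y * X - 1), [x, y, zi]),
    (p23 * (Y * X - 1), [x, yi, z]),
    (-((Y + X - 1) * pN) * (Y * X - 1), [x, yi, zi]),
    (pP * Y * X * (Y * X - 1), [xi, y, z]),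
    (-pQ * Y * X * (Y * X - 1), [xi, y, zi]),
    (((Y + X - 1) * pP) * Y * X * (Y * X - 1), [xi, yi, z]),
    (-((Y + X - 1) * pQ) * Y * X * (Y * X - 1), [xi, yi, zi])]

/-- The numerators of the other words of length three. -/
def numeratorsMixed : WordSum :=
  [
    (((1 + Y) * (1 + X)) * Y * X * (1 + Y) * (1 + X), [y, x, z]),
    (p30 * Y * X * (1 + Y) * (1 + X), [y, x, zi]),
    (pP * pN, [y, xi, z]),
    (-(pQ * pN), [y, xi, zi]),
    (-p33, [yi, x, z]),
    (p34, [yi, x, zi]),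
    (pP * pL, [yi, xi, z]),
    (-(pQ * pL), [yi, xi, zi]),
    (-pQ * (1 + Y) * (1 + X), [z, y, x]),
    (-(pP * pN), [z, y, xi]),
    (p39, [z, yi, x]),
    (-(pP * pL), [z, yi, xi]),
    (p41 * (1 + Y) * (1 + X), [zi, y, x]),
    (pQ * pN, [zi, y, xi]),
    (-p43, [zi, yi, x]),
    (pQ * pL, [zi, yi, xi])]

/-- The numerators of the words of length four that start with `s_k` or its inverse. -/
def numeratorsZLeft : WordSum :=
  [
    (pP * pQ * Y * X, [z, xi, yi, xi]),
    (-pQ ^ 2 * Y * X, [zi, xi, yi, xi]),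
    (pP * Y * X * (Y * X - 1), [z, xi, yi, x]),
    (-pQ * Y * X * (Y * X - 1), [zi, xi, yi, x]),
    (-((Y + X + 2 * Y * X) * pP) * Y * X, [z, xi, y, xi]),
    (((Y + X + 2 * Y * X) * pQ) * Y * X, [zi, xi, y, xi]),
    (pP * pN, [z, x, yi, xi]),
    (-(pQ * pN), [zi, x, yi, xi]),
    (-((Y + X + Y * X) * pP) * (Y * X - 1), [z, x, yi, x]),
    (((Y + X + Y * X) * pQ) * (Y * X - 1), [zi, x, yi, x]),
    ((pP * (Y ^ 2 + Y ^ 2 * X + X ^ 2 + Y * X ^ 2)), [z, x, y, xi]),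
    (-((Y ^ 2 + Y ^ 2 * X + X ^ 2 + Y * X ^ 2) * pQ), [zi, x, y, xi])]

/-- The numerators of the words of length four that end with `s_k` or its inverse. -/
def numeratorsZRight : WordSum :=
  [
    (-(pP * pQ) * Y * X, [xi, yi, xi, z]),
    (pQ ^ 2 * Y * X, [xi, yi, xi, zi]),
    (-pP * Y * X * (Y * X - 1), [xi, yi, x, z]),
    (pQ * Y * X * (Y * X - 1), [xi, yi, x, zi]),
    (((Y + X + 2 * Y * X) * pP) * Y * X, [xi, y, xi, z]),
    (-((Y + X + 2 * Y * X) * pQ) * Y * X, [xi, y, xi, zi]),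
    (-(pP * pN), [x, yi, xi, z]),
    (pQ * pN, [x, yi, xi, zi]),
    (((Y + X + Y * X) * pP) * (Y * X - 1), [x, yi, x, z]),
    (-((Y + X + Y * X) * pQ) * (Y * X - 1), [x, yi, x, zi]),
    (-(pP * (Y ^ 2 + Y ^ 2 * X + X ^ 2 + Y * X ^ 2)), [x, y, xi, z]),
    (((Y ^ 2 + Y ^ 2 * X + X ^ 2 + Y * X ^ 2) * pQ), [x, y, xi, zi])]

/-- The numerators of the words of length four in which `s_j` occurs twice. -/
def numeratorsLong : WordSum :=
  [
    (Y * X * (1 + Y) * (1 + X) * (Y * X - 1) * (1 + Y * X), [x, yi, zi, y]),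
    ((Y * X) * Y * X * (1 + Y) * (1 + X) * (Y + X) * (Y * X - 1), [x, yi, z, yi]),
    (((Y - 1) * (1 + Y) * (X - 1) * (1 + X)) * Y * X * (1 + Y) * (1 + X), [x, y, zi, yi]),
    (-(Y * X * (1 + Y) * (1 + X) * (Y + X) * (Y * X - 1)), [x, y, zi, y]),
    ((Y ^ 2 + X ^ 2 - 2) * Y * X * (1 + Y) * (1 + X), [x, y, z, yi]),
    (-(Y * X * (1 + Y) * (1 + X) * (Y * X - 1) * (1 + Y * X)), [yi, zi, y, x]),
    (-(Y * X) * Y * X * (1 + Y) * (1 + X) * (Y + X) * (Y * X - 1), [yi, z, yi, x]),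
    (-((Y - 1) * (1 + Y) * (X - 1) * (1 + X)) * Y * X * (1 + Y) * (1 + X), [y, zi, yi, x]),
    (Y * X * (1 + Y) * (1 + X) * (Y + X) * (Y * X - 1), [y, zi, y, x]),
    (-(Y ^ 2 + X ^ 2 - 2) * Y * X * (1 + Y) * (1 + X), [y, z, yi, x])]

/-- The numerators over `denom` of the coefficients `a1, …, a78`, each with its word. -/
def numerators : WordSum :=
  numeratorsXY ++ numeratorsYZ ++ numeratorsXOuter ++ numeratorsMixed ++ numeratorsZLeft ++
    numeratorsZRight ++ numeratorsLong

/-- The four-strand relation, multiplied by `denom`. -/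
def fourStrand : WordSum :=
  (denom, [x, zi, y, zi]) ::
  (-denom, [zi, y, zi, x]) ::
  numerators.map fun a => (-a.1, a.2)

end FourStrand

/-- The number of letters with a given exponent. -/
def count (s : Bool) : List Letter → ℕ
  | [] => 0
  | (_, true) :: w => bif s then count s w + 1 else count s w
  | (_, false) :: w => bif s then count s w else count s w + 1

/-- The combination of words obtained by the substitution of `u` and `v` for the variables and of
`lam⁻¹ s` and `mu⁻¹ s̄` for each generator `s` and its inverse, multiplied by `lam ^ 4 * mu ^ 4` to
clear denominators; for words with at most four letters. -/
def rescale (u v lam mu : PolyExpr) (l : WordSum) : WordTree :=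
  WordTree.ofList (l.map fun a =>
    (a.1.subst u v * lam ^ (4 - count true a.2) * mu ^ (4 - count false a.2), a.2))

/-- The relation `l`, for the letters of `tablesV`. -/
def treeV (l : WordSum) : WordTree := l.rescale .X .Y .Y (.X * .Y)

/-- The relation `l`, for the letters of `tablesLG`. -/
def treeLG (l : WordSum) : WordTree := l.rescale (.X ^ 2) (.Y ^ 2) 1 (.X ^ 2 * .Y ^ 2)

end WordSum

/-! ### The computations -/

/-! The relations are tested at the points `(10 ^ 7 + 19, 10 ^ 85 + 7)` for `R_V` and
`(10 ^ 7 + 19, 10 ^ 186 + 9)` for `R_LG`.  Any point that passes `smallAt` would do. -/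

section Computations

theorem smallAt_cubic_V :
    smallAt 10000019 (10 ^ 85 + 7) tablesV (WordSum.treeV (.cubic .p01)) = true := by
  decide +kernel

theorem vanishesAt_cubic_V :
    vanishesAt 10000019 (10 ^ 85 + 7) tablesV (WordSum.treeV (.cubic .p01)) = true := by
  decide +kernel

theorem smallAt_cubic_LG :
    smallAt 10000019 (10 ^ 186 + 9) tablesLG (WordSum.treeLG (.cubic .p01)) = true := by
  decide +kernel

theorem vanishesAt_cubic_LG :
    vanishesAt 10000019 (10 ^ 186 + 9) tablesLG (WordSum.treeLG (.cubic .p01)) = true := by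
  decide +kernel

theorem smallAt_ishii_V :
    smallAt 10000019 (10 ^ 85 + 7) tablesV (WordSum.treeV (.ishii .p01 .p12)) = true := by
  decide +kernel

theorem vanishesAt_ishii_V :
    vanishesAt 10000019 (10 ^ 85 + 7) tablesV (WordSum.treeV (.ishii .p01 .p12)) = true := by
  decide +kernel

theorem smallAt_ishii_LG :
    smallAt 10000019 (10 ^ 186 + 9) tablesLG (WordSum.treeLG (.ishii .p01 .p12)) = true := by
  decide +kernel

theorem vanishesAt_ishii_LG :
    vanishesAt 10000019 (10 ^ 186 + 9) tablesLG (WordSum.treeLG (.ishii .p01 .p12)) = true := by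
  decide +kernel

theorem smallAt_ishii_V' :
    smallAt 10000019 (10 ^ 85 + 7) tablesV (WordSum.treeV (.ishii .p12 .p01)) = true := by
  decide +kernel

theorem vanishesAt_ishii_V' :
    vanishesAt 10000019 (10 ^ 85 + 7) tablesV (WordSum.treeV (.ishii .p12 .p01)) = true := by
  decide +kernel

theorem smallAt_ishii_LG' :
    smallAt 10000019 (10 ^ 186 + 9) tablesLG (WordSum.treeLG (.ishii .p12 .p01)) = true := by
  decide +kernel

theorem vanishesAt_ishii_LG' :
    vanishesAt 10000019 (10 ^ 186 + 9) tablesLG (WordSum.treeLG (.ishii .p12 .p01)) = true := by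
  decide +kernel

theorem smallAt_fourStrand_V :
    smallAt 10000019 (10 ^ 85 + 7) tablesV (WordSum.treeV .fourStrand) = true := by
  decide +kernel

theorem vanishesAt_fourStrand_V :
    vanishesAt 10000019 (10 ^ 85 + 7) tablesV (WordSum.treeV .fourStrand) = true := by
  decide +kernel

theorem smallAt_fourStrand_LG :
    smallAt 10000019 (10 ^ 186 + 9) tablesLG (WordSum.treeLG .fourStrand) = true := by
  decide +kernel

theorem vanishesAt_fourStrand_LG :
    vanishesAt 10000019 (10 ^ 186 + 9) tablesLG (WordSum.treeLG .fourStrand) = true := by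
  decide +kernel

end Computations

/-! ### From four strands to any number of strands -/

section Transport

open Matrix

variable {K : Type*} [Field K] {ι : Type*} [Fintype ι] [DecidableEq ι]
  {P Q : Type*} [Fintype P] [DecidableEq P] [Fintype Q] [DecidableEq Q]

/-- If the letters act on the tensor factors in the image of `e` as the letters of a smaller tensor
power do, then so do all combinations of words. -/
theorem WordTree.mat_mulVec_extend (ev : PolyExpr → K) {e : Q → P}
    {LP : Pos → Bool → Matrix (P → ι) (P → ι) K} {LQ : Pos → Bool → Matrix (Q → ι) (Q → ι) K}
    {S : Pos → Prop} (h : ∀ p, S p → ∀ s φ f g, (LP p s *ᵥ φ) (Function.extend e g f) =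
      (LQ p s *ᵥ fun g' => φ (Function.extend e g' f)) g) {t : WordTree} (ht : t.Uses S)
    (φ : (P → ι) → K) (f : P → ι) (g : Q → ι) :
    (t.mat ev LP *ᵥ φ) (Function.extend e g f) =
      (t.mat ev LQ *ᵥ fun g' => φ (Function.extend e g' f)) g := by
  induction t generalizing φ g with
  | nil => simp [mat]
  | emit a t ih => simp [mat, add_mulVec, smul_mulVec, ih ht]
  | letter p s u t ihu iht =>
    rw [mat, mat, add_mulVec, add_mulVec, Pi.add_apply, Pi.add_apply, iht ht.2.2, ← mulVec_mulVec,
      ← mulVec_mulVec, h p ht.1]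
    simp only [ihu ht.2.1]

/-- A combination of words that vanishes on a smaller tensor power vanishes on a larger one. -/
theorem WordTree.mat_eq_zero_of_extend (ev : PolyExpr → K) {e : Q → P} (he : Function.Injective e)
    {LP : Pos → Bool → Matrix (P → ι) (P → ι) K} {LQ : Pos → Bool → Matrix (Q → ι) (Q → ι) K}
    {S : Pos → Prop} (h : ∀ p, S p → ∀ s φ f g, (LP p s *ᵥ φ) (Function.extend e g f) =
      (LQ p s *ᵥ fun g' => φ (Function.extend e g' f)) g) {t : WordTree} (ht : t.Uses S)
    (h0 : t.mat ev LQ = 0) : t.mat ev LP = 0 := by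
  refine matrix_ext_mulVec fun φ f => ?_
  have hf : f = Function.extend e (f ∘ e) f := by
    funext k
    by_cases hk : ∃ j, e j = k
    · obtain ⟨j, rfl⟩ := hk
      simp [he.extend_apply]
    · simp [Function.extend_apply' _ _ _ hk]
  rw [hf, WordTree.mat_mulVec_extend ev h ht, h0]
  simp

/-- A combination of words that vanishes on a larger tensor power vanishes on a smaller one. -/
theorem WordTree.mat_eq_zero_of_extend_eq_zero [Nonempty ι] (ev : PolyExpr → K) {e : Q → P}
    (he : Function.Injective e)
    {LP : Pos → Bool → Matrix (P → ι) (P → ι) K} {LQ : Pos → Bool → Matrix (Q → ι) (Q → ι) K}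
    {S : Pos → Prop} (h : ∀ p, S p → ∀ s φ f g, (LP p s *ᵥ φ) (Function.extend e g f) =
      (LQ p s *ᵥ fun g' => φ (Function.extend e g' f)) g) {t : WordTree} (ht : t.Uses S)
    (h0 : t.mat ev LP = 0) : t.mat ev LQ = 0 := by
  refine matrix_ext_mulVec fun φ g => ?_
  have := WordTree.mat_mulVec_extend ev h ht (fun F => φ (F ∘ e)) (Classical.arbitrary _) g
  rw [h0] at this
  have hc : ∀ (g' : Q → ι) (f : P → ι), Function.extend e g' f ∘ e = g' := fun g' f => by
    funext j
    simp [he.extend_apply]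
  simp only [hc] at this
  simpa using this.symm

/-- A relation on four strands that uses only some of the strands holds at all positions: `i` tells
which of the four strands are used, and `e` where they are. -/
theorem WordTree.mat_localOp_eq_zero {ev : PolyExpr → K} {T : Bool → Table} {t : WordTree}
    (h : t.mat ev (tableOps ev T) = 0) {S : Pos → Prop} (hS : t.Uses S) {i : Q → Fin 4}
    (hi : Function.Injective i) {e : Q → P} (he : Function.Injective e) {l r : Pos → Q}
    (hl : ∀ p, S p → i (l p) = p.left) (hr : ∀ p, S p → i (r p) = p.right) :
    t.mat ev (fun p s => localOp ((T s).mat ev) (e (l p)) (e (r p))) = 0 := by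
  have hlr : ∀ p, S p → l p ≠ r p := fun p hp hlr => p.left_ne_right
    (by rw [← hl p hp, ← hr p hp, hlr])
  have h1 : t.mat ev (fun p s => localOp ((T s).mat ev) (l p) (r p)) = 0 := by
    refine mat_eq_zero_of_extend_eq_zero ev hi (fun p hp s φ f g => ?_) hS h
    rw [tableOps, ← hl p hp, ← hr p hp]
    exact localOp_mulVec_extend hi _ (hlr p hp) φ f g
  exact mat_eq_zero_of_extend ev he
    (fun p hp s φ f g => localOp_mulVec_extend he _ (hlr p hp) φ f g) hS h1

end Transport

/-! ### Rescaling of letters and of basis vectors -/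

section Rescale

theorem localOp_smul {K : Type*} [Field K] {ι : Type*} [DecidableEq ι] {P : Type*} [Fintype P]
    [DecidableEq P] (c : K) (M : Matrix (ι × ι) (ι × ι) K) (p q : P) :
    localOp (c • M) p q = c • localOp M p q := by
  ext f g
  simp [localOp]

variable {K : Type*} [Field K] {ι : Type*} [Fintype ι] [DecidableEq ι]
  {P : Type*} [Fintype P] [DecidableEq P]

/-- The diagonal matrix on `V ⊗ V` that is induced by `v_x ↦ δ x • v_x`. -/
def gauge₂ (δ : ι → K) : Matrix (ι × ι) (ι × ι) K := Matrix.diagonal fun x => δ x.1 * δ x.2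

/-- The diagonal matrix on a tensor power of `V` that is induced by `v_x ↦ δ x • v_x`. -/
def gauge (P : Type*) [Fintype P] [DecidableEq P] (δ : ι → K) : Matrix (P → ι) (P → ι) K :=
  Matrix.diagonal fun f => ∏ k, δ (f k)

theorem localOp_mul_gauge {δ : ι → K} {M M' : Matrix (ι × ι) (ι × ι) K}
    (h : M * gauge₂ δ = gauge₂ δ * M') {p q : P} (hpq : p ≠ q) :
    localOp M p q * gauge P δ = gauge P δ * localOp M' p q := by
  ext f g
  simp only [gauge, Matrix.mul_diagonal, Matrix.diagonal_mul, localOp, Matrix.of_apply]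
  split_ifs with hfg
  · have h1 := congrFun (congrFun h (f p, f q)) (g p, g q)
    simp only [gauge₂, Matrix.mul_diagonal, Matrix.diagonal_mul] at h1
    -- the factors at the sites other than `p` and `q` agree on the two sides
    rw [← Finset.prod_mul_prod_compl {p, q} fun k => δ (f k),
      ← Finset.prod_mul_prod_compl {p, q} fun k => δ (g k), Finset.prod_pair hpq,
      Finset.prod_pair hpq]
    have h2 : ∏ k ∈ {p, q}ᶜ, δ (f k) = ∏ k ∈ {p, q}ᶜ, δ (g k) :=
      Finset.prod_congr rfl fun k hk => by
        simp only [Finset.mem_compl, Finset.mem_insert, Finset.mem_singleton, not_or] at hk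
        rw [hfg k hk.1 hk.2]
    rw [h2]
    linear_combination (∏ k ∈ {p, q}ᶜ, δ (g k)) * h1
  · simp

theorem eq_zero_of_mul_gauge {δ : ι → K} (hδ : ∀ x, δ x ≠ 0) {W : Matrix (P → ι) (P → ι) K}
    (h : W * gauge P δ = 0) : W = 0 := by
  ext f g
  have := congrFun (congrFun h f) g
  simp only [gauge, Matrix.mul_diagonal, Matrix.zero_apply, mul_eq_zero] at this
  exact this.resolve_right (Finset.prod_ne_zero_iff.2 fun k _ => hδ _)

namespace WordSum

/-- The matrix of a linear combination of words in the operators `U p true` and `U p false`. -/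
def mat {A : Type*} [Semiring A] {R : Type*} [CommRing R] [Module R A] (x y : R)
    (U : Pos → Bool → A) (l : WordSum) : A :=
  (l.map fun a => a.1.eval x y • (a.2.map fun q => U q.1 q.2).prod).sum

theorem prod_scale {n : Type*} [Fintype n] [DecidableEq n] (a b : K)
    (U : Pos → Bool → Matrix n n K) (w : List Letter) :
    (w.map fun q => (bif q.2 then a else b) • U q.1 q.2).prod =
      (a ^ count true w * b ^ count false w) • (w.map fun q => U q.1 q.2).prod := by
  induction w with
  | nil => simp [count]
  | cons q w ih =>
    obtain ⟨p, s⟩ := q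
    cases s <;> simp [count, ih, smul_smul, pow_succ] <;> congr 1 <;> ring

/-- The factors of the letters are the same for all words: `rescale` multiplies each word by the
powers of `lam` and `mu` that are missing in its own letters. -/
theorem mat_rescale {n : Type*} [Fintype n] [DecidableEq n] (x y : K) (u v lam mu : PolyExpr)
    (U : Pos → Bool → Matrix n n K) (l : WordSum) (hl : ∀ a ∈ l, a.2.length ≤ 4) :
    (l.rescale u v lam mu).mat (PolyExpr.eval x y)
        (fun p s => (bif s then lam.eval x y else mu.eval x y) • U p s) =
      (lam.eval x y ^ 4 * mu.eval x y ^ 4) • l.mat (u.eval x y) (v.eval x y) U := by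
  have hcount : ∀ s w, count s w ≤ w.length := by
    intro s w
    induction w with
    | nil => simp [count]
    | cons q w ih =>
      obtain ⟨p, s'⟩ := q
      cases s <;> cases s' <;> simp [count] <;> omega
  rw [rescale, WordTree.mat_ofList, mat, List.map_map, List.smul_sum, List.map_map]
  congr 1
  refine List.map_congr_left fun a ha => ?_
  simp only [Function.comp_apply, prod_scale, PolyExpr.eval_mul, PolyExpr.eval_pow,
    PolyExpr.eval_subst, smul_smul]
  congr 1
  have h1 := pow_sub_mul_pow (lam.eval x y) ((hcount true a.2).trans (hl a ha))
  have h2 := pow_sub_mul_pow (mu.eval x y) ((hcount false a.2).trans (hl a ha))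
  rw [← h1, ← h2]
  ring

end WordSum

/-- The tables `T`, evaluated at the point `(x, y)`, describe the matrices `a R` and `b R⁻¹`,
conjugated by the rescaling `v_i ↦ δ i • v_i` of the basis.  The factors `a` and `b` and the
rescaling make the entries polynomial in `x` and `y`. -/
structure IsModel (R : RMatrix K (Fin 4)) (T : Bool → Table) (x y a b : K) (δ : Fin 4 → K) :
    Prop where
  ne_zero_left : a ≠ 0
  ne_zero_right : b ≠ 0
  gauge_ne_zero : ∀ i, δ i ≠ 0
  intertwine : (a • R.mat) * gauge₂ δ = gauge₂ δ * (T true).mat (PolyExpr.eval x y)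
  mul_inv : (T true).mat (PolyExpr.eval x y) * (T false).mat (PolyExpr.eval x y) = (a * b) • 1

theorem IsModel.localOp_intertwine {R : RMatrix K (Fin 4)} {T : Bool → Table} {x y a b : K}
    {δ : Fin 4 → K} (h : IsModel R T x y a b δ) {p q : P} (hpq : p ≠ q)
    (U : (Matrix (P → Fin 4) (P → Fin 4) K)ˣ) (hU : (U : Matrix _ _ K) = localOp R.mat p q)
    (s : Bool) :
    ((bif s then a else b) • ((bif s then U else U⁻¹ : (Matrix (P → Fin 4) (P → Fin 4) K)ˣ) :
        Matrix (P → Fin 4) (P → Fin 4) K)) * gauge P δ =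
      gauge P δ * localOp ((T s).mat (PolyExpr.eval x y)) p q := by
  have h1 := localOp_mul_gauge h.intertwine hpq
  rw [localOp_smul, ← hU] at h1
  cases s
  · have h2 : localOp ((T true).mat (PolyExpr.eval x y)) p q *
        localOp ((T false).mat (PolyExpr.eval x y)) p q = (a * b) • 1 := by
      rw [← localOp_mul _ _ hpq, h.mul_inv, localOp_smul, localOp_one hpq]
    have h3 := congrArg (fun W => (↑U⁻¹ : Matrix (P → Fin 4) (P → Fin 4) K) *
      (W * localOp ((T false).mat (PolyExpr.eval x y)) p q)) h1
    simp only [mul_assoc, h2, Matrix.smul_mul, Matrix.mul_smul, Units.inv_mul_cancel_left,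
      mul_one] at h3
    simp only [cond_false, Matrix.smul_mul]
    rw [mul_smul] at h3
    exact (smul_right_injective _ h.ne_zero_left h3).symm
  · exact h1

/-- The relation `l` holds for an R-matrix if it holds for its tables on four strands. -/
theorem IsModel.mat_eq_zero {R : RMatrix K (Fin 4)} {T : Bool → Table} {x y : K}
    {u v lam mu : PolyExpr} {δ : Fin 4 → K}
    (h : IsModel R T x y (lam.eval x y) (mu.eval x y) δ) {l : WordSum}
    (hl : ∀ a ∈ l, a.2.length ≤ 4)
    (h0 : (l.rescale u v lam mu).mat (PolyExpr.eval x y) (tableOps (PolyExpr.eval x y) T) = 0)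
    {S : Pos → Prop} (hS : (l.rescale u v lam mu).Uses S) {Q : Type*} [Fintype Q] [DecidableEq Q]
    {i : Q → Fin 4} (hi : Function.Injective i) {e : Q → P} (he : Function.Injective e)
    {lt rt : Pos → Q} (hlr : ∀ p, lt p ≠ rt p) (hlt : ∀ p, S p → i (lt p) = p.left)
    (hrt : ∀ p, S p → i (rt p) = p.right) {U : Pos → (Matrix (P → Fin 4) (P → Fin 4) K)ˣ}
    (hU : ∀ p, (U p : Matrix _ _ K) = localOp R.mat (e (lt p)) (e (rt p))) :
    l.mat (u.eval x y) (v.eval x y)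
      (fun p s => ((bif s then U p else (U p)⁻¹ : (Matrix (P → Fin 4) (P → Fin 4) K)ˣ) :
        Matrix (P → Fin 4) (P → Fin 4) K)) = 0 := by
  have h1 := WordTree.mat_localOp_eq_zero h0 hS hi he hlt hrt
  have h2 := WordTree.mat_mul_of_intertwine (PolyExpr.eval x y) _
    (fun p s => h.localOp_intertwine (he.ne (hlr p)) (U p) (hU p) s) (l.rescale u v lam mu)
  rw [h1, mul_zero, WordSum.mat_rescale _ _ _ _ _ _ _ _ hl] at h2
  have h3 := eq_zero_of_mul_gauge h.gauge_ne_zero h2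
  exact (smul_eq_zero.1 h3).resolve_left
    (mul_ne_zero (pow_ne_zero _ h.ne_zero_left) (pow_ne_zero _ h.ne_zero_right))

end Rescale

/-! ### The two R-matrices and their tables -/

section Models

open Matrix

variable {K : Type*} [Field K]

theorem Table.mat_mulVec (ev : PolyExpr → K) (T : Table) (φ : Fin 4 × Fin 4 → K) (a b : Label) :
    (T.mat ev *ᵥ φ) (a.toFin, b.toFin) =
      ((T a b).map fun t => ev t.2.2 * φ (t.1.toFin, t.2.1.toFin)).sum :=
  T.sum_mat_mul ev a b φ

theorem matrix_ext_label {A B : Matrix (Fin 4 × Fin 4) (Fin 4 × Fin 4) K}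
    (h : ∀ φ (a b : Label), (A *ᵥ φ) (a.toFin, b.toFin) = (B *ᵥ φ) (a.toFin, b.toFin)) : A = B :=
  matrix_ext_mulVec fun φ f => by
    simpa [Label.toFin_ofFin] using h φ (Label.ofFin f.1) (Label.ofFin f.2)

theorem gauge₂_mulVec {ι : Type*} [Fintype ι] [DecidableEq ι] (δ : ι → K) (φ : ι × ι → K) :
    gauge₂ δ *ᵥ φ = fun x => δ x.1 * δ x.2 * φ x := by
  ext x
  simp [gauge₂, Matrix.mulVec_diagonal]

set_option linter.unusedSimpArgs false in
theorem isModel_V {x y : K} (hx : x ≠ 0) (hy : y ≠ 0) {R : RMatrix K (Fin 4)}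
    (hR : R.mat = ofTable (tableV x y 1)) :
    IsModel R tablesV x y y (x * y) 1 where
  ne_zero_left := hy
  ne_zero_right := mul_ne_zero hx hy
  gauge_ne_zero _ := one_ne_zero
  intertwine := by
    refine matrix_ext_label fun φ a b => ?_
    simp only [← mulVec_mulVec, gauge₂_mulVec, smul_mulVec, Pi.smul_apply, hR, Table.mat_mulVec]
    simp only [mulVec_pair]
    have h := fun ψ => rowV x y 1 ψ
    simp only [forall_and] at h
    obtain ⟨g1, g2, g3, g4, g5, g6, g7, g8, g9, g10, g11, g12, g13, g14, g15, g16⟩ := h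
    cases a <;> cases b <;>
    · simp [Label.toFin, tablesV, tableVPos, g1, g2, g3, g4, g5, g6, g7, g8, g9, g10, g11, g12,
        g13, g14, g15, g16]
      try field_simp
      try ring
  mul_inv := by
    refine matrix_ext_label fun φ a b => ?_
    simp only [← mulVec_mulVec, smul_mulVec, one_mulVec, Pi.smul_apply, Table.mat_mulVec]
    cases a <;> cases b <;>
    · simp [Label.toFin, tablesV, tableVPos, tableVNeg]
      try first | ring1 | exact Or.inl (by ring)

set_option linter.unusedSimpArgs false in
theorem isModel_LG {x y c : K} (hx : x ≠ 0) (hy : y ≠ 0) (hc : c ≠ 0)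
    (hcsq : c ^ 2 = (x ^ 2 - 1) * (1 - y ^ 2)) {R : RMatrix K (Fin 4)}
    (hR : R.mat = ofTable (tableLG (x ^ 2) (y ^ 2) x y c)) :
    IsModel R tablesLG x y 1 (x ^ 2 * y ^ 2) ![1, 1, 1, c] where
  ne_zero_left := one_ne_zero
  ne_zero_right := mul_ne_zero (pow_ne_zero _ hx) (pow_ne_zero _ hy)
  gauge_ne_zero := forall_fin4 one_ne_zero one_ne_zero one_ne_zero hc
  intertwine := by
    refine matrix_ext_label fun φ a b => ?_
    simp only [← mulVec_mulVec, gauge₂_mulVec, smul_mulVec, Pi.smul_apply, hR, Table.mat_mulVec]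
    simp only [mulVec_pair]
    have h := fun ψ => rowLG (x ^ 2) (y ^ 2) x y c ψ
    simp only [forall_and] at h
    obtain ⟨g1, g2, g3, g4, g5, g6, g7, g8, g9, g10, g11, g12, g13, g14, g15, g16⟩ := h
    cases a <;> cases b <;>
    · simp [Label.toFin, tablesLG, tableLGPos, g1, g2, g3, g4, g5, g6, g7, g8, g9, g10, g11, g12,
        g13, g14, g15, g16, ← hcsq]
      try first | ring1 | linear_combination (-(x * y) * φ (3, 0)) * hcsq
  mul_inv := by
    refine matrix_ext_label fun φ a b => ?_
    simp only [← mulVec_mulVec, smul_mulVec, one_mulVec, Pi.smul_apply, Table.mat_mulVec]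
    cases a <;> cases b <;>
    · simp [Label.toFin, tablesLG, tableLGPos, tableLGNeg]
      try ring

end Models

/-! ### Words in the group algebra -/

section Linking

variable {K : Type*} [Field K] [Algebra QT K] {n : ℕ}

/-- The letters at the three pairs of positions, as the generators `g` of the braid group. -/
noncomputable def braidLetter (g : Pos → Fin (n - 1)) (p : Pos) (s : Bool) : BraidAlgebra n :=
  bif s then S (g p) else S' (g p)

theorem algRep_S {ι : Type*} [Fintype ι] [DecidableEq ι] (R : RMatrix K ι) (i : Fin (n - 1)) :
    R.algRep n (S i) = ↑(R.genOp i) := by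
  simp [RMatrix.algRep, RMatrix.braidRep, S, sgen]

theorem algRep_S' {ι : Type*} [Fintype ι] [DecidableEq ι] (R : RMatrix K ι) (i : Fin (n - 1)) :
    R.algRep n (S' i) = ↑(R.genOp i)⁻¹ := by
  simp [RMatrix.algRep, RMatrix.braidRep, S', sgen]

/-- The braid representation of a combination of words in the group algebra is the same combination
of words in the operators of the R-matrix. -/
theorem WordSum.algRep_mat (R : RMatrix K (Fin 4)) (g : Pos → Fin (n - 1)) (l : WordSum) :
    R.algRep n (l.mat t₀ t₁ (braidLetter g)) =
      l.mat (algebraMap QT K t₀) (algebraMap QT K t₁)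
        (fun p s => ↑(bif s then R.genOp (g p) else (R.genOp (g p))⁻¹)) := by
  have hletter : ∀ p s, R.algRep n (braidLetter g p s) =
      ↑(bif s then R.genOp (g p) else (R.genOp (g p))⁻¹) := by
    intro p s
    cases s
    · exact algRep_S' R (g p)
    · exact algRep_S R (g p)
  simp only [WordSum.mat, map_list_sum, List.map_map, map_smul, map_list_prod, Function.comp_def,
    hletter, ← PolyExpr.map_eval, algebraMap_smul]

theorem WordTree.uses_single {S : Pos → Prop} (e : PolyExpr) {w : List Letter}
    (hw : ∀ q ∈ w, S q.1) : (single e w).Uses S := by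
  induction w with
  | nil => trivial
  | cons q w ih =>
    rw [List.forall_mem_cons] at hw
    exact ⟨hw.1, ih hw.2, trivial⟩

theorem WordTree.uses_insert {S : Pos → Prop} (e : PolyExpr) {t : WordTree} (ht : t.Uses S)
    {w : List Letter} (hw : ∀ q ∈ w, S q.1) : (t.insert e w).Uses S := by
  induction t generalizing w with
  | nil => exact uses_single e hw
  | emit e' t ih => exact ih ht hw
  | letter p s u t ihu iht =>
    cases w with
    | nil => exact ⟨ht.1, ht.2.1, iht ht.2.2 hw⟩
    | cons q w =>
      rw [insert]
      split
      · exact ⟨ht.1, ihu ht.2.1 (List.forall_mem_cons.1 hw).2, ht.2.2⟩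
      · exact ⟨ht.1, ht.2.1, iht ht.2.2 hw⟩

theorem WordTree.uses_ofList {S : Pos → Prop} {l : List (PolyExpr × List Letter)}
    (hl : ∀ a ∈ l, ∀ q ∈ a.2, S q.1) : (ofList l).Uses S := by
  induction l with
  | nil => trivial
  | cons a l ih =>
    rw [List.forall_mem_cons] at hl
    exact uses_insert a.1 (ih hl.2) hl.1

theorem WordSum.uses_rescale {S : Pos → Prop} {u v lam mu : PolyExpr} {l : WordSum}
    (hl : ∀ a ∈ l, ∀ q ∈ a.2, S q.1) : (l.rescale u v lam mu).Uses S :=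
  WordTree.uses_ofList fun a ha => by
    obtain ⟨b, hb, rfl⟩ := List.mem_map.1 ha
    exact hl b hb

end Linking

/-! ### The skein relations as combinations of words -/

section Relations

variable {n : ℕ}

theorem skeinR1_eq_mat (g : Pos → Fin (n - 1)) (p : Pos) :
    skeinR1 (g p) = (WordSum.cubic p).mat t₀ t₁ (braidLetter g) := by
  simp [skeinR1, WordSum.mat, WordSum.cubic, braidLetter, sq, add_assoc]

theorem skeinR2_eq_mat (g : Pos → Fin (n - 1)) (p q : Pos) :
    skeinR2 (g p) (g q) = (WordSum.ishii p q).mat t₀ t₁ (braidLetter g) := by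
  simp only [skeinR2, WordSum.mat, WordSum.ishii, braidLetter, List.map_cons, List.map_nil,
    cond_true, cond_false, List.prod_cons, List.prod_nil, List.sum_cons, List.sum_nil,
    PolyExpr.eval_neg, PolyExpr.eval_one, neg_smul, one_smul, mul_one, mul_assoc]
  abel

theorem denom_eval_ne_zero : WordSum.denom.eval t₀ t₁ ≠ 0 := by
  -- a polynomial that does not vanish at the point `(2, 2)` is not zero
  have h : ∀ p : MvPolynomial (Fin 2) ℚ, MvPolynomial.eval (fun _ => 2) p ≠ 0 →
      algebraMap (MvPolynomial (Fin 2) ℚ) QT p ≠ 0 := by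
    intro p hp h0
    rw [map_eq_zero_iff _ (IsFractionRing.injective _ _)] at h0
    simp [h0] at hp
  rw [t₀, t₁, ← PolyExpr.map_eval]
  refine h _ ?_
  rw [PolyExpr.map_eval]
  simp [WordSum.denom]
  norm_num

end Relations

/-! ### The coefficients and words of the four-strand relation -/

section FourStrandData

theorem forall₂_ofFn_vecCons {α β : Type*} {r : α → β → Prop} {a : α} {l : List α} {n : ℕ} {b : β}
    {v : Fin n → β} : List.Forall₂ r (a :: l) (List.ofFn (Matrix.vecCons b v)) ↔
      r a b ∧ List.Forall₂ r l (List.ofFn v) := by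
  rw [Matrix.vecCons, List.ofFn_cons, List.forall₂_cons]

theorem forall₂_ofFn_vecEmpty {α β : Type*} {r : α → β → Prop} {v : Fin 0 → β} :
    List.Forall₂ r [] (List.ofFn v) := by
  simp

/-- The value of a letter when the generators are elements of a group. -/
def Letter.toGroup {G : Type*} [Group G] (g : Pos → G) (q : Letter) : G :=
  bif q.2 then g q.1 else (g q.1)⁻¹

/-- The words of `numerators` are the words `skeinWord`, in the same order. -/
theorem WordSum.forall₂_word {G : Type*} [Group G] (g : Pos → G) :
    List.Forall₂ (fun a w => (a.2.map (Letter.toGroup g)).prod = w) WordSum.numerators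
      (List.ofFn (skeinWord (g .p01) (g .p12) (g .p23))) := by
  simp only [numerators, numeratorsXY, numeratorsYZ, numeratorsXOuter, numeratorsMixed,
    numeratorsZLeft, numeratorsZRight, numeratorsLong, List.cons_append, List.nil_append,
    skeinWord, forall₂_ofFn_vecCons, forall₂_ofFn_vecEmpty, List.map_cons, List.map_nil,
    List.prod_cons, List.prod_nil, Letter.toGroup, cond_true, cond_false, mul_one, mul_assoc,
    and_self]

set_option linter.unusedSimpArgs false in
set_option maxHeartbeats 4000000 in
/-- The coefficients of `numerators`, divided by `denom`, are the coefficients `skeinCoeff`, in the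
same order. -/
theorem WordSum.forall₂_coeff {F : Type*} [Field F] {x y : F} (hd : denom.eval x y ≠ 0) :
    List.Forall₂ (fun a c => a.1.eval x y = denom.eval x y * c) WordSum.numerators
      (List.ofFn (skeinCoeff x y)) := by
  simp only [denom, PolyExpr.eval_add, PolyExpr.eval_mul, PolyExpr.eval_sub, PolyExpr.eval_one,
    PolyExpr.eval_X, PolyExpr.eval_Y, mul_ne_zero_iff] at hd
  obtain ⟨⟨⟨⟨⟨⟨h1, h2⟩, h3⟩, h4⟩, h5⟩, h6⟩, h7⟩ := hd
  simp only [numerators, numeratorsXY, numeratorsYZ, numeratorsXOuter, numeratorsMixed,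
    numeratorsZLeft, numeratorsZRight, numeratorsLong, List.cons_append, List.nil_append,
    skeinCoeff, forall₂_ofFn_vecCons, forall₂_ofFn_vecEmpty, and_true]
  and_intros
  all_goals
    simp only [a1, a2, a3, a4, a5, a6, a7, a8, a9, a10, a11, a12, a13, a14, a15, a16, a17,
      a18, a19, a20, a21, a22, a23, a24, a25, a26, a27, a28, a29, a30, a31, a32, a33, a34, a35,
      a36, a37, a38, a39, a40, a41, a42, a43, a44, a45, a46, a47, a48, a49, a50, a51, a52, a53,
      a54, a55, a56, a57, a58, a59, a60, a61, a62, a63, a64, a65, a66, a67, a68, a69, a70, a71,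
      a72, a73, a74, a75, a76, a77, a78, denom, pP, pQ, pN, pM, pL, p1, p14, p15, p16, p22, p23,
      p30, p33, p34, p39, p41, p43, PolyExpr.eval_add, PolyExpr.eval_mul, PolyExpr.eval_sub,
      PolyExpr.eval_one, PolyExpr.eval_neg, PolyExpr.eval_pow, PolyExpr.eval_ofNat,
      PolyExpr.eval_X, PolyExpr.eval_Y]
    field_simp
    try ring

end FourStrandData

/-! ### The skein relations in the braid representations -/

/-- The function with given values at the three pairs of positions. -/
def Pos.elim {α : Type*} (a b c : α) : Pos → α
  | p01 => a
  | p12 => b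
  | p23 => c

section Skein

variable {K : Type*} [Field K] [Algebra QT K] {n : ℕ}

/-- Two indexed families that match a list of words entry by entry give the same element of the
group algebra, up to the common denominator `d`. -/
theorem sum_words_eq {d : QT} {m : ℕ} {x y : QT} (g : Pos → BraidGroup n) {l : WordSum}
    {c : Fin m → QT} {w : Fin m → BraidGroup n}
    (hc : List.Forall₂ (fun a c => a.1.eval x y = d * c) l (List.ofFn c))
    (hw : List.Forall₂ (fun a w => (a.2.map (Letter.toGroup g)).prod = w) l (List.ofFn w)) :
    (l.map fun a => a.1.eval x y • br (a.2.map (Letter.toGroup g)).prod).sum =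
      d • ∑ k, c k • br (w k) := by
  induction m generalizing l with
  | zero =>
    rw [List.ofFn_zero, List.forall₂_nil_right_iff] at hc
    simp [hc]
  | succ m ih =>
    rw [List.ofFn_succ] at hc hw
    cases hc with
    | cons h1 h2 =>
      cases hw with
      | cons h3 h4 =>
        rw [List.map_cons, List.sum_cons, ih h2 h4, Fin.sum_univ_succ, smul_add, h1, h3, mul_smul]

theorem prod_braidLetter (g : Pos → Fin (n - 1)) (w : List Letter) :
    (w.map fun q => braidLetter g q.1 q.2).prod =
      br (w.map (Letter.toGroup fun p => sgen (g p))).prod := by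
  rw [br, map_list_prod, List.map_map]
  congr 1
  refine List.map_congr_left fun q _ => ?_
  obtain ⟨p, s⟩ := q
  cases s <;> rfl

theorem denom_smul_skeinR3 (g : Pos → Fin (n - 1)) :
    WordSum.denom.eval t₀ t₁ • skeinR3 (g .p01) (g .p12) (g .p23) =
      WordSum.fourStrand.mat t₀ t₁ (braidLetter g) := by
  have h := sum_words_eq (fun p => sgen (g p)) (WordSum.forall₂_coeff denom_eval_ne_zero)
    (WordSum.forall₂_word fun p => sgen (g p))
  have hneg : ∀ (l : WordSum) (f : PolyExpr × List Letter → BraidAlgebra n),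
      (l.map fun a => -f a).sum = -(l.map f).sum := by
    intro l f
    induction l with
    | nil => simp
    | cons a l ih => rw [List.map_cons, List.sum_cons, ih, List.map_cons, List.sum_cons, neg_add]
  simp only [WordSum.mat, WordSum.fourStrand, prod_braidLetter, List.map_cons, List.map_map,
    Function.comp_def, PolyExpr.eval_neg, neg_smul, List.sum_cons, hneg, h, skeinR3, smul_sub]
  simp only [List.prod_cons, List.map_nil, List.prod_nil, Letter.toGroup, cond_true, cond_false,
    mul_one, map_mul, mul_assoc]
  abel

/-- If a combination of words vanishes for the tables of an R-matrix on four strands, then it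
vanishes in the braid representation, wherever the strands are. -/
theorem IsModel.algRep_mat_eq_zero {R : RMatrix K (Fin 4)} {T : Bool → Table} {x y : K}
    {u v lam mu : PolyExpr} {δ : Fin 4 → K}
    (h : IsModel R T x y (lam.eval x y) (mu.eval x y) δ)
    (hu : u.eval x y = algebraMap QT K t₀) (hv : v.eval x y = algebraMap QT K t₁) {l : WordSum}
    (hl : ∀ a ∈ l, a.2.length ≤ 4)
    (h0 : (l.rescale u v lam mu).mat (PolyExpr.eval x y) (tableOps (PolyExpr.eval x y) T) = 0)
    {S : Pos → Prop} (hS : ∀ a ∈ l, ∀ q ∈ a.2, S q.1) {Q : Type*} [Fintype Q] [DecidableEq Q]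
    {i : Q → Fin 4} (hi : Function.Injective i) {e : Q → Fin n} (he : Function.Injective e)
    {lt rt : Pos → Q} (hlt : ∀ p, S p → i (lt p) = p.left)
    (hrt : ∀ p, S p → i (rt p) = p.right) {g : Pos → Fin (n - 1)}
    (hgl : ∀ p, posL (g p) = e (lt p)) (hgr : ∀ p, posR (g p) = e (rt p)) :
    R.algRep n (l.mat t₀ t₁ (braidLetter g)) = 0 := by
  rw [WordSum.algRep_mat, ← hu, ← hv]
  refine h.mat_eq_zero hl h0 (WordSum.uses_rescale hS) hi he (fun p hp => ?_) hlt hrt fun p => ?_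
  · exact RMatrix.posL_ne_posR (g p) (by rw [hgl, hgr, hp])
  · rw [← hgl, ← hgr]; rfl

/-- An R-matrix with polynomial tables satisfies all skein relations in every braid group if its
tables satisfy four relations on four strands: the cubic relation, Ishii's relation for `j = i + 1`
and for `i = j + 1`, and the relation with 78 terms. -/
theorem IsModel.vanishesOnSkein {R : RMatrix K (Fin 4)} {T : Bool → Table} {x y : K}
    {u v lam mu : PolyExpr} {δ : Fin 4 → K}
    (h : IsModel R T x y (lam.eval x y) (mu.eval x y) δ)
    (hu : u.eval x y = algebraMap QT K t₀) (hv : v.eval x y = algebraMap QT K t₁)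
    (h0 : ∀ l ∈ [WordSum.cubic .p01, .ishii .p01 .p12, .ishii .p12 .p01, .fourStrand],
      (WordSum.rescale u v lam mu l).mat (PolyExpr.eval x y) (tableOps (PolyExpr.eval x y) T) = 0) :
    VanishesOnSkein (R.algRep n) := by
  simp only [List.forall_mem_cons, List.not_mem_nil, IsEmpty.forall_iff, implies_true,
    and_true] at h0
  obtain ⟨hcubic, hishii, hishii', hfour⟩ := h0
  refine ⟨fun i => ?_, fun i j hij => ?_, fun i j k hj hk => ?_⟩
  · rw [skeinR1_eq_mat (fun _ => i) .p01]
    refine h.algRep_mat_eq_zero hu hv (by decide) hcubic (S := fun p => p = .p01)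
      (by simp [WordSum.cubic]) (Fin.castLE_injective (show 2 ≤ 4 by omega))
      (e := ![posL i, posR i]) ?_ (lt := fun _ => 0) (rt := fun _ => 1) ?_ ?_
      (fun _ => rfl) fun _ => rfl
    · have := RMatrix.posL_ne_posR i
      intro a b
      fin_cases a <;> fin_cases b <;> simp [this, this.symm]
    · rintro p rfl; rfl
    · rintro p rfl; rfl
  · have key : ∀ (i j : Fin (n - 1)), j.val = i.val + 1 →
        ∀ l ∈ [WordSum.ishii .p01 .p12, .ishii .p12 .p01],
        R.algRep n (l.mat t₀ t₁ (braidLetter (Pos.elim i j j))) = 0 := by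
      intro i j hij l hl
      -- three strands: the pairs of positions `01` and `12` are at `i` and `j`; the third pair does
      -- not occur in the words
      refine h.algRep_mat_eq_zero hu hv (l := l) ?_ ?_ (S := fun p => p.right ≤ 2)
        ?_ (Fin.castLE_injective (show 3 ≤ 4 by omega))
        (e := fun k => ⟨i + k, by omega⟩) ?_ (lt := Pos.elim 0 1 1) (rt := Pos.elim 1 2 2) ?_ ?_
        ?_ ?_
      · revert l; decide
      · simp only [List.mem_cons, List.not_mem_nil, or_false] at hl
        rcases hl with rfl | rfl
        · exact hishii
        · exact hishii'
      · revert l; decide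
      · intro a b hab
        simp only [Fin.mk.injEq] at hab
        omega
      · intro p hp
        cases p <;> first | rfl | exact absurd hp (by decide)
      · intro p hp
        cases p <;> first | rfl | exact absurd hp (by decide)
      · intro p; cases p <;> simp [posL, Pos.elim, hij]
      · intro p; cases p <;> simp [posR, Pos.elim, hij]
    rcases hij with hij | hij
    · exact (congrArg _ (skeinR2_eq_mat (Pos.elim i j j) .p01 .p12)).trans
        (key i j hij _ (by simp))
    · exact (congrArg _ (skeinR2_eq_mat (Pos.elim j i i) .p12 .p01)).trans
        (key j i hij _ (by simp))
  · have h1 : R.algRep n (WordSum.fourStrand.mat t₀ t₁ (braidLetter (Pos.elim i j k))) = 0 := by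
      refine h.algRep_mat_eq_zero hu hv (by decide) hfour (S := fun _ => True) (by simp)
        Function.injective_id (e := fun a => ⟨i + a, by omega⟩) ?_ (lt := Pos.left)
        (rt := Pos.right) (fun _ _ => rfl) (fun _ _ => rfl) ?_ ?_
      · intro a b hab
        simp only [Fin.mk.injEq] at hab
        omega
      · intro p; cases p <;> simp [posL, hj, hk, Pos.elim, Pos.left]
      · intro p; cases p <;> simp [posR, hj, hk, Pos.elim, Pos.right]
    rw [← denom_smul_skeinR3, map_smul] at h1
    exact (smul_eq_zero.1 h1).resolve_left denom_eval_ne_zero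

/-- The link invariant of an R-matrix is a `ℚ(t₀, t₁)`-linear functional of the matrix of the
braid, so the relations that hold in the braid representation are skein relations. -/
theorem satisfiesSkein_linkInvariant (R : RMatrix K (Fin 4)) (h : Fin 4 → K)
    (hR : VanishesOnSkein (R.algRep (n + 1))) :
    SatisfiesSkein fun β : BraidGroup (n + 1) => R.linkInvariant h β := by
  let ℓ : Matrix (Fin (n + 1) → Fin 4) (Fin (n + 1) → Fin 4) K →ₗ[QT] K :=
    { toFun := fun W => (Fintype.card (Fin 4) : K)⁻¹ *
        ∑ x, ∑ f : Fin n → Fin 4, (∏ k, h (f k)) * W (Fin.cons x f) (Fin.cons x f)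
      map_add' := fun A B => by
        simp only [Matrix.add_apply, mul_add, Finset.sum_add_distrib]
      map_smul' := fun c A => by
        simp only [Matrix.smul_apply, mul_smul_comm, ← Finset.smul_sum, RingHom.id_apply] }
  have hℓ : ∀ x, linExt (fun β => R.linkInvariant h β) x = ℓ (R.algRep (n + 1) x) := by
    intro x
    rw [RMatrix.algRep, MonoidAlgebra.lift_apply, linExt, map_finsuppSum]
    refine Finsupp.sum_congr fun β _ => ?_
    rw [map_smul]
    rfl
  have hmul : ∀ (α β : BraidGroup (n + 1)) r, R.algRep (n + 1) r = 0 →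
      linExt (fun β => R.linkInvariant h β) (br α * r * br β) = 0 := by
    intro α β r hr
    rw [hℓ, map_mul (R.algRep (n + 1)), map_mul (R.algRep (n + 1)), hr, mul_zero,
      zero_mul, map_zero]
  exact fun α β => ⟨fun i => hmul _ _ _ (hR.1 i), fun i j hij => hmul _ _ _ (hR.2.1 i j hij),
    fun i j k hj hk => hmul _ _ _ (hR.2.2 i j k hj hk)⟩

theorem vanishesOnSkein_RV : VanishesOnSkein (RV.algRep n) := by
  refine IsModel.vanishesOnSkein (u := .X) (v := .Y) (lam := .Y) (mu := .X * .Y)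
    (isModel_V t₀_ne_zero t₁_ne_zero rfl) rfl rfl ?_
  simp only [List.forall_mem_cons, List.not_mem_nil, IsEmpty.forall_iff, implies_true, and_true]
  exact ⟨mat_eq_zero_of_check smallAt_cubic_V vanishesAt_cubic_V _ _,
    mat_eq_zero_of_check smallAt_ishii_V vanishesAt_ishii_V _ _,
    mat_eq_zero_of_check smallAt_ishii_V' vanishesAt_ishii_V' _ _,
    mat_eq_zero_of_check smallAt_fourStrand_V vanishesAt_fourStrand_V _ _⟩

theorem LGRoots.Y_ne_zero (w : LGRoots K) : w.Y ≠ 0 := by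
  intro h0
  have h := w.Y_sq
  have h1 : (t₀ - 1) * (1 - t₁) ≠ 0 := by
    rw [t₀, t₁, ← map_one (algebraMap (MvPolynomial (Fin 2) ℚ) QT), ← map_sub, ← map_sub,
      ← map_mul]
    intro h2
    rw [map_eq_zero_iff _ (IsFractionRing.injective _ _)] at h2
    have := congrArg (MvPolynomial.eval fun _ => (2 : ℚ)) h2
    norm_num at this
  rw [h0, ← map_one (algebraMap QT K), ← map_sub, ← map_sub, ← map_mul, zero_pow two_ne_zero,
    eq_comm, map_eq_zero] at h
  exact h1 h

theorem vanishesOnSkein_RLG (w : LGRoots K) : VanishesOnSkein ((RLG w).algRep n) := by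
  have ha : w.a ≠ 0 := fun h => by
    have := w.a_sq
    rw [h, zero_pow two_ne_zero, eq_comm, map_eq_zero] at this
    exact t₀_ne_zero this
  have hb : w.b ≠ 0 := fun h => by
    have := w.b_sq
    rw [h, zero_pow two_ne_zero, eq_comm, map_eq_zero] at this
    exact t₁_ne_zero this
  have hY : w.Y ^ 2 = (w.a ^ 2 - 1) * (1 - w.b ^ 2) := by rw [w.a_sq, w.b_sq, w.Y_sq]
  have hmodel := isModel_LG ha hb w.Y_ne_zero hY (R := RLG w) (by rw [w.a_sq, w.b_sq]; rfl)
  refine IsModel.vanishesOnSkein (u := .X ^ 2) (v := .Y ^ 2) (lam := 1) (mu := .X ^ 2 * .Y ^ 2)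
    (x := w.a) (y := w.b) (by simpa using hmodel) (by simp [w.a_sq]) (by simp [w.b_sq]) ?_
  simp only [List.forall_mem_cons, List.not_mem_nil, IsEmpty.forall_iff, implies_true, and_true]
  exact ⟨mat_eq_zero_of_check smallAt_cubic_LG vanishesAt_cubic_LG _ _,
    mat_eq_zero_of_check smallAt_ishii_LG vanishesAt_ishii_LG _ _,
    mat_eq_zero_of_check smallAt_ishii_LG' vanishesAt_ishii_LG' _ _,
    mat_eq_zero_of_check smallAt_fourStrand_LG vanishesAt_fourStrand_LG _ _⟩

end Skein

end LinksGould

/-- The R-matrices defining `V_1` and `LG` satisfy the cubic relation, Ishii's relation and the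
78-term four-strand relation in every braid group, and both link invariants satisfy these skein
relations. -/
theorem mainTheorem6 (n : ℕ) :
    (LinksGould.VanishesOnSkein (LinksGould.RV.algRep (n + 1)) ∧
      LinksGould.SatisfiesSkein (fun β : LinksGould.BraidGroup (n + 1) => LinksGould.V1 β)) ∧
    ∀ {K : Type*} [Field K] [Algebra LinksGould.QT K] (w : LinksGould.LGRoots K),
      LinksGould.VanishesOnSkein ((LinksGould.RLG w).algRep (n + 1)) ∧
      LinksGould.SatisfiesSkein (fun β : LinksGould.BraidGroup (n + 1) => LinksGould.LG w β) :=
  ⟨⟨LinksGould.vanishesOnSkein_RV,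
      LinksGould.satisfiesSkein_linkInvariant _ _ LinksGould.vanishesOnSkein_RV⟩,
    fun w => ⟨LinksGould.vanishesOnSkein_RLG w,
      LinksGould.satisfiesSkein_linkInvariant _ _ (LinksGould.vanishesOnSkein_RLG w)⟩⟩
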